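/- Let $G$ be a reductive Poisson linear algebraic group over $\mathbb{C}$ and let $X$ be a Poisson variety over $\mathbb{C}$ on which $G$ acts algebraically, such that the action map $a\colon G\times X\to X$ is a Poisson morphism. Here a *variety* is a reduced separated scheme of finite type over $\mathbb{C}$ (not necessarily irreducible). A *Poisson variety* is a variety $X$ whose structure sheaf $\mathcal{O}_X$ is a sheaf of Poisson $\mathbb{C}$-algebras; a morphism is *Poisson* if pull-back of functions preserves the brackets. A product $X\times Y$ of Poisson varieties carries the product Poisson structure, determined by $$\{\phi_1\otimes f_1,\phi_2\otimes f_2\}=\{\phi_1,\phi_2\}\otimes f_1f_2+\phi_1\phi_2\otimes\{f_1,f_2\}.$$ $G$ is a *Poisson algebraic group* if it is a Poisson variety and its multiplication $G\times G\to G$ is Poisson. $G$ is *reductive* if every finite-dimensional rational representation of $G$ is completely reducible. A function $f$ on a $G$-stable open set $U\subseteq X$ is *invariant* if $a^*f=p^*f$, where $p\colon G\times X\to X$ is the projection; $\mathcal{O}_X(U)^G$ is the algebra of these functions. Then the following hold. 1. For every $G$-stable open set $U\subseteq X$, $\mathcal{O}_X(U)^G$ is a Poisson subalgebra of $\mathcal{O}_X(U)$.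 2. (Affine case.) If $X$ is affine, then $X/\!\!/G=\operatorname{Spec}(\mathbb{C}[X]^G)$ is a variety, and it has a Poisson structure for which the quotient map $q\colon X\to X/\!\!/G$ (given by the inclusion $\mathbb{C}[X]^G\subseteq\mathbb{C}[X]$) is a Poisson morphism. 3. (Projective case.) Let $V$ be a finite-dimensional rational representation of $G$ and let $X$ be embedded $G$-equivariantly as a closed subvariety of $\mathbb{P}(V)$ (a linearization). Let $\hat X\subseteq V$ be the affine cone over $X$, let $\mathbb{C}[\hat X]$ be its homogeneous coordinate ring (the image of $\mathbb{C}[V]$), $R=\mathbb{C}[\hat X]^G$, $X_f=\{x\in X: f(x)\ne 0\}$, and let $X_{ss}=\bigcup_f X_f$ be the union over the homogeneous $f\in R$ of positive degree. Then $X/\!\!/G=\operatorname{Proj}(R)$ is a variety, there is a canonical morphism $q\colon X_{ss}\to X/\!\!/G$ (with $q^{-1}(D_+(f))=X_f$ and $q^*(h/f^r)=h/f^r$), and $X/\!\!/G$ has a Poisson structure for which $q$ is a Poisson morphism, where the open set $X_{ss}\subseteq X$ has the Poisson structure induced from $X$. 4. (Quasi-projective case.) Let $X$ be embedded $G$-equivariantly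 as a locally closed subvariety of $\mathbb{P}(V)$, with $V$ as in 3. Let $R=\bigoplus_{n\ge 0}\Gamma(X,\mathcal{O}(n))^G$, and let $X_{ss}=\bigcup_f X_f$ be the union over the homogeneous $f\in R$ of positive degree for which $X_f$ is affine. Then $X/\!\!/G=\bigcup_f D_+(f)\subseteq\operatorname{Proj}(R)$, the union over the same $f$, is a variety, there is a canonical morphism $q\colon X_{ss}\to X/\!\!/G$ (as in 3), and $X/\!\!/G$ has a Poisson structure for which $q$ is a Poisson morphism, where $X_{ss}$ has the Poisson structure induced from $X$. Moreover, in 2, 3 and 4, if $X$ is irreducible, then $X/\!\!/G$ is irreducible or empty. -/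

import Mathlib

open CategoryTheory MonoidalCategory CartesianMonoidalCategory AlgebraicGeometry TensorProduct
open scoped MonObj

noncomputable section

namespace PoissonGIT

/-! ### Complex varieties -/

/-- The base scheme `Spec ℂ`. -/
abbrev SpecC : Scheme.{0} := Spec (CommRingCat.of ℂ)

/-- Complex varieties: reduced separated schemes of finite type over `ℂ`
(irreducibility is not required). -/
structure IsVariety (X : Over SpecC) : Prop where
  isReduced : IsReduced X.left
  isSeparated : IsSeparated X.hom
  locallyOfFiniteType : LocallyOfFiniteType X.hom
  quasiCompact : QuasiCompact X.hom

/-- The constant functions `ℂ → Γ(X, U)` on an open subset of a scheme over `ℂ`. -/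
def constants (X : Over SpecC) (U : X.left.Opens) : CommRingCat.of ℂ ⟶ Γ(X.left, U) :=
  (Scheme.ΓSpecIso (CommRingCat.of ℂ)).inv ≫
    Scheme.Hom.appLE (X := X.left) (Y := SpecC) X.hom ⊤ U (fun _ _ => trivial)

/-- The rings of functions of a scheme over `ℂ` are `ℂ`-algebras. -/
instance sectionsAlgebra (X : Over SpecC) (U : X.left.Opens) : Algebra ℂ Γ(X.left, U) :=
  (constants X U).hom.toAlgebra

/-- Pull-back of functions `Γ(Y, V) → Γ(X, U)` along a morphism `f : X ⟶ Y` over `ℂ` with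
`f(U) ⊆ V`. -/
def pull {X Y : Over SpecC} (f : X ⟶ Y) (V : Y.left.Opens) (U : X.left.Opens)
    (h : U ≤ f.left ⁻¹ᵁ V) : Γ(Y.left, V) →ₐ[ℂ] Γ(X.left, U) :=
  { (f.left.appLE V U h).hom with
    commutes' := fun c => by
      have e : constants Y V ≫ f.left.appLE V U h = constants X U := by
        have hw : f.left ≫ Y.hom = X.hom := Over.w f
        unfold constants
        simp only [Category.assoc]
        congr 1
        refine (Scheme.Hom.appLE_comp_appLE (X := X.left) (Y := Y.left) (Z := SpecC)
          f.left Y.hom ⊤ V U _ h).trans ?_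
        simp only [← hw]
      exact congrArg (fun φ => φ.hom c) e }

/-- Restriction of functions to a smaller open subset. -/
def res (X : Over SpecC) {U V : X.left.Opens} (h : V ≤ U) :
    Γ(X.left, U) →ₐ[ℂ] Γ(X.left, V) :=
  { (X.left.presheaf.map (homOfLE h).op).hom with
    commutes' := fun c => by
      have e : constants X U ≫ X.left.presheaf.map (homOfLE h).op = constants X V := by
        unfold constants
        simp only [Category.assoc]
        congr 1
        exact Scheme.Hom.appLE_map _ _ _
      exact congrArg (fun φ => φ.hom c) e }

/-- An open subset, as a scheme over `ℂ`. -/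
abbrev openSub (X : Over SpecC) (U : X.left.Opens) : Over SpecC := Over.mk (U.ι ≫ X.hom)

/-- The inclusion of an open subset. -/
def openIncl (X : Over SpecC) (U : X.left.Opens) : openSub X U ⟶ X := Over.homMk U.ι

/-! ### Poisson structures -/

/-- A Poisson structure on `X`: the structure sheaf is a sheaf of Poisson algebras. -/
structure PoissonStructure (X : Over SpecC) where
  /-- The Poisson bracket on the functions on an open subset. -/
  bracket (U : X.left.Opens) : Γ(X.left, U) →ₗ[ℂ] Γ(X.left, U) →ₗ[ℂ] Γ(X.left, U)
  alternating : ∀ U f, bracket U f f = 0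
  jacobi : ∀ U f g h, bracket U f (bracket U g h) + bracket U g (bracket U h f) +
    bracket U h (bracket U f g) = 0
  leibniz : ∀ U f g h, bracket U (f * g) h = f * bracket U g h + g * bracket U f h
  restrict : ∀ (U V : X.left.Opens) (i : V ≤ U) (f g : Γ(X.left, U)),
    res X i (bracket U f g) = bracket V (res X i f) (res X i g)

/-- A morphism is Poisson if pull-back of functions preserves the Poisson brackets. -/
def IsPoisson {X Y : Over SpecC} (PX : PoissonStructure X) (PY : PoissonStructure Y)
    (q : X ⟶ Y) : Prop :=
  ∀ (V : Y.left.Opens) (f g : Γ(Y.left, V)),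
    pull q V (q.left ⁻¹ᵁ V) le_rfl (PY.bracket V f g) =
      PX.bracket (q.left ⁻¹ᵁ V) (pull q V _ le_rfl f) (pull q V _ le_rfl g)

/-- The functions on an open subset `V` of the scheme `U` are those on the image of `V` in `X`,
also as `ℂ`-algebras. -/
lemma constants_openSub (X : Over SpecC) (U : X.left.Opens) (V : U.toScheme.Opens) :
    constants (openSub X U) V = constants X (U.ι ''ᵁ V) := by
  have h : V ≤ U.ι ⁻¹ᵁ (U.ι ''ᵁ V) := by rw [Scheme.Hom.preimage_image_eq]
  have e : constants (openSub X U) V =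
      constants X (U.ι ''ᵁ V) ≫ U.ι.appLE (U.ι ''ᵁ V) V h := by
    unfold constants
    simp only [Category.assoc]
    congr 1
    exact (Scheme.Hom.appLE_comp_appLE (X := U.toScheme) (Y := X.left) (Z := SpecC)
      U.ι X.hom ⊤ (U.ι ''ᵁ V) V _ h).symm
  rw [e, Scheme.Opens.ι_appLE]
  exact (congrArg (constants X (U.ι ''ᵁ V) ≫ ·) (X.left.presheaf.map_id _)).trans
    (Category.comp_id _)

/-- The identification `Γ(U, V) = Γ(X, V)` for open subsets `V ⊆ U` of `X`. -/
def openSubEquiv (X : Over SpecC) (U : X.left.Opens) (V : U.toScheme.Opens) :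
    Γ((openSub X U).left, V) ≃ₐ[ℂ] Γ(X.left, U.ι ''ᵁ V) :=
  { RingEquiv.refl Γ(X.left, U.ι ''ᵁ V) with
    commutes' := fun c => congrArg (fun φ => φ.hom c) (constants_openSub X U V) }

/-- The Poisson structure induced on an open subset: `{f, g}` on `V ⊆ U` is the bracket of `f` and
`g` as functions on the open subset `V` of `X`. -/
def PoissonStructure.openRestrict {X : Over SpecC} (P : PoissonStructure X)
    (U : X.left.Opens) : PoissonStructure (openSub X U) where
  bracket V := ((P.bracket (U.ι ''ᵁ V)).compl₁₂ (openSubEquiv X U V).toLinearMap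
    (openSubEquiv X U V).toLinearMap).compr₂ (openSubEquiv X U V).symm.toLinearMap
  alternating V f := P.alternating (U.ι ''ᵁ V) f
  jacobi V f g h := P.jacobi (U.ι ''ᵁ V) f g h
  leibniz V f g h := P.leibniz (U.ι ''ᵁ V) f g h
  restrict V W i f g := P.restrict (U.ι ''ᵁ V) (U.ι ''ᵁ W) (Scheme.Hom.image_mono _ i) f g

/-! ### Poisson actions -/

/-- The product function `φ ⊗ f` on `U × V`. -/
def boxProd {X Y : Over SpecC} {U : X.left.Opens} {V : Y.left.Opens}
    (φ : Γ(X.left, U)) (f : Γ(Y.left, V)) :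
    Γ((X ⊗ Y).left, (fst X Y).left ⁻¹ᵁ U ⊓ (snd X Y).left ⁻¹ᵁ V) :=
  pull (fst X Y) U _ inf_le_left φ * pull (snd X Y) V _ inf_le_right f

/-- `P` is the product Poisson structure on `X × Y`, that is
`{φ₁ ⊗ f₁, φ₂ ⊗ f₂} = {φ₁, φ₂} ⊗ f₁ f₂ + φ₁ φ₂ ⊗ {f₁, f₂}`.
This determines `P`, as functions on `X × Y` are locally fractions of sums of such products. -/
def IsProductPoisson {X Y : Over SpecC} (PX : PoissonStructure X) (PY : PoissonStructure Y)
    (P : PoissonStructure (X ⊗ Y)) : Prop :=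
  ∀ (U : X.left.Opens) (V : Y.left.Opens) (φ₁ φ₂ : Γ(X.left, U)) (f₁ f₂ : Γ(Y.left, V)),
    P.bracket _ (boxProd φ₁ f₁) (boxProd φ₂ f₂) =
      boxProd (PX.bracket U φ₁ φ₂) (f₁ * f₂) + boxProd (φ₁ * φ₂) (PY.bracket V f₁ f₂)

/-- A morphism `m : X × Y ⟶ Z` is Poisson for the product Poisson structure on `X × Y`
(there is exactly one product Poisson structure on `X × Y`). -/
def IsPoissonFromProduct {X Y Z : Over SpecC} (PX : PoissonStructure X) (PY : PoissonStructure Y)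
    (PZ : PoissonStructure Z) (m : X ⊗ Y ⟶ Z) : Prop :=
  ∃ P : PoissonStructure (X ⊗ Y), IsProductPoisson PX PY P ∧ IsPoisson P PZ m

/-- The linear algebraic group with coordinate Hopf algebra `A`. -/
abbrev algGroup (A : Type) [CommRing A] [Algebra ℂ A] : Over SpecC :=
  (Spec (CommRingCat.of A)).asOver SpecC

section Group

variable (A : Type) [CommRing A] [HopfAlgebra ℂ A]

/-- `PG` makes the linear algebraic group `Spec A` a Poisson algebraic group: the multiplication
is a Poisson morphism. -/
def IsPoissonGroup (PG : PoissonStructure (algGroup A)) : Prop :=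
  IsPoissonFromProduct PG PG PG μ[algGroup A]

/-- `ρ` makes `V` a comodule over the coordinate ring `A` of `G`. Finite-dimensional comodules are
the duals of the finite-dimensional rational representations of `G`. -/
structure IsComodule {V : Type} [AddCommGroup V] [Module ℂ V] (ρ : V →ₗ[ℂ] A ⊗[ℂ] V) : Prop where
  counit : ∀ v, TensorProduct.lid ℂ V ((Coalgebra.counit (R := ℂ) (A := A)).rTensor V (ρ v)) = v
  coassoc : ∀ v, TensorProduct.assoc ℂ A A V
    ((Coalgebra.comul (R := ℂ) (A := A)).rTensor V (ρ v)) = ρ.lTensor A (ρ v)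

/-- `W` is a subcomodule (subrepresentation) of `V`. -/
def IsSubcomodule {V : Type} [AddCommGroup V] [Module ℂ V] (ρ : V →ₗ[ℂ] A ⊗[ℂ] V)
    (W : Submodule ℂ V) : Prop :=
  ∀ w ∈ W, ρ w ∈ LinearMap.range (W.subtype.lTensor A)

/-- The linear algebraic group with coordinate ring `A` is reductive: every finite-dimensional
rational representation is completely reducible, i.e. every subrepresentation has an invariant
complement. (Over `ℂ` this is equivalent to the triviality of the unipotent radical.) -/
def IsReductive : Prop :=
  ∀ (V : Type) [AddCommGroup V] [Module ℂ V] [FiniteDimensional ℂ V] (ρ : V →ₗ[ℂ] A ⊗[ℂ] V),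
    IsComodule A ρ → ∀ W : Submodule ℂ V, IsSubcomodule A ρ W →
      ∃ W' : Submodule ℂ V, IsSubcomodule A ρ W' ∧ IsCompl W W'

end Group

/-- The action of the Poisson algebraic group `G` on the Poisson variety `X` is Poisson: the action
map `G × X ⟶ X` is a Poisson morphism for the product Poisson structure. -/
def IsPoissonAction {G : Over SpecC} [GrpObj G] {X : Over SpecC} [ModObj G X]
    (PG : PoissonStructure G) (PX : PoissonStructure X) : Prop :=
  IsPoissonFromProduct PG PX PX γ[G, X]

section Invariants

variable {G : Over SpecC} [GrpObj G] (X : Over SpecC) [ModObj G X]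

variable (G) in
/-- The action map `a : G × X ⟶ X`. -/
abbrev act : G ⊗ X ⟶ X := γ[G, X]

variable (G) in
/-- `U` is stable under the action of `G`: `a⁻¹(U) = G × U`. -/
def IsStable (U : X.left.Opens) : Prop :=
  (act G X).left ⁻¹ᵁ U = (snd G X).left ⁻¹ᵁ U

variable (G) in
/-- The `G`-invariant functions on an open subset `U`, which will be `G`-stable:
those `f` with `f(g x) = f(x)`, that is `a^* f = p^* f`. -/
def invariants (U : X.left.Opens) : Subalgebra ℂ Γ(X.left, U) :=
  AlgHom.equalizer
    (pull (act G X) U ((act G X).left ⁻¹ᵁ U ⊓ (snd G X).left ⁻¹ᵁ U) inf_le_left)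
    (pull (snd G X) U ((act G X).left ⁻¹ᵁ U ⊓ (snd G X).left ⁻¹ᵁ U) inf_le_right)

/-! ### The quotient of an affine variety -/

/-- `Spec R` as a scheme over `ℂ`. -/
abbrev specOver (R : Type) [CommRing R] [Algebra ℂ R] : Over SpecC :=
  Over.mk (Y := Spec (CommRingCat.of R)) (Spec.map (CommRingCat.ofHom (algebraMap ℂ R)))

variable (G) in
/-- The quotient `X // G = Spec (ℂ[X]^G)` of an affine variety. -/
abbrev affineQuotient : Over SpecC := specOver (invariants G X ⊤)

variable (G) in
/-- The quotient map `X ⟶ Spec (ℂ[X]^G)`, for which pull-back of functions is the inclusion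
`ℂ[X]^G ⊆ ℂ[X]`. -/
def affineQuotientMap : X ⟶ affineQuotient G X :=
  Over.homMk
    (X.left.toSpecΓ ≫ Spec.map (CommRingCat.ofHom (invariants G X ⊤).val.toRingHom)) (by
    have h1 : CommRingCat.ofHom (algebraMap ℂ (invariants G X ⊤)) ≫
        CommRingCat.ofHom (invariants G X ⊤).val.toRingHom = constants X ⊤ := by
      ext c
      rfl
    have h2 : constants X ⊤ = (Scheme.ΓSpecIso (CommRingCat.of ℂ)).inv ≫
        Scheme.Hom.appTop (X := X.left) (Y := SpecC) X.hom := by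
      unfold constants
      congr 1
      exact Scheme.Hom.appLE_eq_app (X := X.left) (Y := SpecC) X.hom
    change (X.left.toSpecΓ ≫ Spec.map _) ≫ Spec.map _ = X.hom
    rw [Category.assoc, ← Spec.map_comp, h1, h2, Spec.map_comp]
    have h3 := Scheme.toSpecΓ_naturality (X := X.left) (Y := SpecC) X.hom
    rw [← Category.assoc, ← h3, Category.assoc]
    have h4 : SpecC.toSpecΓ ≫ Spec.map (Scheme.ΓSpecIso (CommRingCat.of ℂ)).inv = 𝟙 _ := by
      simp
    exact (congrArg (X.hom ≫ ·) h4).trans (Category.comp_id _))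

end Invariants

/-! ### Graded rings and their `Proj` -/

/-- `Proj` of a graded `ℂ`-algebra as a scheme over `ℂ`. -/
abbrev projOver {R : Type} [CommRing R] [Algebra ℂ R] (𝒜 : ℕ → Submodule ℂ R)
    [GradedAlgebra 𝒜] : Over SpecC :=
  Over.mk (Y := Proj 𝒜) (Proj.toSpecZero 𝒜 ≫
    Spec.map (CommRingCat.ofHom (algebraMap ℂ (𝒜 0))))

/-- The function `h / f ^ r` on `D₊(f) ⊆ Proj R`, for `f` of degree `d` and `h` of degree `r d`. -/
def projFraction {R : Type} [CommRing R] [Algebra ℂ R] (𝒜 : ℕ → Submodule ℂ R)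
    [GradedAlgebra 𝒜] {d : ℕ} (f : R) (hf : f ∈ 𝒜 d) (r : ℕ) (h : R) (hh : h ∈ 𝒜 (r • d)) :
    Γ((projOver 𝒜).left, Proj.basicOpen 𝒜 f) :=
  (Proj.awayToSection 𝒜 f).hom (HomogeneousLocalization.Away.mk 𝒜 hf r h hh)

section GradedRing

open Polynomial

variable {P : Type} [CommRing P] [Algebra ℂ P] (M : ℕ → Submodule ℂ P) [SetLike.GradedMonoid M]

/-- For subspaces `M n` of an algebra `P` with `1 ∈ M 0` and `M m * M n ⊆ M (m + n)`, the algebra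
`⨁ n, M n`, realized as the algebra of polynomials `∑ uₙ tⁿ` with `uₙ ∈ M n`. -/
def sumRing : Subalgebra ℂ P[X] where
  carrier := {F | ∀ n, F.coeff n ∈ M n}
  mul_mem' {F H} hF hH n := by
    rw [coeff_mul]
    refine Submodule.sum_mem _ fun x hx => ?_
    rw [← Finset.HasAntidiagonal.mem_antidiagonal.mp hx]
    exact SetLike.mul_mem_graded (hF _) (hH _)
  add_mem' {F H} hF hH n := by
    rw [coeff_add]
    exact Submodule.add_mem _ (hF n) (hH n)
  algebraMap_mem' c n := by
    rw [Polynomial.algebraMap_apply, coeff_C]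
    split_ifs with h
    · subst h
      rw [Algebra.algebraMap_eq_smul_one]
      exact Submodule.smul_mem _ _ SetLike.GradedOne.one_mem
    · exact Submodule.zero_mem _

/-- The summand `M n` of `⨁ n, M n`: the elements `u tⁿ`. -/
def sumPiece (n : ℕ) : Submodule ℂ (sumRing M) where
  carrier := {F | ∀ m, m ≠ n → F.1.coeff m = 0}
  zero_mem' := fun _ _ => by simp
  add_mem' {F H} hF hH m hm := by simp [hF m hm, hH m hm]
  smul_mem' c F hF m hm := by simp [hF m hm]

/-- The element `u tⁿ` of degree `n` given by `u ∈ M n`. -/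
def ofPiece (n : ℕ) (u : M n) : sumPiece M n :=
  ⟨⟨monomial n u.1, fun m => by
    rw [coeff_monomial]
    split_ifs with h
    · exact h ▸ u.2
    · exact Submodule.zero_mem _⟩, fun m hm => by
    simp [coeff_monomial, hm.symm]⟩

lemma coeff_coeAddMonoidHom (x : DirectSum ℕ fun n => sumPiece M n) (n : ℕ) :
    (DirectSum.coeAddMonoidHom (sumPiece M) x).1.coeff n = (x n).1.1.coeff n := by
  induction x using DirectSum.induction_on with
  | zero => simp
  | of i F =>
    rw [DirectSum.coeAddMonoidHom_of]
    by_cases h : i = n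
    · subst h
      rw [DirectSum.of_eq_same]
    · rw [DirectSum.of_eq_of_ne _ _ _ (Ne.symm h)]
      simpa using F.2 n (Ne.symm h)
  | add x y hx hy => simp [hx, hy]

lemma coe_injective : Function.Injective (DirectSum.coeAddMonoidHom (sumPiece M)) := by
  intro x y h
  refine DFinsupp.ext fun n => Subtype.ext (Subtype.ext (Polynomial.ext fun m => ?_))
  by_cases hm : m = n
  · subst hm
    rw [← coeff_coeAddMonoidHom, ← coeff_coeAddMonoidHom, h]
  · rw [(x n).2 m hm, (y n).2 m hm]

lemma coe_sum (F : sumRing M) : DirectSum.coeAddMonoidHom (sumPiece M)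
    (∑ n ∈ F.1.support, DirectSum.of (fun n => sumPiece M n) n
      (ofPiece M n ⟨F.1.coeff n, F.2 n⟩)) = F := by
  rw [map_sum]
  simp only [DirectSum.coeAddMonoidHom_of]
  refine Subtype.ext ?_
  rw [AddSubmonoidClass.coe_finsetSum]
  exact F.1.as_sum_support.symm

instance sumGraded : GradedAlgebra (sumPiece M) where
  one_mem := fun m hm => by simp [Polynomial.coeff_one, hm]
  mul_mem {m n F H} hF hH k hk := by
    change (F.1 * H.1).coeff k = 0
    rw [coeff_mul]
    refine Finset.sum_eq_zero fun x hx => ?_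
    have hx := Finset.HasAntidiagonal.mem_antidiagonal.mp hx
    by_cases h : x.1 = m
    · rw [hH x.2 (by omega), mul_zero]
    · rw [hF x.1 h, zero_mul]
  decompose' F := ∑ n ∈ F.1.support, DirectSum.of (fun n => sumPiece M n) n
    (ofPiece M n ⟨F.1.coeff n, F.2 n⟩)
  left_inv F := coe_sum M F
  right_inv x := coe_injective M (coe_sum M _)

end GradedRing

/-! ### Linearized actions on quasi-projective varieties -/

attribute [local instance] MvPolynomial.gradedAlgebra

/-- The projective space `ℙ(V)` of lines in `V = ℂᴺ`, with homogeneous coordinates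
`x₁, …, x_N`. -/
abbrev projSpace (N : ℕ) : Over SpecC := projOver (MvPolynomial.homogeneousSubmodule (Fin N) ℂ)

lemma X_mem {N : ℕ} (i : Fin N) :
    (MvPolynomial.X i : MvPolynomial (Fin N) ℂ) ∈ MvPolynomial.homogeneousSubmodule (Fin N) ℂ 1 :=
  MvPolynomial.isHomogeneous_X ℂ i

section Charts

variable {X : Over SpecC} {N : ℕ} (j : X ⟶ projSpace N)

/-- The open subset `Xᵢ` of `X` where `xᵢ ≠ 0`. -/
def chart (i : Fin N) : X.left.Opens :=
  j.left ⁻¹ᵁ (Proj.basicOpen (MvPolynomial.homogeneousSubmodule (Fin N) ℂ) (MvPolynomial.X i))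

/-- The function `x_l / xᵢ` on `Xᵢ`. -/
def ratio (l i : Fin N) : Γ(X.left, chart j i) :=
  pull j _ (chart j i) le_rfl
    (projFraction (MvPolynomial.homogeneousSubmodule (Fin N) ℂ) (MvPolynomial.X i)
      (X_mem i) 1 (MvPolynomial.X l) ((one_smul ℕ 1).symm ▸ X_mem l))

end Charts

section Linearization

variable {A : Type} [CommRing A] [HopfAlgebra ℂ A] {X : Over SpecC} [ModObj (algGroup A) X]

/-- A regular function on `G` as a function on an open subset of `G × X`. -/
def grpFun (φ : A) (W : (algGroup A ⊗ X).left.Opens) : Γ((algGroup A ⊗ X).left, W) :=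
  pull (fst (algGroup A) X) ⊤ W (fun _ _ => trivial)
    ((Scheme.ΓSpecIso (CommRingCat.of A)).inv.hom φ)

/-- The open subset of `(g, x)` with `g x ∈ Xᵢ` and `x ∈ X_k`. -/
def chartPair {N : ℕ} (j : X ⟶ projSpace N) (i k : Fin N) : (algGroup A ⊗ X).left.Opens :=
  (act (algGroup A) X).left ⁻¹ᵁ chart j i ⊓ (snd (algGroup A) X).left ⁻¹ᵁ chart j k

/-- The function `(g, x) ↦ (∑ₘ c_lm(g) xₘ) / x_k = x_l(g x) / x_k(x)`, on the set of `(g, x)` with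
`g x ∈ Xᵢ` and `x ∈ X_k`. -/
def translate {N : ℕ} (c : Matrix (Fin N) (Fin N) A) (j : X ⟶ projSpace N) (l i k : Fin N) :
    Γ((algGroup A ⊗ X).left, chartPair (A := A) j i k) :=
  ∑ m, grpFun (c l m) _ * pull (snd (algGroup A) X) (chart j k) _ inf_le_right (ratio j m k)

variable (A X) in
/-- A linearization of the action of `G` on `X`: a representation of `G` on `V = ℂᴺ` and a
`G`-equivariant (locally closed) immersion of `X` in `ℙ(V)`. -/
structure Linearization where
  /-- The dimension of `V`. -/
  N : ℕ
  /-- The matrix coefficients of the representation, `g ↦ (c_im(g))`. -/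
  c : Matrix (Fin N) (Fin N) A
  counit_c : ∀ i k, Coalgebra.counit (R := ℂ) (c i k) = if i = k then 1 else 0
  comul_c : ∀ i k, Coalgebra.comul (R := ℂ) (c i k) = ∑ m, c i m ⊗ₜ[ℂ] c m k
  /-- The immersion of `X` in `ℙ(V)`. -/
  j : X ⟶ projSpace N
  isImmersion : IsImmersion j.left
  /-- Equivariance: the point `g x` has homogeneous coordinates `(∑ₘ c_lm(g) xₘ)_l`. -/
  equivariant : ∀ i k l,
    pull (act (algGroup A) X) (chart j i) (chartPair j i k) inf_le_left (ratio j l i) *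
      translate c j i i k = translate c j l i k

namespace Linearization

variable (L : Linearization A X)

/-- Families of functions on the charts `Xᵢ`. -/
abbrev ChartFunctions : Type := ∀ i : Fin L.N, Γ(X.left, chart L.j i)

/-- The `G`-invariant sections over `X` of (the pull-back of) `𝒪(n)`, i.e. the `G`-invariant
functions of degree `n` on the punctured cone over `X`. A section `s` is given by the functions
`uᵢ = s / xᵢⁿ` on the charts `Xᵢ`, with `u_k = uᵢ (xᵢ / x_k)ⁿ` on overlaps;
`G`-invariance `s(g x) = s(x)` reads `uᵢ(g x) (xᵢ(g x) / x_k(x))ⁿ = u_k(x)`. -/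
def invariantSections (n : ℕ) : Submodule ℂ L.ChartFunctions where
  carrier := {u |
    (∀ i k, res X (V := chart L.j i ⊓ chart L.j k) inf_le_right (u k) =
      res X inf_le_left (u i) * res X inf_le_right (ratio L.j i k) ^ n) ∧
    ∀ i k, pull (act (algGroup A) X) (chart L.j i) (chartPair L.j i k) inf_le_left (u i) *
        translate L.c L.j i i k ^ n =
      pull (snd (algGroup A) X) (chart L.j k) (chartPair L.j i k) inf_le_right (u k)}
  zero_mem' := by simp
  add_mem' {u v} hu hv := by
    refine ⟨fun i k => ?_, fun i k => ?_⟩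
    · simp only [Pi.add_apply, map_add, hu.1 i k, hv.1 i k, add_mul]
    · simp only [Pi.add_apply, map_add, ← hu.2 i k, ← hv.2 i k, add_mul]
  smul_mem' a u hu := by
    refine ⟨fun i k => ?_, fun i k => ?_⟩
    · simp only [Pi.smul_apply, map_smul, hu.1 i k, smul_mul_assoc]
    · simp only [Pi.smul_apply, map_smul, ← hu.2 i k, smul_mul_assoc]

instance : SetLike.GradedMonoid L.invariantSections where
  one_mem := by
    refine ⟨fun i k => ?_, fun i k => ?_⟩ <;> simp
  mul_mem {m n} u v hu hv := by
    refine ⟨fun i k => ?_, fun i k => ?_⟩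
    · simp only [Pi.mul_apply, map_mul, hu.1 i k, hv.1 i k, pow_add]
      ring
    · simp only [Pi.mul_apply, map_mul, ← hu.2 i k, ← hv.2 i k, pow_add]
      ring

/-- The homogeneous coordinate map sending a homogeneous polynomial `p` of degree `n` on `V` to the
section `p` of `𝒪(n)` over `X`, given by the functions `p / xᵢⁿ = p(x₁ / xᵢ, …, x_N / xᵢ)`. -/
def ofPolynomial : MvPolynomial (Fin L.N) ℂ →ₐ[ℂ] L.ChartFunctions :=
  AlgHom.pi fun i => MvPolynomial.aeval fun l => ratio L.j l i

/-- The `G`-invariant homogeneous functions of degree `n` on the cone over `X`: the elements of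
degree `n` of `ℂ[X̂]^G`, where `ℂ[X̂]` is the image of `ℂ[V]`. -/
def invariantForms (n : ℕ) : Submodule ℂ L.ChartFunctions :=
  L.invariantSections n ⊓
    (MvPolynomial.homogeneousSubmodule (Fin L.N) ℂ n).map L.ofPolynomial.toLinearMap

instance : SetLike.GradedMonoid L.invariantForms where
  one_mem := ⟨SetLike.GradedOne.one_mem, 1, MvPolynomial.isHomogeneous_one _ _,
    map_one L.ofPolynomial⟩
  mul_mem {m n} u v := by
    rintro ⟨hu, p, hp, rfl⟩ ⟨hv, q, hq, rfl⟩
    exact ⟨SetLike.mul_mem_graded hu hv, p * q, MvPolynomial.IsHomogeneous.mul hp hq,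
      map_mul L.ofPolynomial _ _⟩

/-- The open subset `X_u` where a section `u` of `𝒪(n)` over `X` does not vanish. -/
def locus (u : L.ChartFunctions) : X.left.Opens := ⨆ i, X.left.basicOpen (u i)

/-- `m : U ⟶ Proj (⨁ M n)`, for an open `U ⊆ X` and spaces `M n` of invariant sections of `𝒪(n)`, is
the canonical morphism: for `f` of positive degree, `m⁻¹(D₊(f)) = U ∩ X_f`, and the pull-back of the
function `h / f ^ r` is the function `h / f ^ r` on `U ∩ X_f`. These conditions determine `m` if `U`
is covered by such sets `X_f`, as the `D₊(f)` are affine with functions the `h / f ^ r`. -/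
def IsCanonical (M : ℕ → Submodule ℂ L.ChartFunctions) [SetLike.GradedMonoid M]
    (U : X.left.Opens) (m : openSub X U ⟶ projOver (sumPiece M)) : Prop :=
  ∀ (n : ℕ) (_ : 0 < n) (f : M n),
    m.left ⁻¹ᵁ Proj.basicOpen (sumPiece M) (ofPiece M n f) = U.ι ⁻¹ᵁ L.locus f ∧
    ∀ (r : ℕ) (h : M (r • n)) (i : Fin L.N),
      pull m (Proj.basicOpen (sumPiece M) (ofPiece M n f))
          (m.left ⁻¹ᵁ Proj.basicOpen (sumPiece M) (ofPiece M n f) ⊓ U.ι ⁻¹ᵁ chart L.j i) inf_le_left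
          (projFraction (sumPiece M) _ (ofPiece M n f).2 r _ (ofPiece M (r • n) h).2) *
        pull (openIncl X U) (chart L.j i) _ inf_le_right (f.1 i) ^ r =
      pull (openIncl X U) (chart L.j i) _ inf_le_right (h.1 i)

/-! #### Projective varieties -/

/-- The semistable locus of a projective variety: the union of the `X_f`, for `f ∈ ℂ[X̂]^G`
homogeneous of positive degree. -/
def projectiveSemistable : X.left.Opens :=
  ⨆ (n : ℕ) (_ : 0 < n) (f : L.invariantForms n), L.locus f

/-- The quotient `X // G = Proj (ℂ[X̂]^G)` of a projective variety. -/
abbrev projectiveQuotient : Over SpecC := projOver (sumPiece L.invariantForms)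

/-! #### Quasi-projective varieties -/

/-- The semistable locus of a quasi-projective variety: the union of the `X_f` that are affine, for
`G`-invariant sections `f` of `𝒪(n)` over `X`, `n > 0`. -/
def semistable : X.left.Opens :=
  ⨆ (n : ℕ) (_ : 0 < n) (f : L.invariantSections n) (_ : IsAffineOpen (L.locus f)), L.locus f

/-- The union of the affine open subsets `D₊(f)` of `Proj (⨁ Γ(X, 𝒪(n))^G)` for the sections `f`
of positive degree with `X_f` affine. -/
def quotientOpen : (projOver (sumPiece L.invariantSections)).left.Opens :=
  ⨆ (n : ℕ) (_ : 0 < n) (f : L.invariantSections n) (_ : IsAffineOpen (L.locus f)),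
    Proj.basicOpen (sumPiece L.invariantSections) (ofPiece L.invariantSections n f)

/-- The quotient `X // G` of a quasi-projective variety, glued from the affine quotients
`X_f // G = Spec (ℂ[X_f]^G) = D₊(f)` of the affine open subsets `X_f` above. -/
abbrev quotient : Over SpecC := openSub (projOver (sumPiece L.invariantSections)) L.quotientOpen

end Linearization

end Linearization

end PoissonGIT

end

/-!
Quotients of Poisson varieties by reductive Poisson groups.

The bracket of two invariant functions is invariant because pull-back along the action map `a` and
along the projection `p : G × X ⟶ X` both preserve brackets: for `a` this is the hypothesis, and
for `p` it holds as the constant function `1` on `G` has zero bracket with itself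
(`bracket_mem_invariants`). So if `q : U ⟶ Y` is a morphism from an open subset of `X` such that
`Γ(Y, V)` is the ring of invariant functions on `q⁻¹(V)` for every open `V` (`IsQuotientOver`),
then `Y` has a Poisson structure for which `q` is Poisson (`exists_isPoisson_of_isQuotientOver`);
and `Y` is reduced, and irreducible if `X` is. It remains to show that the three constructions give
such quotients, and that they are of finite type and separated.

Reductivity enters through an invariant integral. The constants have a stable complement in the
regular representation (Zorn's lemma reduces this to finite-dimensional representations), so there
is a normalized functional on `A = ℂ[G]` that is invariant under translations
(`IsReductive.exists_integral`). Averaging with it is the Reynolds operator, which gives Hilbert's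
theorem that invariants are finitely generated (`IsReductive.coinvariants_fg`), and the fact that
invariants which generate the unit ideal do so in the ring of invariants
(`IsReductive.span_eq_top`). Both are transported to functions on stable affine open sets `U` by the
identification of the functions on `G × U` with `A ⊗ Γ(X, U)` (`boxHom_bijective`), for which
pull-back along the action is a comodule structure (`isComodule_coaction`).

For `Y = Spec (ℂ[X]^G)` the quotient property holds for global functions by definition, and it
passes to principal open subsets, as an invariant function on `X_b` is a fraction `h / bⁿ` of invariant
functions (`exists_mem_invariants_res_eq`, `IsQuotientOver.basicOpen`).

In the linearized cases let `M n` be the invariant sections of `𝒪(n)`, or those given by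
polynomials. An invariant function on `X_f` is a fraction `h / fʳ`, as is every function on a
non-vanishing locus, and the numerator becomes an invariant section after multiplication with a
power of `f` (`IsFraction.exists_pow_mul_mem`); in the projective case `X_f` is a closed subset of
the affine set `F ≠ 0` in projective space, so `h` can be taken to be given by a polynomial. The
functions on `D₊(f) ⊆ Proj (⨁ M n)` are the fractions `h / fʳ` too. This provides the canonical
morphism locally, by its effect on functions, and shows its uniqueness, so that the local morphisms
can be glued (`exists_isCanonicalFor`); and it shows that over each `D₊(f)` with `X_f` affine the
canonical morphism is a quotient (`isQuotientOver_preimage_dPlus`). Finitely many of these `D₊(f)`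
suffice, since open subsets of the quotient cover it if their inverse images do
(`IsQuotientOver.le_iSup_of_openPreimage_le`). Both cases are instances of
`Linearization.exists_quotient`.
-/

noncomputable section

namespace PoissonGIT

/-! ### Comodules and their stable subspaces -/

section Contract

variable {A : Type} [AddCommGroup A] [Module ℂ A] {V W : Type} [AddCommGroup V] [Module ℂ V]
  [AddCommGroup W] [Module ℂ W]

/-- The contraction `A ⊗ V → V` with a linear functional on `A`. -/
def contract (V : Type) [AddCommGroup V] [Module ℂ V] (φ : Module.Dual ℂ A) : A ⊗[ℂ] V →ₗ[ℂ] V :=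
  (TensorProduct.lid ℂ V).toLinearMap ∘ₗ φ.rTensor V

@[simp] lemma contract_tmul (φ : Module.Dual ℂ A) (a : A) (v : V) :
    contract V φ (a ⊗ₜ v) = φ a • v := by
  simp [contract]

lemma contract_lTensor (φ : Module.Dual ℂ A) (f : V →ₗ[ℂ] W) (x : A ⊗[ℂ] V) :
    contract W φ (f.lTensor A x) = f (contract V φ x) := by
  induction x using TensorProduct.induction_on with
  | zero => simp
  | tmul a v => simp
  | add x y hx hy => simp [hx, hy]

/-- Membership in `A ⊗ W ⊆ A ⊗ V` can be tested by contractions, as `A` has a basis. -/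
lemma mem_range_lTensor_subtype_iff (W : Submodule ℂ V) (x : A ⊗[ℂ] V) :
    x ∈ LinearMap.range (W.subtype.lTensor A) ↔ ∀ φ : Module.Dual ℂ A, contract V φ x ∈ W := by
  constructor
  · rintro ⟨y, rfl⟩ φ
    rw [contract_lTensor]
    exact Subtype.coe_prop _
  · intro h
    obtain ⟨b, rfl⟩ := TensorProduct.eq_repr_basis_left (Module.Basis.ofVectorSpace ℂ A) x
    have hb : ∀ i, b i ∈ W := fun i => by
      have := h ((Module.Basis.ofVectorSpace ℂ A).coord i)
      rw [Finsupp.sum, map_sum] at this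
      simp only [contract_tmul, Module.Basis.coord_apply, Module.Basis.repr_self] at this
      rwa [Finset.sum_eq_single i (fun j _ hj => by simp [hj])
        (fun hi => by simp [Finsupp.notMem_support_iff.mp hi]), Finsupp.single_eq_same,
        one_smul] at this
    exact Submodule.sum_mem _ fun i _ =>
      ⟨(Module.Basis.ofVectorSpace ℂ A) i ⊗ₜ ⟨b i, hb i⟩, by simp⟩

end Contract

section Comodule

variable {A : Type} [CommRing A] [HopfAlgebra ℂ A] {V : Type} [AddCommGroup V] [Module ℂ V]
  {ρ : V →ₗ[ℂ] A ⊗[ℂ] V}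

variable (ρ) in
/-- `W` is stable under the operators `v ↦ (φ ⊗ 1) (ρ v)` for all functionals `φ` on `A`. -/
def IsContractStable (W : Submodule ℂ V) : Prop :=
  ∀ φ : Module.Dual ℂ A, ∀ w ∈ W, contract V φ (ρ w) ∈ W

lemma isSubcomodule_iff {W : Submodule ℂ V} : IsSubcomodule A ρ W ↔ IsContractStable ρ W := by
  simp only [IsSubcomodule, mem_range_lTensor_subtype_iff, IsContractStable]
  exact ⟨fun h φ w hw => h w hw φ, fun h w hw φ => h φ w hw⟩

/-- Two successive contractions of the coaction are one contraction with the convolution product of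
the functionals. -/
lemma contract_coaction_contract (hρ : IsComodule A ρ) (φ ψ : Module.Dual ℂ A) (v : V) :
    contract V ψ (ρ (contract V φ (ρ v))) =
      contract V ((TensorProduct.lid ℂ ℂ).toLinearMap ∘ₗ TensorProduct.map φ ψ ∘ₗ
        Coalgebra.comul) (ρ v) := by
  have h1 : ∀ x : A ⊗[ℂ] V, ρ (contract V φ x) = contract (A ⊗[ℂ] V) φ (ρ.lTensor A x) :=
    fun x => (contract_lTensor φ ρ x).symm
  rw [h1, ← hρ.coassoc v]
  have h2 : ∀ y : (A ⊗[ℂ] A) ⊗[ℂ] V,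
      contract V ψ (contract (A ⊗[ℂ] V) φ (TensorProduct.assoc ℂ A A V y)) =
      TensorProduct.lid ℂ V (((TensorProduct.lid ℂ ℂ).toLinearMap ∘ₗ
        TensorProduct.map φ ψ).rTensor V y) := by
    intro y
    induction y using TensorProduct.induction_on with
    | zero => simp
    | add x y hx hy => simp only [map_add, hx, hy]
    | tmul x v =>
      induction x using TensorProduct.induction_on with
      | zero => simp
      | add x y hx hy => simp only [map_add, TensorProduct.add_tmul, hx, hy]
      | tmul a b => simp [smul_smul]
  rw [h2, ← LinearMap.comp_apply, ← LinearMap.rTensor_comp]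
  rfl

variable (ρ) in
/-- The subspace of all `(φ ⊗ 1) (ρ v)`, which is the subcomodule generated by `v`. -/
def orbitSpan (v : V) : Submodule ℂ V :=
  LinearMap.range (((TensorProduct.lid ℂ V).toLinearMap.compRight ℂ ∘ₗ
    LinearMap.rTensorHom V).flip (ρ v))

lemma isContractStable_orbitSpan (hρ : IsComodule A ρ) (v : V) :
    IsContractStable ρ (orbitSpan ρ v) := by
  rintro φ _ ⟨ψ, rfl⟩
  exact ⟨_, (contract_coaction_contract hρ ψ φ v).symm⟩

lemma self_mem_orbitSpan (hρ : IsComodule A ρ) (v : V) : v ∈ orbitSpan ρ v :=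
  ⟨_, hρ.counit v⟩

/-- Comodules are locally finite. -/
lemma finiteDimensional_orbitSpan (v : V) : FiniteDimensional ℂ (orbitSpan ρ v) := by
  classical
  obtain ⟨s, hs⟩ := TensorProduct.exists_finset (R := ℂ) (ρ v)
  have : orbitSpan ρ v ≤ Submodule.span ℂ (s.image Prod.snd : Finset V) := by
    rintro _ ⟨φ, rfl⟩
    change contract V φ (ρ v) ∈ _
    rw [hs, map_sum]
    refine Submodule.sum_mem _ fun i hi => ?_
    rw [contract_tmul]
    exact Submodule.smul_mem _ _ (Submodule.subset_span (Finset.mem_coe.mpr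
      (Finset.mem_image_of_mem _ hi)))
  exact Submodule.finiteDimensional_of_le this

lemma IsContractStable.sup {W W' : Submodule ℂ V} (h : IsContractStable ρ W)
    (h' : IsContractStable ρ W') : IsContractStable ρ (W ⊔ W') := by
  intro φ w hw
  obtain ⟨x, hx, y, hy, rfl⟩ := Submodule.mem_sup.mp hw
  rw [map_add, map_add]
  exact Submodule.add_mem_sup (h φ x hx) (h' φ y hy)

lemma IsContractStable.inf {W W' : Submodule ℂ V} (h : IsContractStable ρ W)
    (h' : IsContractStable ρ W') : IsContractStable ρ (W ⊓ W') :=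
  fun φ w hw => ⟨h φ w hw.1, h' φ w hw.2⟩

/-- The coaction on a stable subspace. -/
def restrictCoaction (ρ : V →ₗ[ℂ] A ⊗[ℂ] V) (W : Submodule ℂ V) (hW : IsContractStable ρ W) :
    W →ₗ[ℂ] A ⊗[ℂ] W :=
  (LinearEquiv.ofInjective (W.subtype.lTensor A)
    (Module.Flat.lTensor_preserves_injective_linearMap _ W.injective_subtype)).symm.toLinearMap ∘ₗ
  (ρ ∘ₗ W.subtype).codRestrict _ fun w => isSubcomodule_iff.mpr hW w w.2

lemma lTensor_restrictCoaction {W : Submodule ℂ V} (hW : IsContractStable ρ W) (w : W) :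
    W.subtype.lTensor A (restrictCoaction ρ W hW w) = ρ w := by
  have := LinearEquiv.apply_symm_apply (LinearEquiv.ofInjective (W.subtype.lTensor A)
    (Module.Flat.lTensor_preserves_injective_linearMap _ W.injective_subtype))
    ⟨ρ w, isSubcomodule_iff.mpr hW w w.2⟩
  exact congrArg Subtype.val this

lemma coe_contract_restrictCoaction {W : Submodule ℂ V} (hW : IsContractStable ρ W)
    (φ : Module.Dual ℂ A) (w : W) :
    (contract W φ (restrictCoaction ρ W hW w) : V) = contract V φ (ρ w) := by
  rw [← lTensor_restrictCoaction hW, contract_lTensor]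
  rfl

/-- Naturality in `U` of the comultiplication `A ⊗ U → A ⊗ (A ⊗ U)`. -/
lemma assoc_rTensor_comul_lTensor {U : Type} [AddCommGroup U] [Module ℂ U] (f : U →ₗ[ℂ] V)
    (x : A ⊗[ℂ] U) : TensorProduct.assoc ℂ A A V
      ((Coalgebra.comul (R := ℂ) (A := A)).rTensor V (f.lTensor A x)) =
    (f.lTensor A).lTensor A (TensorProduct.assoc ℂ A A U
      ((Coalgebra.comul (R := ℂ) (A := A)).rTensor U x)) := by
  induction x using TensorProduct.induction_on with
  | zero => simp
  | add x y hx hy => simp only [map_add, hx, hy]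
  | tmul a v =>
    simp only [LinearMap.rTensor_tmul, LinearMap.lTensor_tmul]
    generalize Coalgebra.comul (R := ℂ) a = z
    induction z using TensorProduct.induction_on with
    | zero => simp
    | add x y hx hy => simp only [map_add, TensorProduct.add_tmul, hx, hy]
    | tmul a b => simp

/-- A comodule structure can be checked after an injective map of coactions. -/
lemma IsComodule.of_injective {U : Type} [AddCommGroup U] [Module ℂ U] {σ : U →ₗ[ℂ] A ⊗[ℂ] U}
    (hρ : IsComodule A ρ) (f : U →ₗ[ℂ] V) (hf : Function.Injective f)
    (hσ : ∀ u, f.lTensor A (σ u) = ρ (f u)) : IsComodule A σ where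
  counit u := hf (by
    rw [← hρ.counit (f u), ← hσ]
    exact (contract_lTensor _ f _).symm)
  coassoc u := by
    have hinj : Function.Injective ((f.lTensor A).lTensor A) :=
      Module.Flat.lTensor_preserves_injective_linearMap _
        (Module.Flat.lTensor_preserves_injective_linearMap _ hf)
    apply hinj
    have h1 : (f.lTensor A) ∘ₗ σ = ρ ∘ₗ f := LinearMap.ext hσ
    rw [← LinearMap.comp_apply (LinearMap.lTensor A (LinearMap.lTensor A f)),
      ← LinearMap.lTensor_comp, h1, LinearMap.lTensor_comp, LinearMap.comp_apply, hσ,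
      ← hρ.coassoc, ← hσ]
    exact (assoc_rTensor_comul_lTensor f (σ u)).symm

lemma isComodule_restrictCoaction (hρ : IsComodule A ρ) {W : Submodule ℂ V}
    (hW : IsContractStable ρ W) : IsComodule A (restrictCoaction ρ W hW) :=
  hρ.of_injective W.subtype W.injective_subtype (lTensor_restrictCoaction hW)

/-- For a reductive group, stable subspaces of a finite-dimensional stable subspace have stable
complements in it. -/
lemma IsReductive.exists_stable_compl (hA : IsReductive A) (hρ : IsComodule A ρ)
    {W W₁ : Submodule ℂ V} [FiniteDimensional ℂ W] (hW : IsContractStable ρ W)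
    (hW₁ : IsContractStable ρ W₁) (hle : W₁ ≤ W) :
    ∃ L : Submodule ℂ V, IsContractStable ρ L ∧ L ≤ W ∧ W₁ ⊔ L = W ∧ W₁ ⊓ L = ⊥ := by
  obtain ⟨L, hL, hc⟩ := hA W (restrictCoaction ρ W hW) (isComodule_restrictCoaction hρ hW)
    (W₁.comap W.subtype) (isSubcomodule_iff.mpr fun φ w hw => by
      rw [Submodule.mem_comap, Submodule.subtype_apply, coe_contract_restrictCoaction]
      exact hW₁ φ _ hw)
  rw [isSubcomodule_iff] at hL
  have hmap : (W₁.comap W.subtype).map W.subtype = W₁ := by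
    rw [Submodule.map_comap_subtype, inf_eq_right.mpr hle]
  refine ⟨L.map W.subtype, ?_, Submodule.map_subtype_le _ _, ?_, ?_⟩
  · rintro φ _ ⟨l, hl, rfl⟩
    exact ⟨_, hL φ l hl, coe_contract_restrictCoaction hW φ l⟩
  · rw [← hmap, ← Submodule.map_sup, hc.sup_eq_top, Submodule.map_subtype_top]
  · rw [← hmap, ← Submodule.map_inf _ W.injective_subtype, hc.inf_eq_bot, Submodule.map_bot]

end Comodule

/-! ### The invariant integral of a reductive group -/

section Integral

variable {A : Type} [CommRing A] [HopfAlgebra ℂ A]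

variable (A) in
lemma isComodule_comul : IsComodule A (Coalgebra.comul (R := ℂ) (A := A)) where
  counit a := by
    rw [Coalgebra.rTensor_counit_comul]
    simp
  coassoc a := Coalgebra.coassoc_apply a

/-- The line of constant functions has a stable complement in the regular representation. -/
lemma IsReductive.exists_compl_one (hA : IsReductive A) :
    ∃ W : Submodule ℂ A, IsContractStable (Coalgebra.comul (R := ℂ) (A := A)) W ∧
      (1 : A) ∉ W ∧ ∀ a : A, ∃ c : ℂ, a - algebraMap ℂ A c ∈ W := by
  have hΔ := isComodule_comul A
  set Δ := Coalgebra.comul (R := ℂ) (A := A)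
  have h1 : IsContractStable Δ (Submodule.span ℂ {(1 : A)}) := by
    intro φ w hw
    obtain ⟨c, rfl⟩ := Submodule.mem_span_singleton.mp hw
    rw [map_smul, map_smul, Bialgebra.comul_one, Algebra.TensorProduct.one_def, contract_tmul,
      smul_smul]
    exact Submodule.smul_mem _ _ (Submodule.mem_span_singleton_self _)
  by_cases hnt : (1 : A) = 0
  · -- the zero ring cannot occur, as the counit maps `1` to `1`
    exact absurd (by simpa using congrArg (Coalgebra.counit (R := ℂ) (A := A)) hnt)
      (one_ne_zero (α := ℂ))
  obtain ⟨W, hW⟩ := zorn_le_nonempty₀ {W : Submodule ℂ A | IsContractStable Δ W ∧ (1 : A) ∉ W}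
    (fun c hc hchain W₀ hW₀ => by
      refine ⟨sSup c, ⟨?_, ?_⟩, fun W hW => le_sSup hW⟩
      · intro φ w hw
        rw [Submodule.mem_sSup_of_directed ⟨W₀, hW₀⟩ hchain.directedOn] at hw ⊢
        obtain ⟨W, hW, hw⟩ := hw
        exact ⟨W, hW, (hc hW).1 φ w hw⟩
      · rw [Submodule.mem_sSup_of_directed ⟨W₀, hW₀⟩ hchain.directedOn]
        rintro ⟨W, hW, hw⟩
        exact (hc hW).2 hw) ⊥ ⟨fun φ w hw => by
          rw [(Submodule.mem_bot ℂ).mp hw]; simp, by simpa using hnt⟩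
  obtain ⟨-, hmax⟩ := hW
  have hWs := hmax.prop.1
  refine ⟨W, hWs, hmax.prop.2, fun a => ?_⟩
  suffices h : a ∈ Submodule.span ℂ {(1 : A)} ⊔ W by
    obtain ⟨x, hx, y, hy, rfl⟩ := Submodule.mem_sup.mp h
    obtain ⟨c, rfl⟩ := Submodule.mem_span_singleton.mp hx
    exact ⟨c, by simpa [Algebra.algebraMap_eq_smul_one] using hy⟩
  have := finiteDimensional_orbitSpan (ρ := Δ) a
  have hU := isContractStable_orbitSpan hΔ a
  obtain ⟨L, hL, -, hsup, hinf⟩ := hA.exists_stable_compl hΔ hU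
    (hU.inf (h1.sup hWs)) inf_le_left
  -- `W ⊔ L` does not contain `1` either, so `L = 0` by maximality
  have hLW : L ≤ W := by
    refine le_sup_right.trans (hmax.le_of_ge (y := W ⊔ L) ⟨hWs.sup hL, fun h => ?_⟩ le_sup_left)
    obtain ⟨w, hw, l, hl, hwl⟩ := Submodule.mem_sup.mp h
    have hl' : l ∈ Submodule.span ℂ {(1 : A)} ⊔ W := by
      rw [← sub_eq_iff_eq_add'.mpr hwl.symm]
      exact Submodule.sub_mem _ (Submodule.mem_sup_left (Submodule.mem_span_singleton_self _))
        (Submodule.mem_sup_right hw)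
    have hl'' : l ∈ orbitSpan Δ a := hsup ▸ Submodule.mem_sup_right hl
    have : l ∈ (⊥ : Submodule ℂ A) := hinf ▸ ⟨⟨hl'', hl'⟩, hl⟩
    rw [(Submodule.mem_bot ℂ).mp this, add_zero] at hwl
    exact hmax.prop.2 (hwl ▸ hw)
  have ha := self_mem_orbitSpan hΔ a
  rw [← hsup] at ha
  exact (sup_le inf_le_right (hLW.trans le_sup_right)) ha

/-- A normalized functional on `A` that is invariant under left translations. -/
lemma IsReductive.exists_left_integral (hA : IsReductive A) :
    ∃ ν : Module.Dual ℂ A, ν 1 = 1 ∧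
      ∀ a, ν.lTensor A (Coalgebra.comul (R := ℂ) a) = 1 ⊗ₜ ν a := by
  obtain ⟨W, hW, h1, hc⟩ := hA.exists_compl_one
  have hcompl : IsCompl (Submodule.span ℂ {(1 : A)}) W := by
    constructor
    · rw [disjoint_iff, eq_bot_iff]
      rintro x ⟨hx, hxW⟩
      obtain ⟨c, rfl⟩ := Submodule.mem_span_singleton.mp hx
      by_cases h : c = 0
      · simp [h]
      · exact absurd ((Submodule.smul_mem_iff _ h).mp hxW) h1
    · rw [codisjoint_iff, eq_top_iff]
      intro a _
      obtain ⟨c, h⟩ := hc a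
      refine Submodule.mem_sup.mpr ⟨_, Submodule.mem_span_singleton.mpr ⟨c, rfl⟩, _, h, ?_⟩
      simp [Algebra.algebraMap_eq_smul_one]
  have h0 : (1 : A) ≠ 0 := fun h => h1 (h ▸ W.zero_mem)
  set ν : Module.Dual ℂ A := (LinearEquiv.toSpanNonzeroSingleton ℂ A 1 h0).symm.toLinearMap ∘ₗ
    Submodule.projectionOnto _ W hcompl
  have hν1 : ν 1 = 1 := by
    have : Submodule.projectionOnto _ W hcompl (1 : A) =
        ⟨1, Submodule.mem_span_singleton_self _⟩ :=
      Submodule.projectionOnto_apply_left hcompl ⟨1, Submodule.mem_span_singleton_self _⟩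
    change (LinearEquiv.toSpanNonzeroSingleton ℂ A 1 h0).symm _ = 1
    rw [this, LinearEquiv.symm_apply_eq]
    ext
    simp
  have hνW : ∀ w ∈ W, ν w = 0 := fun w hw => by
    change (LinearEquiv.toSpanNonzeroSingleton ℂ A 1 h0).symm _ = 0
    rw [(Submodule.projectionOnto_apply_eq_zero_iff hcompl).mpr hw, map_zero]
  refine ⟨ν, hν1, fun a => ?_⟩
  obtain ⟨c, h⟩ := hc a
  obtain ⟨w, hw, rfl⟩ : ∃ w ∈ W, a = algebraMap ℂ A c + w := ⟨_, h, by ring⟩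
  have hmap : ν (algebraMap ℂ A c + w) = c := by
    rw [map_add, hνW w hw, Algebra.algebraMap_eq_smul_one, map_smul, hν1]; simp
  rw [hmap, map_add, map_add]
  obtain ⟨y, hy⟩ := isSubcomodule_iff.mpr hW w hw
  have h0' : ν.lTensor A (Coalgebra.comul (R := ℂ) w) = 0 := by
    rw [← hy, ← LinearMap.comp_apply (ν.lTensor A), ← LinearMap.lTensor_comp,
      show ν ∘ₗ W.subtype = 0 from LinearMap.ext fun w => hνW w w.2, LinearMap.lTensor_zero,
      LinearMap.zero_apply]
  rw [h0', add_zero, Algebra.algebraMap_eq_smul_one, map_smul, Bialgebra.comul_one,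
    Algebra.TensorProduct.one_def, map_smul, LinearMap.lTensor_tmul, hν1, ← TensorProduct.tmul_smul,
    smul_eq_mul, mul_one]

open WithConv in
/-- The antipode reverses the comultiplication. -/
lemma comul_antipode (a : A) : Coalgebra.comul (R := ℂ) (HopfAlgebra.antipode ℂ a) =
    TensorProduct.map (HopfAlgebra.antipode ℂ) (HopfAlgebra.antipode ℂ)
      (TensorProduct.comm ℂ A A (Coalgebra.comul a)) := by
  -- in the group of algebra maps `A → A ⊗ A` the comultiplication is the product of the inclusions
  let l : WithConv (A →ₐ[ℂ] A ⊗[ℂ] A) := toConv Algebra.TensorProduct.includeLeft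
  let r : WithConv (A →ₐ[ℂ] A ⊗[ℂ] A) := toConv Algebra.TensorProduct.includeRight
  have hΔ : toConv (Bialgebra.comulAlgHom ℂ A) = l * r := by
    apply WithConv.ofConv_injective
    apply AlgHom.ext
    intro a
    change Coalgebra.comul a = (l * r) a
    rw [AlgHom.convMul_apply]
    generalize Coalgebra.comul (R := ℂ) a = x
    induction x using TensorProduct.induction_on with
    | zero => simp
    | add x y hx hy => rw [map_add, ← hx, ← hy]
    | tmul a b => simp [l, r]
  have h : (toConv (Bialgebra.comulAlgHom ℂ A))⁻¹ = r⁻¹ * l⁻¹ :=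
    (congrArg Inv.inv hΔ).trans (mul_inv_rev l r)
  have ha := congrArg (fun f : WithConv (A →ₐ[ℂ] A ⊗[ℂ] A) => f a) h
  change Coalgebra.comul (HopfAlgebra.antipode ℂ a) = (r⁻¹ * l⁻¹) a at ha
  rw [ha, AlgHom.convMul_apply]
  generalize Coalgebra.comul (R := ℂ) a = x
  induction x using TensorProduct.induction_on with
  | zero => simp
  | add x y hx hy => simp only [map_add] at hx hy ⊢; rw [hx, hy]
  | tmul a b =>
    rw [Algebra.TensorProduct.lift_tmul]
    change ((1 : A) ⊗ₜ[ℂ] HopfAlgebra.antipode ℂ a) * (HopfAlgebra.antipode ℂ b ⊗ₜ[ℂ] (1 : A)) = _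
    simp

open WithConv in
lemma antipode_antipode (a : A) :
    HopfAlgebra.antipode ℂ (HopfAlgebra.antipode ℂ a) = a := by
  have h : (toConv (AlgHom.id ℂ A))⁻¹⁻¹ = toConv (AlgHom.id ℂ A) := inv_inv _
  exact congrArg (fun f : WithConv (A →ₐ[ℂ] A) => f a) h

/-- A reductive group has a normalized functional on its coordinate ring that is invariant under
right translations. It plays the role of the integral over a maximal compact subgroup. -/
lemma IsReductive.exists_integral (hA : IsReductive A) :
    ∃ ν : Module.Dual ℂ A, ν 1 = 1 ∧
      ∀ a, ν.rTensor A (Coalgebra.comul (R := ℂ) a) = ν a ⊗ₜ 1 := by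
  obtain ⟨ν, h1, hν⟩ := hA.exists_left_integral
  refine ⟨ν ∘ₗ HopfAlgebra.antipode ℂ, by simp [h1], fun a => ?_⟩
  have hS : Function.Injective (HopfAlgebra.antipode ℂ (A := A)) :=
    Function.LeftInverse.injective antipode_antipode
  have hS' : Function.Injective ((HopfAlgebra.antipode ℂ (A := A)).lTensor ℂ) :=
    Module.Flat.lTensor_preserves_injective_linearMap _ hS
  apply hS'
  have h := hν (HopfAlgebra.antipode ℂ a)
  rw [comul_antipode] at h
  have h2 := congrArg (TensorProduct.comm ℂ A ℂ) h
  simp only [TensorProduct.comm_tmul] at h2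
  rw [LinearMap.lTensor_tmul, HopfAlgebra.antipode_one]
  refine Eq.trans ?_ h2
  generalize Coalgebra.comul (R := ℂ) a = x
  induction x using TensorProduct.induction_on with
  | zero => simp
  | add x y hx hy => simp only [map_add, hx, hy]
  | tmul a b => simp

end Integral


/-! ### Invariants of comodule algebras -/

section Reynolds

variable {A : Type} [CommRing A] [HopfAlgebra ℂ A]
variable {B : Type} [CommRing B] [Algebra ℂ B] (ρ : B →ₐ[ℂ] A ⊗[ℂ] B)

/-- The invariants of a coaction on an algebra. -/
def coinvariants : Subalgebra ℂ B := AlgHom.equalizer ρ Algebra.TensorProduct.includeRight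

variable {ρ}

lemma mem_coinvariants {b : B} : b ∈ coinvariants ρ ↔ ρ b = 1 ⊗ₜ b := Iff.rfl

lemma contract_one_tmul_mul (φ : Module.Dual ℂ A) (b : B) (x : A ⊗[ℂ] B) :
    contract B φ ((1 ⊗ₜ b) * x) = b * contract B φ x := by
  induction x using TensorProduct.induction_on with
  | zero => simp
  | add x y hx hy => simp only [mul_add, map_add, hx, hy]
  | tmul a c => simp

/-- Averaging with a right invariant functional gives invariants. -/
lemma coaction_average {V : Type} [AddCommGroup V] [Module ℂ V] {σ : V →ₗ[ℂ] A ⊗[ℂ] V}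
    (hσ : IsComodule A σ) {ν : Module.Dual ℂ A}
    (hν : ∀ a, ν.rTensor A (Coalgebra.comul (R := ℂ) a) = ν a ⊗ₜ 1) (v : V) :
    σ (contract V ν (σ v)) = 1 ⊗ₜ contract V ν (σ v) := by
  have h1 : ∀ x : A ⊗[ℂ] V, σ (contract V ν x) = contract (A ⊗[ℂ] V) ν (σ.lTensor A x) :=
    fun x => (contract_lTensor ν σ x).symm
  rw [h1, ← hσ.coassoc v]
  have h2 : ∀ (z : A ⊗[ℂ] A) (v : V), contract (A ⊗[ℂ] V) ν (TensorProduct.assoc ℂ A A V (z ⊗ₜ v)) =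
      TensorProduct.lid ℂ A (ν.rTensor A z) ⊗ₜ v := by
    intro z v
    induction z using TensorProduct.induction_on with
    | zero => simp
    | add x y hx hy => simp only [map_add, TensorProduct.add_tmul, hx, hy]
    | tmul a b => simp [TensorProduct.smul_tmul']
  generalize σ v = x
  induction x using TensorProduct.induction_on with
  | zero => simp
  | add x y hx hy => simp only [map_add, TensorProduct.tmul_add, hx, hy]
  | tmul a b =>
    rw [LinearMap.rTensor_tmul, h2, hν, contract_tmul]
    simp [TensorProduct.smul_tmul]

variable (ρ) in
/-- The Reynolds operator: an invariant linear projection onto the invariants, linear over them. -/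
def reynolds (ν : Module.Dual ℂ A) : B →ₗ[ℂ] B := contract B ν ∘ₗ ρ.toLinearMap

lemma reynolds_mem (hρ : IsComodule A ρ.toLinearMap) {ν : Module.Dual ℂ A}
    (hν : ∀ a, ν.rTensor A (Coalgebra.comul (R := ℂ) a) = ν a ⊗ₜ 1) (b : B) :
    reynolds ρ ν b ∈ coinvariants ρ :=
  coaction_average hρ hν b

lemma reynolds_mul {ν : Module.Dual ℂ A} {b : B} (hb : b ∈ coinvariants ρ) (c : B) :
    reynolds ρ ν (b * c) = b * reynolds ρ ν c := by
  change contract B ν (ρ (b * c)) = _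
  rw [map_mul, mem_coinvariants.mp hb, contract_one_tmul_mul]
  rfl

lemma reynolds_of_mem {ν : Module.Dual ℂ A} (h1 : ν 1 = 1) {b : B} (hb : b ∈ coinvariants ρ) :
    reynolds ρ ν b = b := by
  change contract B ν (ρ b) = _
  rw [mem_coinvariants.mp hb, contract_tmul, h1, one_smul]

/-- Invariants that generate the unit ideal generate it already in the ring of invariants. -/
lemma IsReductive.span_eq_top (hA : IsReductive A) (hρ : IsComodule A ρ.toLinearMap)
    (s : Set (coinvariants ρ)) (hs : Ideal.span ((coinvariants ρ).val '' s) = ⊤) :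
    Ideal.span s = ⊤ := by
  obtain ⟨ν, h1, hν⟩ := hA.exists_integral
  have key : ∀ x ∈ Ideal.span ((coinvariants ρ).val '' s), ∀ c,
      (⟨reynolds ρ ν (x * c), reynolds_mem hρ hν _⟩ : coinvariants ρ) ∈ Ideal.span s := by
    intro x hx
    induction hx using Submodule.span_induction with
    | zero =>
      intro c
      have := Ideal.zero_mem (Ideal.span s)
      simp only [zero_mul, map_zero]
      exact this
    | mem x hx =>
      intro c
      obtain ⟨y, hy, rfl⟩ := hx
      have : (⟨reynolds ρ ν (y * c), reynolds_mem hρ hν _⟩ : coinvariants ρ) =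
          y * ⟨reynolds ρ ν c, reynolds_mem hρ hν _⟩ := Subtype.ext (reynolds_mul y.2 c)
      exact this ▸ Ideal.mul_mem_right _ _ (Ideal.subset_span hy)
    | add x y _ _ hx hy =>
      intro c
      have := Ideal.add_mem _ (hx c) (hy c)
      simp only [add_mul, map_add]
      exact this
    | smul d x _ hx =>
      intro c
      have := hx (d * c)
      rwa [mul_left_comm, ← mul_assoc] at this
  rw [Ideal.eq_top_iff_one] at hs ⊢
  have := key 1 hs 1
  rw [one_mul] at this
  convert this
  exact (reynolds_of_mem h1 (one_mem _)).symm

/-- An equivariant surjection of comodule algebras is surjective on invariants. -/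
lemma IsReductive.map_coinvariants (hA : IsReductive A) {C : Type} [CommRing C] [Algebra ℂ C]
    {σ : C →ₐ[ℂ] A ⊗[ℂ] C} (hσ : IsComodule A σ.toLinearMap)
    (f : C →ₐ[ℂ] B) (hf : Function.Surjective f)
    (hfσ : ∀ c, f.toLinearMap.lTensor A (σ c) = ρ (f c)) :
    (coinvariants σ).map f = coinvariants ρ := by
  obtain ⟨ν, h1, hν⟩ := hA.exists_integral
  apply le_antisymm
  · rintro _ ⟨c, hc, rfl⟩
    change ρ (f c) = _
    rw [← hfσ, mem_coinvariants.mp hc]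
    simp
  · intro b hb
    obtain ⟨c, rfl⟩ := hf b
    refine ⟨reynolds σ ν c, reynolds_mem hσ hν c, ?_⟩
    rw [← reynolds_of_mem h1 hb]
    change f (contract C ν (σ c)) = contract B ν (ρ (f c))
    rw [← hfσ, contract_lTensor]
    rfl

end Reynolds

/-! ### Hilbert's finiteness theorem -/

section Hilbert

open MvPolynomial

variable {A : Type} [CommRing A] [HopfAlgebra ℂ A]
variable {κ : Type} {σ : MvPolynomial κ ℂ →ₐ[ℂ] A ⊗[ℂ] MvPolynomial κ ℂ}

attribute [local instance] MvPolynomial.gradedAlgebra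

lemma contract_mem_of_mem_baseChange {V : Type} [AddCommGroup V] [Module ℂ V] {W : Submodule ℂ V}
    {x : A ⊗[ℂ] V} (hx : x ∈ W.baseChange A) (φ : Module.Dual ℂ A) : contract V φ x ∈ W := by
  rw [Submodule.baseChange_eq_span] at hx
  induction hx using Submodule.span_induction generalizing φ with
  | zero => simp
  | mem x hx =>
    obtain ⟨w, hw, rfl⟩ := hx
    rw [TensorProduct.mk_apply, contract_tmul]
    exact W.smul_mem _ hw
  | add x y _ _ hx hy => rw [map_add]; exact W.add_mem (hx φ) (hy φ)
  | smul a x _ hx =>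
    have h : ∀ y : A ⊗[ℂ] V, contract V φ (a • y) = contract V (φ ∘ₗ LinearMap.mulLeft ℂ a) y := by
      intro y
      induction y using TensorProduct.induction_on with
      | zero => simp
      | add x y hx hy => rw [smul_add, map_add, map_add, hx, hy]
      | tmul b v => simp [TensorProduct.smul_tmul']
    rw [h]
    exact hx _

/-- A coaction given by linear substitutions preserves degrees. -/
lemma coaction_homogeneous (hσ : ∀ i, σ (X i) ∈ (homogeneousSubmodule κ ℂ 1).baseChange A)
    {d : ℕ} {p : MvPolynomial κ ℂ} (hp : p ∈ homogeneousSubmodule κ ℂ d) :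
    σ p ∈ (homogeneousSubmodule κ ℂ d).baseChange A := by
  rw [p.as_sum, map_sum]
  refine Submodule.sum_mem _ fun s hs => ?_
  have hd : ∑ i ∈ s.support, s i • 1 = d := by
    have := hp (MvPolynomial.mem_support_iff.mp hs)
    rw [← this]
    simp [Finsupp.weight_apply, Finsupp.sum]
  rw [monomial_eq, map_mul, ← algebraMap_eq, AlgHom.commutes, ← Algebra.smul_def, Finsupp.prod,
    map_prod]
  refine Submodule.smul_of_tower_mem _ _ ?_
  simp only [map_pow]
  rw [← hd]
  exact SetLike.prod_pow_mem_graded (fun i => (homogeneousSubmodule κ ℂ i).baseChange A)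
    _ _ _ fun k _ => hσ k

/-- Hilbert's finiteness theorem for linear actions on a polynomial ring: generators of the ideal
spanned by the homogeneous invariants of positive degree generate the algebra of invariants. -/
lemma IsReductive.coinvariants_fg_mvPolynomial [Finite κ] (hA : IsReductive A)
    (hcom : IsComodule A σ.toLinearMap)
    (hσ : ∀ i, σ (X i) ∈ (homogeneousSubmodule κ ℂ 1).baseChange A) :
    (coinvariants σ).FG := by
  obtain ⟨ν, h1, hν⟩ := hA.exists_integral
  have hdec : ∀ (p : MvPolynomial κ ℂ) n,
      (DirectSum.decompose (homogeneousSubmodule κ ℂ) p n : MvPolynomial κ ℂ) =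
        homogeneousComponent n p := decomposition.decompose'_apply
  have hR : ∀ {d : ℕ} {p : MvPolynomial κ ℂ}, p ∈ homogeneousSubmodule κ ℂ d →
      reynolds σ ν p ∈ homogeneousSubmodule κ ℂ d := fun hp =>
    contract_mem_of_mem_baseChange (coaction_homogeneous hσ hp) ν
  let S : Set (MvPolynomial κ ℂ) :=
    {f | f ∈ coinvariants σ ∧ ∃ d, 0 < d ∧ f ∈ homogeneousSubmodule κ ℂ d}
  obtain ⟨T, hTS, hT⟩ := (Submodule.fg_span_iff_fg_span_finset_subset S).mp
    (IsNoetherian.noetherian (Ideal.span S))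
  have key : ∀ d, ∀ p ∈ coinvariants σ, p ∈ homogeneousSubmodule κ ℂ d →
      p ∈ Algebra.adjoin ℂ (T : Set (MvPolynomial κ ℂ)) := by
    intro d
    induction d using Nat.strong_induction_on with
    | _ d ih =>
    intro p hp hpd
    rcases Nat.eq_zero_or_pos d with rfl | hd
    · rw [← homogeneousComponent_eq_self hpd, homogeneousComponent_zero, ← algebraMap_eq]
      exact Subalgebra.algebraMap_mem _ _
    have hpT : p ∈ Ideal.span (T : Set (MvPolynomial κ ℂ)) := by
      change p ∈ Submodule.span _ _
      rw [← hT]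
      exact Submodule.subset_span ⟨hp, d, hd, hpd⟩
    obtain ⟨c, -, hc⟩ := Submodule.mem_span_finset.mp hpT
    choose! e he using fun t (ht : t ∈ T) => (hTS ht).2
    -- take the part of degree `d` in `p = ∑ c t * t` and average
    have hsum : p = ∑ t ∈ T, t * reynolds σ ν
        (if e t ≤ d then homogeneousComponent (d - e t) (c t) else 0) := by
      have h : homogeneousComponent d p = ∑ t ∈ T, t *
          (if e t ≤ d then homogeneousComponent (d - e t) (c t) else 0) := by
        rw [← hc, map_sum]
        refine Finset.sum_congr rfl fun t ht => ?_
        have := DirectSum.coe_decompose_mul_of_right_mem (homogeneousSubmodule κ ℂ) d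
          (a := c t) (he t ht).2
        rw [hdec, hdec] at this
        rw [smul_eq_mul, this]
        split_ifs
        · exact mul_comm _ _
        · exact (mul_zero t).symm
      rw [homogeneousComponent_eq_self hpd] at h
      conv_lhs => rw [← reynolds_of_mem h1 hp, h, map_sum]
      exact Finset.sum_congr rfl fun t ht => reynolds_mul (hTS ht).1 _
    rw [hsum]
    refine Subalgebra.sum_mem _ fun t ht =>
      Subalgebra.mul_mem _ (Algebra.subset_adjoin ht) ?_
    split_ifs with h
    · exact ih (d - e t) (by have := (he t ht).1; omega) _ (reynolds_mem hcom hν _)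
        (hR (homogeneousComponent_mem _ _))
    · rw [map_zero]
      exact Subalgebra.zero_mem _
  refine ⟨T, le_antisymm (Algebra.adjoin_le fun t ht => (hTS ht).1) fun p hp => ?_⟩
  rw [← reynolds_of_mem h1 hp, ← sum_homogeneousComponent p, map_sum]
  exact Subalgebra.sum_mem _ fun i _ => key i _ (reynolds_mem hcom hν _)
    (hR (homogeneousComponent_mem _ _))

end Hilbert

section FiniteType

variable {A : Type} [CommRing A] [HopfAlgebra ℂ A]
variable {B : Type} [CommRing B] [Algebra ℂ B] {ρ : B →ₐ[ℂ] A ⊗[ℂ] B}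

lemma IsContractStable.exists_finiteDimensional {V : Type} [AddCommGroup V] [Module ℂ V]
    {τ : V →ₗ[ℂ] A ⊗[ℂ] V} (hτ : IsComodule A τ) (s : Finset V) :
    ∃ W : Submodule ℂ V, IsContractStable τ W ∧ FiniteDimensional ℂ W ∧ (s : Set V) ⊆ W := by
  classical
  induction s using Finset.induction_on with
  | empty =>
    exact ⟨⊥, fun φ w hw => by rw [(Submodule.mem_bot ℂ).mp hw]; simp, inferInstance, by simp⟩
  | insert a s _ ih =>
    obtain ⟨W, hW, _, hs⟩ := ih
    have := finiteDimensional_orbitSpan (ρ := τ) a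
    refine ⟨orbitSpan τ a ⊔ W, (isContractStable_orbitSpan hτ a).sup hW, inferInstance, ?_⟩
    rw [Finset.coe_insert]
    exact Set.insert_subset (Submodule.mem_sup_left (self_mem_orbitSpan hτ a))
      (hs.trans fun x hx => Submodule.mem_sup_right hx)

/-- The invariants of a reductive group on a finitely generated algebra are finitely generated. -/
theorem IsReductive.coinvariants_fg (hA : IsReductive A) (hρ : IsComodule A ρ.toLinearMap)
    [hB : Algebra.FiniteType ℂ B] : (coinvariants ρ).FG := by
  obtain ⟨s, hs⟩ := hB.out
  obtain ⟨W, hW, _, hsW⟩ := IsContractStable.exists_finiteDimensional hρ s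
  -- the symmetric algebra of `W`, as a polynomial ring
  let b := Module.finBasis ℂ W
  let j : W →ₗ[ℂ] MvPolynomial (Fin (Module.finrank ℂ W)) ℂ := b.constr ℂ MvPolynomial.X
  have hj : ∀ i, j (b i) = MvPolynomial.X i := fun i => b.constr_basis ℂ _ i
  let τ := restrictCoaction ρ.toLinearMap W hW
  have hτ : IsComodule A τ := isComodule_restrictCoaction hρ hW
  let σ : MvPolynomial (Fin (Module.finrank ℂ W)) ℂ →ₐ[ℂ]
      A ⊗[ℂ] MvPolynomial (Fin (Module.finrank ℂ W)) ℂ :=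
    MvPolynomial.aeval fun i => j.lTensor A (τ (b i))
  have hσX : ∀ i, σ (MvPolynomial.X i) = j.lTensor A (τ (b i)) := fun i =>
    MvPolynomial.aeval_X _ i
  have hσj : σ.toLinearMap ∘ₗ j = j.lTensor A ∘ₗ τ := b.ext fun i => by
    simp only [LinearMap.comp_apply, AlgHom.toLinearMap_apply, hj, hσX]
  have hσ : IsComodule A σ.toLinearMap := by
    constructor
    · have h : ((Algebra.TensorProduct.lid ℂ _).toAlgHom.comp (Algebra.TensorProduct.map
          (Bialgebra.counitAlgHom ℂ A) (AlgHom.id ℂ _))).comp σ = AlgHom.id ℂ _ := by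
        refine MvPolynomial.algHom_ext fun i => ?_
        change contract _ Coalgebra.counit (σ (MvPolynomial.X i)) = MvPolynomial.X i
        rw [hσX, contract_lTensor, ← hj i]
        exact congrArg j (hτ.counit (b i))
      exact fun v => AlgHom.congr_fun h v
    · have h : (Algebra.TensorProduct.assoc ℂ ℂ ℂ A A _).toAlgHom.comp
          ((Algebra.TensorProduct.map (Bialgebra.comulAlgHom ℂ A) (AlgHom.id ℂ _)).comp σ) =
          (Algebra.TensorProduct.map (AlgHom.id ℂ A) σ).comp σ := by
        refine MvPolynomial.algHom_ext fun i => ?_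
        change TensorProduct.assoc ℂ A A _ ((Coalgebra.comul (R := ℂ) (A := A)).rTensor _
          (σ (MvPolynomial.X i))) = σ.toLinearMap.lTensor A (σ (MvPolynomial.X i))
        rw [hσX, assoc_rTensor_comul_lTensor, hτ.coassoc]
        rw [← LinearMap.comp_apply, ← LinearMap.lTensor_comp, ← hσj, LinearMap.lTensor_comp]
        rfl
      exact fun v => AlgHom.congr_fun h v
  let f : MvPolynomial (Fin (Module.finrank ℂ W)) ℂ →ₐ[ℂ] B :=
    MvPolynomial.aeval fun i => (b i : B)
  have hfj : f.toLinearMap ∘ₗ j = W.subtype := b.ext fun i => by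
    simp [hj, f]
  have hf : Function.Surjective f := by
    rw [← AlgHom.range_eq_top, eq_top_iff, ← hs, Algebra.adjoin_le_iff]
    intro x hx
    exact ⟨j ⟨x, hsW hx⟩, LinearMap.congr_fun hfj ⟨x, hsW hx⟩⟩
  rw [← hA.map_coinvariants hσ f hf]
  · refine Subalgebra.FG.map _ (hA.coinvariants_fg_mvPolynomial hσ fun i => ?_)
    rw [hσX]
    generalize τ (b i) = x
    induction x using TensorProduct.induction_on with
    | zero => simp
    | add x y hx hy => rw [map_add]; exact Submodule.add_mem _ hx hy
    | tmul a w =>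
      refine Submodule.tmul_mem_baseChange_of_mem _ ?_
      rw [← b.sum_repr w, map_sum]
      refine Submodule.sum_mem _ fun k _ => ?_
      rw [map_smul, hj]
      exact Submodule.smul_mem _ _ (MvPolynomial.isHomogeneous_X ℂ k)
  · have h : (Algebra.TensorProduct.map (AlgHom.id ℂ A) f).comp σ = ρ.comp f := by
      refine MvPolynomial.algHom_ext fun i => ?_
      change f.toLinearMap.lTensor A (σ (MvPolynomial.X i)) = ρ (f (MvPolynomial.X i))
      rw [hσX, ← LinearMap.comp_apply, ← LinearMap.lTensor_comp, hfj, lTensor_restrictCoaction]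
      simp [f]
    exact fun c => AlgHom.congr_fun h c

end FiniteType


/-! ### Functoriality of pull-back and restriction of functions -/

section Pull

variable {X Y Z : Over SpecC}

lemma le_preimage_comp {f : X ⟶ Y} {g : Y ⟶ Z} {W : Z.left.Opens} {V : Y.left.Opens}
    {U : X.left.Opens} (h : V ≤ g.left ⁻¹ᵁ W) (h' : U ≤ f.left ⁻¹ᵁ V) :
    U ≤ (f ≫ g).left ⁻¹ᵁ W :=
  fun _ hx => h (h' hx)

lemma le_preimage_of_eq {f g : X ⟶ Y} (e : f = g) {V : Y.left.Opens} {U : X.left.Opens}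
    (h : U ≤ f.left ⁻¹ᵁ V) : U ≤ g.left ⁻¹ᵁ V :=
  e ▸ h

lemma le_preimage_mono {f : X ⟶ Y} {V V' : Y.left.Opens} {U : X.left.Opens}
    (h : U ≤ f.left ⁻¹ᵁ V') (i : V' ≤ V) : U ≤ f.left ⁻¹ᵁ V :=
  fun _ hx => i (h hx)

lemma pull_pull (f : X ⟶ Y) (g : Y ⟶ Z) {W : Z.left.Opens} {V : Y.left.Opens} {U : X.left.Opens}
    (h : V ≤ g.left ⁻¹ᵁ W) (h' : U ≤ f.left ⁻¹ᵁ V) (s : Γ(Z.left, W)) :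
    pull f V U h' (pull g W V h s) =
      pull (f ≫ g) W U (le_preimage_comp h h') s :=
  congrArg (fun φ => φ.hom s) (Scheme.Hom.appLE_comp_appLE f.left g.left W V U h h')

lemma res_pull (f : X ⟶ Y) {V : Y.left.Opens} {U U' : X.left.Opens} (h : U ≤ f.left ⁻¹ᵁ V)
    (i : U' ≤ U) (s : Γ(Y.left, V)) :
    res X i (pull f V U h s) = pull f V U' (i.trans h) s :=
  congrArg (fun φ => φ.hom s) (Scheme.Hom.appLE_map f.left h (homOfLE i).op)

lemma pull_res (f : X ⟶ Y) {V V' : Y.left.Opens} {U : X.left.Opens} (h : U ≤ f.left ⁻¹ᵁ V')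
    (i : V' ≤ V) (s : Γ(Y.left, V)) :
    pull f V' U h (res Y i s) = pull f V U (le_preimage_mono h i) s :=
  congrArg (fun φ => φ.hom s) (Scheme.Hom.map_appLE f.left h (homOfLE i).op)

lemma res_res {U V W : X.left.Opens} (i : V ≤ U) (j : W ≤ V) (s : Γ(X.left, U)) :
    res X j (res X i s) = res X (j.trans i) s :=
  congrArg (fun φ => φ.hom s) (X.left.presheaf.map_comp (homOfLE i).op (homOfLE j).op).symm

lemma res_self {U : X.left.Opens} (i : U ≤ U) (s : Γ(X.left, U)) : res X i s = s :=
  congrArg (fun φ => φ.hom s) (X.left.presheaf.map_id (Opposite.op U))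

lemma pull_congr {f g : X ⟶ Y} (e : f = g) {V : Y.left.Opens} {U : X.left.Opens}
    (h : U ≤ f.left ⁻¹ᵁ V) (s : Γ(Y.left, V)) :
    pull f V U h s = pull g V U (le_preimage_of_eq e h) s := by
  subst e
  rfl

lemma pull_id {V U : X.left.Opens} (h : U ≤ (𝟙 X : X ⟶ X).left ⁻¹ᵁ V) (s : Γ(X.left, V)) :
    pull (𝟙 X) V U h s = res X (show U ≤ V from h) s := by
  refine congrArg (fun φ : Γ(X.left, V) ⟶ Γ(X.left, U) => φ.hom s) ?_
  change Scheme.Hom.appLE (𝟙 X.left) V U h = _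
  simp only [Scheme.Hom.appLE]
  exact Category.id_comp _

/-- Functions that agree on the members of an open cover are equal. -/
lemma eq_of_res_eq {κ : Type*} {U : X.left.Opens} (V : κ → X.left.Opens) (i : ∀ j, V j ≤ U)
    (hU : U ≤ ⨆ j, V j) {s t : Γ(X.left, U)} (h : ∀ j, res X (i j) s = res X (i j) t) : s = t :=
  X.left.sheaf.eq_of_locally_eq' V U (fun j => homOfLE (i j)) hU s t h

end Pull

/-! ### Stable open sets and invariant functions -/

lemma IsStable.act_le {G : Over SpecC} [GrpObj G] {X : Over SpecC} [ModObj G X]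
    {U : X.left.Opens} (h : IsStable G X U) :
    (snd G X).left ⁻¹ᵁ U ≤ (act G X).left ⁻¹ᵁ U :=
  (show (act G X).left ⁻¹ᵁ U = (snd G X).left ⁻¹ᵁ U from h).ge

/-- On a stable open set the condition `a^* f = p^* f` can be read on `G × U`. -/
lemma mem_invariants_iff {G : Over SpecC} [GrpObj G] {X : Over SpecC} [ModObj G X]
    {U : X.left.Opens} (hs : IsStable G X U) (f : Γ(X.left, U)) :
    f ∈ invariants G X U ↔
      pull (act G X) U _ hs.act_le f = pull (snd G X) U _ le_rfl f := by
  have hle : (snd G X).left ⁻¹ᵁ U ≤ (act G X).left ⁻¹ᵁ U ⊓ (snd G X).left ⁻¹ᵁ U :=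
    le_inf hs.act_le le_rfl
  constructor
  · intro h
    have := congrArg (res _ hle) (show pull _ _ _ _ f = pull _ _ _ _ f from h)
    rwa [res_pull, res_pull] at this
  · intro h
    have := congrArg (res _ (V := (act G X).left ⁻¹ᵁ U ⊓ (snd G X).left ⁻¹ᵁ U) inf_le_right) h
    rwa [res_pull, res_pull] at this

/-! ### Brackets of invariant functions -/

/-- Invariant functions have invariant brackets: pull-back along both the action and the projection
preserves brackets. -/
theorem bracket_mem_invariants {G : Over SpecC} [GrpObj G] {X : Over SpecC} [ModObj G X]
    {PG : PoissonStructure G} {PX : PoissonStructure X} (hact : IsPoissonAction PG PX)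
    {U : X.left.Opens} {f g : Γ(X.left, U)} (hf : f ∈ invariants G X U)
    (hg : g ∈ invariants G X U) : PX.bracket U f g ∈ invariants G X U := by
  obtain ⟨P, hP, ha⟩ := hact
  let W := (act G X).left ⁻¹ᵁ U ⊓ (snd G X).left ⁻¹ᵁ U
  have h1 : ∀ f g, pull (act G X) U W inf_le_left (PX.bracket U f g) =
      P.bracket W (pull (act G X) U W inf_le_left f) (pull (act G X) U W inf_le_left g) := by
    intro f g
    have := congrArg (res (G ⊗ X) (V := W) inf_le_left) (ha U f g)
    rwa [P.restrict, res_pull, res_pull, res_pull] at this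
  have hW : W ≤ (fst G X).left ⁻¹ᵁ ⊤ ⊓ (snd G X).left ⁻¹ᵁ U := fun x hx => ⟨trivial, hx.2⟩
  have hbox : ∀ f, res (G ⊗ X) hW (boxProd (1 : Γ(G.left, ⊤)) f) =
      pull (snd G X) U W inf_le_right f := by
    intro f
    rw [boxProd, map_one, one_mul, res_pull]
  have h2 : ∀ f g, pull (snd G X) U W inf_le_right (PX.bracket U f g) =
      P.bracket W (pull (snd G X) U W inf_le_right f) (pull (snd G X) U W inf_le_right g) := by
    intro f g
    have := congrArg (res (G ⊗ X) hW) (hP ⊤ U 1 1 f g)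
    rw [P.restrict, PG.alternating, hbox, hbox] at this
    rw [this, boxProd, map_zero, zero_mul, zero_add, mul_one, hbox]
  have hf' : pull (act G X) U W inf_le_left f = pull (snd G X) U W inf_le_right f := hf
  have hg' : pull (act G X) U W inf_le_left g = pull (snd G X) U W inf_le_right g := hg
  change pull (act G X) U W inf_le_left _ = pull (snd G X) U W inf_le_right _
  rw [h1, h2, hf', hg']

/-! ### Functions on `G × Y` -/

section Box

/-- The pull-back of elements of `R` along a morphism to `Spec R`, as functions on an open set. -/
def specPull {R : CommRingCat} {T : Scheme} (w : T ⟶ Spec R) (W : T.Opens) : R ⟶ Γ(T, W) :=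
  (Scheme.ΓSpecIso R).inv ≫ w.appLE ⊤ W (fun _ _ => trivial)

lemma specPull_comp_specMap {R S : CommRingCat} {T : Scheme} (w : T ⟶ Spec R) (φ : S ⟶ R)
    (W : T.Opens) : specPull (w ≫ Spec.map φ) W = φ ≫ specPull w W := by
  unfold specPull
  rw [← Category.assoc φ, Scheme.ΓSpecIso_inv_naturality, Category.assoc]
  congr 1

variable {A : Type} [CommRing A] [HopfAlgebra ℂ A]

/-- The pull-back of regular functions along a morphism to the group `Spec A`. -/
def grpPull {T : Over SpecC} (g : T ⟶ algGroup A) (W : T.left.Opens) : A →ₐ[ℂ] Γ(T.left, W) :=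
  { (specPull (R := CommRingCat.of A) g.left W).hom with
    commutes' := fun c => by
      have hw : g.left ≫ Spec.map (CommRingCat.ofHom (algebraMap ℂ A)) = T.hom := Over.w g
      have h := (congrArg (fun w => specPull (R := CommRingCat.of ℂ) w W) hw).symm.trans
        (specPull_comp_specMap (R := CommRingCat.of A) g.left
          (CommRingCat.ofHom (algebraMap ℂ A)) W)
      exact (congrArg (fun φ => φ.hom c) h).symm }

lemma pull_grpPull {S T : Over SpecC} (h : S ⟶ T) (g : T ⟶ algGroup A) {W : T.left.Opens}
    {W' : S.left.Opens} (i : W' ≤ h.left ⁻¹ᵁ W) (a : A) :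
    pull h W W' i (grpPull g W a) = grpPull (h ≫ g) W' a :=
  pull_pull h g (W := ⊤) (fun _ _ => trivial) i ((Scheme.ΓSpecIso (CommRingCat.of A)).inv.hom a)

/-- Pull-back of functions along a product of group-valued morphisms. -/
lemma grpPull_mul {T : Over SpecC} (g₁ g₂ : T ⟶ algGroup A) (W : T.left.Opens) (a : A) :
    grpPull (lift g₁ g₂ ≫ μ[algGroup A]) W a =
      Algebra.TensorProduct.productMap (grpPull g₁ W) (grpPull g₂ W)
        (Coalgebra.comul (R := ℂ) a) := by
  let w : T.left ⟶ Spec (CommRingCat.of (A ⊗[ℂ] A)) :=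
    (lift g₁ g₂).left ≫ (pullbackSpecIso ℂ A A).hom
  have h0 := specPull_comp_specMap (R := CommRingCat.of (A ⊗[ℂ] A)) w
    (CommRingCat.ofHom (Bialgebra.comulAlgHom ℂ A).toRingHom) W
  have h1 := specPull_comp_specMap (R := CommRingCat.of (A ⊗[ℂ] A)) w
    (CommRingCat.ofHom (Algebra.TensorProduct.includeLeftRingHom (R := ℂ) (A := A) (B := A))) W
  have h2 := specPull_comp_specMap (R := CommRingCat.of (A ⊗[ℂ] A)) w
    (CommRingCat.ofHom (Algebra.TensorProduct.includeRight (R := ℂ) (A := A) (B := A)).toRingHom) W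
  have e0 : w ≫ Spec.map (CommRingCat.ofHom (Bialgebra.comulAlgHom ℂ A).toRingHom) =
      (lift g₁ g₂ ≫ μ[algGroup A]).left := by
    rw [Over.comp_left, mul_spec_asOver_spec_left]
    exact Category.assoc _ _ _
  have e1 : w ≫ Spec.map (CommRingCat.ofHom
      (Algebra.TensorProduct.includeLeftRingHom (R := ℂ) (A := A) (B := A))) = g₁.left := by
    refine (Category.assoc _ _ _).trans ((congrArg (_ ≫ ·) (pullbackSpecIso_hom_fst ℂ A A)).trans ?_)
    exact congrArg (fun f => f.left) (lift_fst g₁ g₂)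
  have e2 : w ≫ Spec.map (CommRingCat.ofHom
      (Algebra.TensorProduct.includeRight (R := ℂ) (A := A) (B := A)).toRingHom) = g₂.left := by
    refine (Category.assoc _ _ _).trans ((congrArg (_ ≫ ·) (pullbackSpecIso_hom_snd ℂ A A)).trans ?_)
    exact congrArg (fun f => f.left) (lift_snd g₁ g₂)
  replace h0 := (congrArg (fun w => specPull (R := CommRingCat.of A) w W) e0).symm.trans h0
  replace h1 := (congrArg (fun w => specPull (R := CommRingCat.of A) w W) e1).symm.trans h1
  replace h2 := (congrArg (fun w => specPull (R := CommRingCat.of A) w W) e2).symm.trans h2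
  refine (congrArg (fun φ => φ.hom a) h0).trans ?_
  change (specPull w W).hom (Coalgebra.comul (R := ℂ) a) = _
  generalize Coalgebra.comul (R := ℂ) a = x
  induction x using TensorProduct.induction_on with
  | zero => rw [map_zero, map_zero]
  | add x y hx hy => rw [map_add, map_add, hx, hy]
  | tmul a b =>
    rw [Algebra.TensorProduct.productMap_apply_tmul]
    have : a ⊗ₜ[ℂ] b = (a ⊗ₜ[ℂ] (1 : A)) * ((1 : A) ⊗ₜ[ℂ] b) := by simp
    rw [this, map_mul]
    exact (congrArg₂ (· * ·) (congrArg (fun φ => φ.hom a) h1)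
      (congrArg (fun φ => φ.hom b) h2)).symm

lemma grpPull_one {T : Over SpecC} (W : T.left.Opens) (a : A) :
    grpPull (toUnit T ≫ η[algGroup A]) W a = algebraMap ℂ _ (Coalgebra.counit (R := ℂ) a) := by
  have h := specPull_comp_specMap (R := CommRingCat.of ℂ) (toUnit T).left
    (CommRingCat.ofHom (Bialgebra.counitAlgHom ℂ A).toRingHom) W
  have e : (toUnit T).left ≫ Spec.map (CommRingCat.ofHom (Bialgebra.counitAlgHom ℂ A).toRingHom) =
      (toUnit T ≫ η[algGroup A]).left := by
    rw [Over.comp_left, one_spec_asOver_spec_left]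
    rfl
  replace h := (congrArg (fun w => specPull (R := CommRingCat.of A) w W) e).symm.trans h
  have h' : (toUnit T).left = T.hom := (Category.comp_id _).symm.trans (Over.w (toUnit T))
  replace h := h.trans (congrArg (fun w => CommRingCat.ofHom (Bialgebra.counitAlgHom ℂ A).toRingHom ≫
    specPull (R := CommRingCat.of ℂ) w W) h')
  exact congrArg (fun φ => φ.hom a) h

/-- The map `A ⊗ Γ(Y, U) → Γ(G × Y, G × U)`, sending `a ⊗ f` to the product function. -/
def boxHom (A : Type) [CommRing A] [HopfAlgebra ℂ A] (Y : Over SpecC) (U : Y.left.Opens) :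
    A ⊗[ℂ] Γ(Y.left, U) →ₐ[ℂ] Γ((algGroup A ⊗ Y).left, (snd (algGroup A) Y).left ⁻¹ᵁ U) :=
  Algebra.TensorProduct.productMap (grpPull (fst (algGroup A) Y) _)
    (pull (snd (algGroup A) Y) U _ le_rfl)

lemma boxHom_bijective (Y : Over SpecC) {U : Y.left.Opens} (hU : IsAffineOpen U) :
    Function.Bijective (boxHom A Y U) := by
  have H : IsPullback (fst (algGroup A) Y).left (snd (algGroup A) Y).left (algGroup A).hom Y.hom :=
    IsPullback.of_hasPullback _ _
  have : IsAffine (algGroup A).left := inferInstanceAs (IsAffine (Spec _))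
  have h := (isIso_pushoutSection_iff H (US := ⊤) (UX := ⊤) (UT := U) (fun _ _ => trivial)
    (fun _ _ => trivial) (UY := (snd (algGroup A) Y).left ⁻¹ᵁ U) (by simp)).mp
    (isIso_pushoutSection_of_isAffineOpen H _ _ _ (isAffineOpen_top _) hU (isAffineOpen_top _))
  have h' : IsPushout (CommRingCat.ofHom (algebraMap ℂ A)) (constants Y U)
      (CommRingCat.ofHom (grpPull (fst (algGroup A) Y) ((snd (algGroup A) Y).left ⁻¹ᵁ U)).toRingHom)
      (CommRingCat.ofHom (pull (snd (algGroup A) Y) U _ le_rfl).toRingHom) := by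
    refine IsPushout.of_iso h (Scheme.ΓSpecIso (CommRingCat.of ℂ))
      (Scheme.ΓSpecIso (CommRingCat.of A)) (Iso.refl _) (Iso.refl _) ?_ ?_ ?_ ?_
    · refine (congrArg (· ≫ _) (Scheme.Hom.appLE_eq_app _)).trans ?_
      exact Scheme.ΓSpecIso_naturality (CommRingCat.ofHom (algebraMap ℂ A))
    · exact (Category.comp_id _).trans (Iso.hom_inv_id_assoc _ _).symm
    · exact (Category.comp_id _).trans (Iso.hom_inv_id_assoc _ _).symm
    · exact (Category.comp_id _).trans (Category.id_comp _).symm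
  let e := (CommRingCat.isPushout_tensorProduct ℂ A Γ(Y.left, U)).isoIsPushout _ _ h'
  have h1 := (CommRingCat.isPushout_tensorProduct ℂ A Γ(Y.left, U)).inl_isoIsPushout_hom _ _ h'
  have h2 := (CommRingCat.isPushout_tensorProduct ℂ A Γ(Y.left, U)).inr_isoIsPushout_hom _ _ h'
  have he : ∀ x, boxHom A Y U x = e.hom.hom x := by
    intro x
    induction x using TensorProduct.induction_on with
    | zero => rw [map_zero, map_zero]
    | add x y hx hy => rw [map_add, map_add, hx, hy]
    | tmul a f =>
      have : a ⊗ₜ[ℂ] f = (a ⊗ₜ[ℂ] (1 : Γ(Y.left, U))) * ((1 : A) ⊗ₜ[ℂ] f) := by simp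
      rw [boxHom, Algebra.TensorProduct.productMap_apply_tmul, this, map_mul]
      exact (congrArg₂ (· * ·) (congrArg (fun φ => φ.hom a) h1)
        (congrArg (fun φ => φ.hom f) h2)).symm
  have hb := ConcreteCategory.bijective_of_isIso e.hom
  rwa [show (boxHom A Y U : _ → _) = e.hom.hom from funext he]

/-- The pull-back of a function on `G × Y` along `(g, y)` is computed from the pull-backs along `g`
and `y`. -/
lemma pull_boxHom {T Y : Over SpecC} (h : T ⟶ algGroup A ⊗ Y) {U : Y.left.Opens}
    {W : T.left.Opens} (i : W ≤ h.left ⁻¹ᵁ ((snd (algGroup A) Y).left ⁻¹ᵁ U))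
    (x : A ⊗[ℂ] Γ(Y.left, U)) :
    pull h _ W i (boxHom A Y U x) =
      Algebra.TensorProduct.productMap (grpPull (h ≫ fst (algGroup A) Y) W)
        (pull (h ≫ snd (algGroup A) Y) U W (le_preimage_comp le_rfl i)) x := by
  induction x using TensorProduct.induction_on with
  | zero => simp only [map_zero]
  | add x y hx hy => simp only [map_add, hx, hy]
  | tmul a f =>
    rw [boxHom, Algebra.TensorProduct.productMap_apply_tmul,
      Algebra.TensorProduct.productMap_apply_tmul, map_mul, pull_grpPull, pull_pull]

end Box


/-! ### The coaction on the functions on a stable affine open set -/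

section Coaction

lemma lift_one_act (G : Over SpecC) [GrpObj G] (X : Over SpecC) [ModObj G X] :
    lift (toUnit X ≫ η[G]) (𝟙 X) ≫ act G X = 𝟙 X := by
  have h : η[G] ▷ X ≫ act G X = (λ_ X).hom := ModObj.one_smul X
  have h' : lift (toUnit X ≫ η[G]) (𝟙 X) = lift (toUnit X) (𝟙 X) ≫ η[G] ▷ X := by
    rw [lift_whiskerRight]
  rw [h', Category.assoc, h, leftUnitor_hom, lift_snd]

/-- The two morphisms `(g, h, x) ↦ (g h) x` and `(g, h, x) ↦ g (h x)` agree. -/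
lemma lift_mul_act (G : Over SpecC) [GrpObj G] (X : Over SpecC) [ModObj G X] :
    lift (lift (fst G (G ⊗ X)) (snd G (G ⊗ X) ≫ fst G X) ≫ μ[G]) (snd G (G ⊗ X) ≫ snd G X) ≫
      act G X = lift (fst G (G ⊗ X)) (snd G (G ⊗ X) ≫ act G X) ≫ act G X := by
  have h : μ[G] ▷ X ≫ act G X = (α_ G G X).hom ≫ G ◁ act G X ≫ act G X := ModObj.mul_smul X
  have h1 : lift (fst G (G ⊗ X)) (snd G (G ⊗ X) ≫ act G X) = G ◁ act G X := by
    ext1 <;> simp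
  have h2 : lift (lift (fst G (G ⊗ X)) (snd G (G ⊗ X) ≫ fst G X) ≫ μ[G])
      (snd G (G ⊗ X) ≫ snd G X) = (α_ G G X).inv ≫ μ[G] ▷ X := by
    ext1
    · rw [lift_fst, Category.assoc, whiskerRight_fst, ← Category.assoc]
      congr 1
      ext1 <;> simp
    · simp
  rw [h1, h2, Category.assoc, h, Iso.inv_hom_id_assoc]

variable {A : Type} [CommRing A] [HopfAlgebra ℂ A] {X : Over SpecC} {U : X.left.Opens}

/-- For `m(g, h, x) = (g h, x)`, pull-back along `m` of functions on `G × X` is given by the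
comultiplication. -/
lemma boxHom_assoc_comul (m : algGroup A ⊗ (algGroup A ⊗ X) ⟶ algGroup A ⊗ X)
    (h1 : m ≫ fst (algGroup A) X = lift (fst (algGroup A) (algGroup A ⊗ X))
      (snd (algGroup A) (algGroup A ⊗ X) ≫ fst (algGroup A) X) ≫ μ[algGroup A])
    (h2 : m ≫ snd (algGroup A) X = snd (algGroup A) (algGroup A ⊗ X) ≫ snd (algGroup A) X)
    (hm : (snd (algGroup A) (algGroup A ⊗ X)).left ⁻¹ᵁ ((snd (algGroup A) X).left ⁻¹ᵁ U) ≤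
      m.left ⁻¹ᵁ ((snd (algGroup A) X).left ⁻¹ᵁ U)) (x : A ⊗[ℂ] Γ(X.left, U)) :
    boxHom A (algGroup A ⊗ X) ((snd (algGroup A) X).left ⁻¹ᵁ U)
        ((boxHom A X U).toLinearMap.lTensor A (TensorProduct.assoc ℂ A A Γ(X.left, U)
          ((Coalgebra.comul (R := ℂ) (A := A)).rTensor _ x))) =
      pull m _ _ hm (boxHom A X U x) := by
  rw [pull_boxHom]
  induction x using TensorProduct.induction_on with
  | zero => simp only [map_zero]
  | add x y hx hy => simp only [map_add, hx, hy]
  | tmul a f =>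
    rw [Algebra.TensorProduct.productMap_apply_tmul, LinearMap.rTensor_tmul, h1, grpPull_mul,
      pull_congr h2]
    generalize Coalgebra.comul (R := ℂ) a = z
    induction z using TensorProduct.induction_on with
    | zero => simp only [map_zero, TensorProduct.zero_tmul, zero_mul]
    | add x y hx hy => simp only [map_add, TensorProduct.add_tmul, add_mul, hx, hy]
    | tmul a b =>
      simp only [TensorProduct.assoc_tmul, LinearMap.lTensor_tmul, AlgHom.toLinearMap_apply]
      rw [Algebra.TensorProduct.productMap_apply_tmul, boxHom,
        Algebra.TensorProduct.productMap_apply_tmul, pull_boxHom,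
        Algebra.TensorProduct.productMap_apply_tmul, mul_assoc]

variable [ModObj (algGroup A) X]

/-- The isomorphism `A ⊗ Γ(Y, U) ≃ Γ(G × Y, G × U)` for an affine open set `U`. -/
def boxEquiv (A : Type) [CommRing A] [HopfAlgebra ℂ A] (Y : Over SpecC) {U : Y.left.Opens}
    (hU : IsAffineOpen U) :
    A ⊗[ℂ] Γ(Y.left, U) ≃ₐ[ℂ] Γ((algGroup A ⊗ Y).left, (snd (algGroup A) Y).left ⁻¹ᵁ U) :=
  AlgEquiv.ofBijective (boxHom A Y U) (boxHom_bijective Y hU)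

/-- The coaction `f ↦ a^* f` on the functions on a stable affine open set. -/
def coaction (hU : IsAffineOpen U) (hs : IsStable (algGroup A) X U) :
    Γ(X.left, U) →ₐ[ℂ] A ⊗[ℂ] Γ(X.left, U) :=
  (boxEquiv A X hU).symm.toAlgHom.comp (pull (act (algGroup A) X) U _ hs.act_le)

lemma boxHom_coaction (hU : IsAffineOpen U) (hs : IsStable (algGroup A) X U) (f : Γ(X.left, U)) :
    boxHom A X U (coaction hU hs f) = pull (act (algGroup A) X) U _ hs.act_le f :=
  (boxEquiv A X hU).apply_symm_apply _

lemma isAffineOpen_snd_preimage (Y : Over SpecC) {U : Y.left.Opens} (hU : IsAffineOpen U) :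
    IsAffineOpen ((snd (algGroup A) Y).left ⁻¹ᵁ U) := by
  have H : IsPullback (fst (algGroup A) Y).left (snd (algGroup A) Y).left (algGroup A).hom Y.hom :=
    IsPullback.of_hasPullback _ _
  have : IsAffine (algGroup A).left := inferInstanceAs (IsAffine (Spec _))
  have h1 : IsAffineHom (algGroup A).hom := inferInstance
  have : IsAffineHom (snd (algGroup A) Y).left := MorphismProperty.of_isPullback H h1
  exact hU.preimage _

/-- Pull-back along `s(x) = (1, x)` is the contraction with the counit, and `s` is a section of the
action map. -/
lemma contract_counit_coaction (hU : IsAffineOpen U) (hs : IsStable (algGroup A) X U)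
    (s : X ⟶ algGroup A ⊗ X) (h1 : s ≫ fst (algGroup A) X = toUnit X ≫ η[algGroup A])
    (h2 : s ≫ snd (algGroup A) X = 𝟙 X) (h3 : s ≫ act (algGroup A) X = 𝟙 X)
    (f : Γ(X.left, U)) : contract _ Coalgebra.counit (coaction hU hs f) = f := by
  have hs2 : U ≤ s.left ⁻¹ᵁ ((snd (algGroup A) X).left ⁻¹ᵁ U) := by
    rw [← Scheme.Hom.comp_preimage, ← Over.comp_left, h2]
    exact le_rfl
  have key : ∀ x, contract _ Coalgebra.counit x = pull s _ U hs2 (boxHom A X U x) := by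
    intro x
    rw [pull_boxHom]
    induction x using TensorProduct.induction_on with
    | zero => rw [map_zero, map_zero]
    | add x y hx hy => rw [map_add, map_add, hx, hy]
    | tmul a f =>
      rw [Algebra.TensorProduct.productMap_apply_tmul, contract_tmul, Algebra.smul_def,
        h1, grpPull_one, pull_congr h2, pull_id, res_self]
  rw [key, boxHom_coaction, pull_pull, pull_congr h3, pull_id, res_self]

/-- For `n(g, h, x) = (g, h x)`, pull-back along `n` of functions on `G × X` is given by the
coaction. -/
lemma boxHom_lTensor_coaction (hU : IsAffineOpen U) (hs : IsStable (algGroup A) X U)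
    (n : algGroup A ⊗ (algGroup A ⊗ X) ⟶ algGroup A ⊗ X)
    (h1 : n ≫ fst (algGroup A) X = fst (algGroup A) (algGroup A ⊗ X))
    (h2 : n ≫ snd (algGroup A) X = snd (algGroup A) (algGroup A ⊗ X) ≫ act (algGroup A) X)
    (hn : (snd (algGroup A) (algGroup A ⊗ X)).left ⁻¹ᵁ ((snd (algGroup A) X).left ⁻¹ᵁ U) ≤
      n.left ⁻¹ᵁ ((snd (algGroup A) X).left ⁻¹ᵁ U)) (x : A ⊗[ℂ] Γ(X.left, U)) :
    boxHom A (algGroup A ⊗ X) ((snd (algGroup A) X).left ⁻¹ᵁ U)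
        ((boxHom A X U).toLinearMap.lTensor A ((coaction hU hs).toLinearMap.lTensor A x)) =
      pull n _ _ hn (boxHom A X U x) := by
  rw [pull_boxHom]
  induction x using TensorProduct.induction_on with
  | zero => simp only [map_zero]
  | add x y hx hy => simp only [map_add, hx, hy]
  | tmul a f =>
    simp only [LinearMap.lTensor_tmul, AlgHom.toLinearMap_apply]
    rw [boxHom_coaction, boxHom, Algebra.TensorProduct.productMap_apply_tmul,
      Algebra.TensorProduct.productMap_apply_tmul, pull_pull, h1, pull_congr h2]

/-- Coassociativity of the coaction is associativity of the action: `m(g, h, x) = (g h, x)` and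
`n(g, h, x) = (g, h x)` have the same composition with the action map. -/
lemma coaction_coassoc (hU : IsAffineOpen U) (hs : IsStable (algGroup A) X U)
    (m n : algGroup A ⊗ (algGroup A ⊗ X) ⟶ algGroup A ⊗ X)
    (hm1 : m ≫ fst (algGroup A) X = lift (fst (algGroup A) (algGroup A ⊗ X))
      (snd (algGroup A) (algGroup A ⊗ X) ≫ fst (algGroup A) X) ≫ μ[algGroup A])
    (hm2 : m ≫ snd (algGroup A) X = snd (algGroup A) (algGroup A ⊗ X) ≫ snd (algGroup A) X)
    (hn1 : n ≫ fst (algGroup A) X = fst (algGroup A) (algGroup A ⊗ X))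
    (hn2 : n ≫ snd (algGroup A) X = snd (algGroup A) (algGroup A ⊗ X) ≫ act (algGroup A) X)
    (hmn : m ≫ act (algGroup A) X = n ≫ act (algGroup A) X) (f : Γ(X.left, U)) :
    TensorProduct.assoc ℂ A A Γ(X.left, U)
      ((Coalgebra.comul (R := ℂ) (A := A)).rTensor _ (coaction hU hs f)) =
      (coaction hU hs).toLinearMap.lTensor A (coaction hU hs f) := by
  have hinj : Function.Injective (boxHom A (algGroup A ⊗ X) ((snd (algGroup A) X).left ⁻¹ᵁ U) ∘
      (boxHom A X U).toLinearMap.lTensor A) :=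
    (boxHom_bijective _ (isAffineOpen_snd_preimage X hU)).1.comp
      (Module.Flat.lTensor_preserves_injective_linearMap _ (boxHom_bijective X hU).1)
  have hm : (snd (algGroup A) (algGroup A ⊗ X)).left ⁻¹ᵁ ((snd (algGroup A) X).left ⁻¹ᵁ U) ≤
      m.left ⁻¹ᵁ ((snd (algGroup A) X).left ⁻¹ᵁ U) := by
    rw [← Scheme.Hom.comp_preimage, ← Over.comp_left, ← hm2]
    exact le_rfl
  have hn : (snd (algGroup A) (algGroup A ⊗ X)).left ⁻¹ᵁ ((snd (algGroup A) X).left ⁻¹ᵁ U) ≤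
      n.left ⁻¹ᵁ ((snd (algGroup A) X).left ⁻¹ᵁ U) := by
    have h : n.left ⁻¹ᵁ ((snd (algGroup A) X).left ⁻¹ᵁ U) =
        (snd (algGroup A) (algGroup A ⊗ X)).left ⁻¹ᵁ ((act (algGroup A) X).left ⁻¹ᵁ U) := by
      rw [← Scheme.Hom.comp_preimage, ← Over.comp_left, hn2, Over.comp_left,
        Scheme.Hom.comp_preimage]
    rw [h]
    exact Scheme.Hom.preimage_mono _ hs.act_le
  apply hinj
  rw [Function.comp_apply, Function.comp_apply, boxHom_lTensor_coaction hU hs n hn1 hn2 hn,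
    boxHom_assoc_comul m hm1 hm2 hm, boxHom_coaction, pull_pull, pull_pull, pull_congr hmn]

lemma isComodule_coaction (hU : IsAffineOpen U) (hs : IsStable (algGroup A) X U) :
    IsComodule A (coaction hU hs).toLinearMap where
  counit f := contract_counit_coaction hU hs _ (lift_fst _ _) (lift_snd _ _) (lift_one_act _ _) f
  coassoc f := coaction_coassoc hU hs _ _ (lift_fst _ _) (lift_snd _ _) (lift_fst _ _)
    (lift_snd _ _) (lift_mul_act _ _) f

lemma coinvariants_coaction (hU : IsAffineOpen U) (hs : IsStable (algGroup A) X U) :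
    coinvariants (coaction hU hs) = invariants (algGroup A) X U := by
  ext f
  rw [mem_coinvariants, mem_invariants_iff hs, ← (boxHom_bijective (A := A) X hU).1.eq_iff,
    boxHom_coaction, boxHom, Algebra.TensorProduct.productMap_apply_tmul, map_one, one_mul]

/-- The invariant functions on a stable affine open set are finitely generated. -/
theorem IsReductive.invariants_fg (hA : IsReductive A) (hU : IsAffineOpen U)
    (hs : IsStable (algGroup A) X U) [Algebra.FiniteType ℂ Γ(X.left, U)] :
    (invariants (algGroup A) X U).FG := by
  rw [← coinvariants_coaction hU hs]
  exact hA.coinvariants_fg (isComodule_coaction hU hs)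

/-- Invariant functions without common zero on a stable affine open set generate the unit ideal in
the ring of invariant functions: quotient maps of affine varieties are surjective. -/
theorem IsReductive.invariants_span_eq_top (hA : IsReductive A) (hU : IsAffineOpen U)
    (hs : IsStable (algGroup A) X U) (s : Set (invariants (algGroup A) X U))
    (h : Ideal.span ((invariants (algGroup A) X U).val '' s) = ⊤) : Ideal.span s = ⊤ := by
  revert s
  rw [← coinvariants_coaction hU hs]
  exact fun s => hA.span_eq_top (isComodule_coaction hU hs) s

end Coaction


/-! ### Non-vanishing loci and extension of functions -/

section BasicOpen

variable {X Y : Over SpecC}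

lemma basicOpen_res {U V : X.left.Opens} (i : V ≤ U) (s : Γ(X.left, U)) :
    X.left.basicOpen (res X i s) = V ⊓ X.left.basicOpen s :=
  Scheme.basicOpen_res X.left s (homOfLE i).op

lemma basicOpen_pull (f : X ⟶ Y) {V : Y.left.Opens} {U : X.left.Opens} (h : U ≤ f.left ⁻¹ᵁ V)
    (s : Γ(Y.left, V)) :
    X.left.basicOpen (pull f V U h s) = U ⊓ f.left ⁻¹ᵁ Y.left.basicOpen s := by
  have h1 : X.left.basicOpen (pull f V (f.left ⁻¹ᵁ V) le_rfl s) =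
      f.left ⁻¹ᵁ Y.left.basicOpen s := by
    rw [Scheme.preimage_basicOpen, ← Scheme.Hom.appLE_eq_app]
    rfl
  rw [← h1, ← basicOpen_res h, res_pull]

lemma isUnit_iff_le_basicOpen {U : X.left.Opens} (s : Γ(X.left, U)) :
    IsUnit s ↔ U ≤ X.left.basicOpen s := by
  refine ⟨fun h => (Scheme.basicOpen_of_isUnit X.left h).ge, fun h => ?_⟩
  have h1 : IsUnit (res X (X.left.basicOpen_le s) s) := RingedSpace.isUnit_res_basicOpen _ s
  have h2 := h1.map (res X h)
  rwa [res_res, res_self] at h2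

/-- Functions on a quasi-compact open set that agree where `f` does not vanish agree after
multiplication with a power of `f`. -/
lemma exists_pow_mul_eq {U W : X.left.Opens} (hU : IsCompact (U : Set X.left)) {f s t : Γ(X.left, U)}
    (i : W ≤ U) (hW : X.left.basicOpen f ≤ W) (h : res X i s = res X i t) :
    ∃ n : ℕ, f ^ n * s = f ^ n * t := by
  obtain ⟨n, hn⟩ := exists_pow_mul_eq_zero_of_res_basicOpen_eq_zero_of_isCompact X.left hU
    (s - t) f (by
      have : res X (X.left.basicOpen_le f) (s - t) = 0 := by
        rw [← res_res i hW, map_sub, h, sub_self, map_zero]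
      exact this)
  exact ⟨n, by rwa [mul_sub, sub_eq_zero] at hn⟩

/-- A function defined where `f` does not vanish extends after multiplication with a power
of `f`. -/
lemma exists_res_eq_pow_mul {U W : X.left.Opens} (hU : IsCompact (U : Set X.left))
    (hU' : IsQuasiSeparated (U : Set X.left)) (f : Γ(X.left, U)) (hW : W = X.left.basicOpen f)
    (i : W ≤ U) (s : Γ(X.left, W)) :
    ∃ (n : ℕ) (t : Γ(X.left, U)), res X i t = res X i f ^ n * s := by
  subst hW
  exact exists_eq_pow_mul_of_isCompact_of_isQuasiSeparated X.left U hU hU' f s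

end BasicOpen

/-! ### Stable open sets -/

section Stable

variable {G : Over SpecC} [GrpObj G] {X : Over SpecC} [ModObj G X]

lemma res_mem_invariants {U V : X.left.Opens} (i : V ≤ U) {f : Γ(X.left, U)}
    (hf : f ∈ invariants G X U) : res X i f ∈ invariants G X V := by
  have hle : (act G X).left ⁻¹ᵁ V ⊓ (snd G X).left ⁻¹ᵁ V ≤
      (act G X).left ⁻¹ᵁ U ⊓ (snd G X).left ⁻¹ᵁ U := fun _ hx => ⟨i hx.1, i hx.2⟩
  have := congrArg (res _ hle) (show pull _ _ _ _ f = pull _ _ _ _ f from hf)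
  rw [res_pull, res_pull] at this
  change pull _ _ _ _ _ = pull _ _ _ _ _
  rwa [pull_res, pull_res]

lemma IsStable.basicOpen {U : X.left.Opens} (hs : IsStable G X U) {f : Γ(X.left, U)}
    (hf : f ∈ invariants G X U) : IsStable G X (X.left.basicOpen f) := by
  have h := congrArg (fun s => (G ⊗ X).left.basicOpen s) ((mem_invariants_iff hs f).1 hf)
  simp only [basicOpen_pull] at h
  have h1 : (act G X).left ⁻¹ᵁ X.left.basicOpen f ≤ (snd G X).left ⁻¹ᵁ U := by
    rw [← show (act G X).left ⁻¹ᵁ U = (snd G X).left ⁻¹ᵁ U from hs]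
    exact Scheme.Hom.preimage_mono _ (X.left.basicOpen_le f)
  have h2 : (snd G X).left ⁻¹ᵁ X.left.basicOpen f ≤ (snd G X).left ⁻¹ᵁ U :=
    Scheme.Hom.preimage_mono _ (X.left.basicOpen_le f)
  rwa [inf_eq_right.2 h1, inf_eq_right.2 h2] at h

lemma IsStable.iSup {κ : Sort*} {U : κ → X.left.Opens} (h : ∀ k, IsStable G X (U k)) :
    IsStable G X (⨆ k, U k) := by
  unfold IsStable
  rw [Scheme.Hom.preimage_iSup, Scheme.Hom.preimage_iSup]
  exact iSup_congr h

lemma isStable_top : IsStable G X ⊤ := rfl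

/-- An invariant function on `U_b`, for an invariant function `b` on an affine open set `U`, extends
to an invariant function on `U` after multiplication with a power of `b`. -/
lemma exists_mem_invariants_res_eq {A : Type} [CommRing A] [HopfAlgebra ℂ A]
    [ModObj (algGroup A) X] {U W : X.left.Opens} (hU : IsAffineOpen U)
    (hs : IsStable (algGroup A) X U) {b : Γ(X.left, U)} (hb : b ∈ invariants (algGroup A) X U)
    (hW : W = X.left.basicOpen b) (i : W ≤ U) {g : Γ(X.left, W)}
    (hg : g ∈ invariants (algGroup A) X W) :
    ∃ (n : ℕ) (h : Γ(X.left, U)), h ∈ invariants (algGroup A) X U ∧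
      res X i h = res X i b ^ n * g := by
  obtain ⟨n, h, hn⟩ := exists_res_eq_pow_mul hU.isCompact hU.isQuasiSeparated b hW i g
  have hW' : IsStable (algGroup A) X W := hW ▸ hs.basicOpen hb
  have hbi := (mem_invariants_iff hs b).1 hb
  have hle : (snd (algGroup A) X).left ⁻¹ᵁ W ≤ (snd (algGroup A) X).left ⁻¹ᵁ U :=
    Scheme.Hom.preimage_mono _ i
  have h1 : res X i h ∈ invariants (algGroup A) X W := by
    rw [hn]
    exact mul_mem (pow_mem (res_mem_invariants i hb) _) hg
  obtain ⟨m, hm⟩ := exists_pow_mul_eq (isAffineOpen_snd_preimage (A := A) X hU).isCompact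
    (f := pull (snd (algGroup A) X) U _ le_rfl b) (s := pull (act (algGroup A) X) U _ hs.act_le h)
    (t := pull (snd (algGroup A) X) U _ le_rfl h) hle
    (by rw [basicOpen_pull, hW]; exact inf_le_right) (by
      have := (mem_invariants_iff hW' _).1 h1
      rw [pull_res, pull_res] at this
      rwa [res_pull, res_pull])
  refine ⟨m + n, b ^ m * h, ?_, by rw [map_mul, map_pow, hn, pow_add, mul_assoc]⟩
  rw [mem_invariants_iff hs, map_mul, map_mul, map_pow, map_pow, hbi, hm]

end Stable


/-! ### Quotients by sheaves of invariant functions -/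

section Quotient

variable {X Y : Over SpecC} {U : X.left.Opens}

/-- The inverse image `q⁻¹(V) ⊆ U` of an open set, as an open subset of `X`. -/
def openPreimage (q : openSub X U ⟶ Y) (V : Y.left.Opens) : X.left.Opens :=
  U.ι ''ᵁ (show U.toScheme.Opens from q.left ⁻¹ᵁ V)

/-- Pull-back of functions along a morphism `q` defined on an open subset of `X`, with values in the
functions on an open subset of `X`. -/
def openPull (q : openSub X U ⟶ Y) (V : Y.left.Opens) :
    Γ(Y.left, V) →ₐ[ℂ] Γ(X.left, openPreimage q V) :=
  (openSubEquiv X U (q.left ⁻¹ᵁ V)).toAlgHom.comp (pull q V _ le_rfl)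

variable (q : openSub X U ⟶ Y)

lemma openPreimage_mono {V V' : Y.left.Opens} (i : V' ≤ V) :
    openPreimage q V' ≤ openPreimage q V :=
  Scheme.Hom.image_mono U.ι (Scheme.Hom.preimage_mono q.left i)

lemma openPreimage_iSup {κ : Sort*} (V : κ → Y.left.Opens) :
    openPreimage q (⨆ k, V k) = ⨆ k, openPreimage q (V k) := by
  unfold openPreimage
  rw [Scheme.Hom.preimage_iSup]
  exact Scheme.Hom.image_iSup U.ι _

lemma openPull_res {V V' : Y.left.Opens} (i : V' ≤ V) (s : Γ(Y.left, V)) :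
    openPull q V' (res Y i s) = res X (openPreimage_mono q i) (openPull q V s) := by
  have h : pull q V' _ le_rfl (res Y i s) =
      res (openSub X U) (Scheme.Hom.preimage_mono q.left i) (pull q V _ le_rfl s) := by
    rw [pull_res, res_pull]
  exact h

lemma basicOpen_openSub {V : U.toScheme.Opens} (s : Γ((openSub X U).left, V)) :
    U.ι ''ᵁ (show U.toScheme.Opens from (openSub X U).left.basicOpen s) =
      X.left.basicOpen (openSubEquiv X U V s) := by
  refine (Scheme.image_basicOpen U.ι (U := V) s).trans ?_
  rw [Scheme.Opens.ι_appIso]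
  rfl

lemma openPreimage_basicOpen {V : Y.left.Opens} (s : Γ(Y.left, V)) :
    openPreimage q (Y.left.basicOpen s) = X.left.basicOpen (openPull q V s) := by
  refine Eq.trans ?_ (basicOpen_openSub (pull q V (q.left ⁻¹ᵁ V) le_rfl s))
  have := basicOpen_pull q (V := V) le_rfl s
  rw [inf_eq_right.2 (Scheme.Hom.preimage_mono _ (Y.left.basicOpen_le s))] at this
  rw [this]
  rfl

/-- Over `V ⊆ Y` the morphism `q` is a quotient by `G`: the open set `q⁻¹(V)` is stable, and
pull-back of functions is an isomorphism of `Γ(Y, V)` with the invariant functions on `q⁻¹(V)`. -/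
structure IsQuotientOver (G : Over SpecC) [GrpObj G] {X Y : Over SpecC} [ModObj G X]
    {U : X.left.Opens} (q : openSub X U ⟶ Y) (V : Y.left.Opens) : Prop where
  isStable : IsStable G X (openPreimage q V)
  injective : Function.Injective (openPull q V)
  range_eq : (openPull q V).range = invariants G X (openPreimage q V)

variable {q} {G : Over SpecC} [GrpObj G] [ModObj G X]

lemma IsQuotientOver.of_forall {V : Y.left.Opens} (hs : IsStable G X (openPreimage q V))
    (h0 : ∀ s, openPull q V s = 0 → s = 0)
    (h1 : ∀ s, openPull q V s ∈ invariants G X (openPreimage q V))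
    (h2 : ∀ g ∈ invariants G X (openPreimage q V), ∃ s, openPull q V s = g) :
    IsQuotientOver G q V where
  isStable := hs
  injective := (injective_iff_map_eq_zero _).2 h0
  range_eq := le_antisymm (by rintro _ ⟨s, rfl⟩; exact h1 s) fun g hg => h2 g hg

/-- Localization: being the quotient passes to the non-vanishing locus of a function. -/
lemma IsQuotientOver.basicOpen {A : Type} [CommRing A] [HopfAlgebra ℂ A]
    [ModObj (algGroup A) X] {V : Y.left.Opens} (h : IsQuotientOver (algGroup A) q V)
    (hV : IsAffineOpen V) (hW : IsAffineOpen (openPreimage q V)) (a : Γ(Y.left, V)) :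
    IsQuotientOver (algGroup A) q (Y.left.basicOpen a) := by
  have hb : openPull q V a ∈ invariants (algGroup A) X (openPreimage q V) :=
    h.range_eq ▸ ⟨a, rfl⟩
  have hle := Y.left.basicOpen_le a
  refine ⟨?_, ?_, ?_⟩
  · rw [openPreimage_basicOpen]
    exact h.isStable.basicOpen hb
  · rw [injective_iff_map_eq_zero]
    intro s hs
    obtain ⟨n, t, ht⟩ := exists_res_eq_pow_mul hV.isCompact hV.isQuasiSeparated a rfl hle s
    have h1 : res X (openPreimage_mono q hle) (openPull q V t) =
        res X (openPreimage_mono q hle) 0 := by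
      rw [← openPull_res q hle, ht, map_mul, hs, mul_zero, map_zero]
    obtain ⟨m, hm⟩ := exists_pow_mul_eq hW.isCompact _ (openPreimage_basicOpen q a).ge h1
    have h2 : a ^ m * t = 0 := by
      apply h.injective
      rw [map_mul, map_pow, hm, mul_zero, map_zero]
    have h3 : IsUnit (res Y hle a) := by
      rw [isUnit_iff_le_basicOpen, basicOpen_res, inf_idem]
    have h4 := congrArg (res Y hle) h2
    rw [map_mul, ht, map_pow, map_zero, ← mul_assoc, ← pow_add] at h4
    exact ((h3.pow _).mul_right_eq_zero).1 h4
  · apply le_antisymm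
    · rintro _ ⟨s, rfl⟩
      obtain ⟨n, t, ht⟩ := exists_res_eq_pow_mul hV.isCompact hV.isQuasiSeparated a rfl hle s
      have h3 : IsUnit (res Y hle a) := by
        rw [isUnit_iff_le_basicOpen, basicOpen_res, inf_idem]
      have hs' : IsStable (algGroup A) X (openPreimage q (Y.left.basicOpen a)) := by
        rw [openPreimage_basicOpen]
        exact h.isStable.basicOpen hb
      have h4 : openPull q _ (res Y hle a) ^ n * openPull q _ s ∈
          invariants (algGroup A) X (openPreimage q (Y.left.basicOpen a)) := by
        rw [← map_pow, ← map_mul, ← ht, openPull_res]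
        exact res_mem_invariants _ (h.range_eq ▸ ⟨t, rfl⟩)
      have h5 : openPull q _ (res Y hle a) ∈
          invariants (algGroup A) X (openPreimage q (Y.left.basicOpen a)) := by
        rw [openPull_res]
        exact res_mem_invariants _ hb
      have h6 := (mem_invariants_iff hs' _).1 h4
      have h7 := (mem_invariants_iff hs' _).1 (pow_mem h5 n)
      rw [map_mul, map_mul, h7] at h6
      rw [AlgHom.toRingHom_eq_coe, RingHom.coe_coe, mem_invariants_iff hs']
      exact (((h3.pow n).map (openPull q _)).map (pull (snd (algGroup A) X) _ _ le_rfl)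
        |>.mul_left_cancel (by simpa only [map_pow] using h6))
    · intro g hg
      obtain ⟨n, f, hf, hn⟩ := exists_mem_invariants_res_eq hW h.isStable hb
        (openPreimage_basicOpen q a) (openPreimage_mono q hle) hg
      rw [← h.range_eq] at hf
      obtain ⟨t, rfl⟩ := hf
      have h3 : IsUnit (res Y hle a) := by
        rw [isUnit_iff_le_basicOpen, basicOpen_res, inf_idem]
      obtain ⟨c, hc⟩ := (h3.pow n).exists_left_inv
      refine ⟨c * res Y hle t, ?_⟩
      change openPull q _ (c * res Y hle t) = g
      rw [map_mul, openPull_res]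
      refine (congrArg _ hn).trans ?_
      rw [← openPull_res q hle, ← map_pow, ← mul_assoc, ← map_mul, hc, map_one, one_mul]

/-- Being the quotient is a local property on the quotient. -/
lemma isQuotientOver_of_basis
    (h : ∀ (V : Y.left.Opens), ∀ x ∈ V, ∃ V' ≤ V, x ∈ V' ∧ IsQuotientOver G q V')
    (V : Y.left.Opens) : IsQuotientOver G q V := by
  choose B hB hx hq using fun (V : Y.left.Opens) (x : V) => h V x.1 x.2
  have hcov : ∀ V, V ≤ ⨆ x, B V x := fun V x hxV =>
    TopologicalSpace.Opens.mem_iSup.2 ⟨⟨x, hxV⟩, hx V ⟨x, hxV⟩⟩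
  have hV : ∀ V, ⨆ x, B V x = V := fun V => le_antisymm (iSup_le (hB V)) (hcov V)
  have hpre : ∀ V, openPreimage q V = ⨆ x, openPreimage q (B V x) := fun V => by
    rw [← openPreimage_iSup, hV]
  have hst : ∀ V, IsStable G X (openPreimage q V) := fun V => by
    rw [hpre]
    exact IsStable.iSup fun x => (hq V x).isStable
  have hinj : ∀ V, Function.Injective (openPull q V) := fun V s t hst =>
    eq_of_res_eq (B V) (hB V) (hcov V) fun x => (hq V x).injective (by
      rw [openPull_res, openPull_res, hst])
  refine ⟨hst V, hinj V, le_antisymm ?_ fun g hg => ?_⟩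
  · rintro _ ⟨s, rfl⟩
    rw [AlgHom.toRingHom_eq_coe, RingHom.coe_coe, mem_invariants_iff (hst V)]
    refine eq_of_res_eq (X := G ⊗ X) (fun x => (snd G X).left ⁻¹ᵁ openPreimage q (B V x))
      (fun x => Scheme.Hom.preimage_mono _ (openPreimage_mono q (hB V x))) ?_ fun x => ?_
    · rw [← Scheme.Hom.preimage_iSup, ← hpre]
    · have h1 : openPull q (B V x) (res Y (hB V x) s) ∈ invariants G X _ :=
        (hq V x).range_eq ▸ ⟨_, rfl⟩
      rw [mem_invariants_iff (hq V x).isStable, openPull_res, pull_res, pull_res] at h1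
      rwa [res_pull, res_pull]
  · have h1 : ∀ x, ∃ s, openPull q (B V x) s = res X (openPreimage_mono q (hB V x)) g := fun x => by
      have : res X (openPreimage_mono q (hB V x)) g ∈ (openPull q (B V x)).range := by
        rw [(hq V x).range_eq]
        exact res_mem_invariants _ hg
      exact this
    choose s hs using h1
    obtain ⟨t, ht, -⟩ := Y.left.sheaf.existsUnique_gluing' (B V) V (fun x => homOfLE (hB V x))
      (hcov V) s (fun x y => by
        have : res Y (V := B V x ⊓ B V y) inf_le_left (s x) = res Y inf_le_right (s y) := by
          apply hinj
          rw [openPull_res, openPull_res, hs, hs, res_res, res_res]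
        exact this)
    refine ⟨t, eq_of_res_eq (fun x => openPreimage q (B V x))
      (fun x => openPreimage_mono q (hB V x)) (hpre V).le fun x => ?_⟩
    have : res Y (hB V x) t = s x := ht x
    exact (openPull_res q (hB V x) t).symm.trans ((congrArg _ this).trans (hs x))

/-- It suffices to check that `q` is a quotient on an affine cover. -/
theorem isQuotientOver_of_cover {A : Type} [CommRing A] [HopfAlgebra ℂ A]
    [ModObj (algGroup A) X] {κ : Type*} (D : κ → Y.left.Opens) (hcov : ⨆ k, D k = ⊤)
    (hD : ∀ k, IsAffineOpen (D k)) (hW : ∀ k, IsAffineOpen (openPreimage q (D k)))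
    (h : ∀ k, IsQuotientOver (algGroup A) q (D k)) (V : Y.left.Opens) :
    IsQuotientOver (algGroup A) q V := by
  refine isQuotientOver_of_basis (fun V x hx => ?_) V
  obtain ⟨k, hk⟩ := TopologicalSpace.Opens.mem_iSup.1 (hcov.ge (show x ∈ ⊤ from trivial))
  obtain ⟨a, ha, hxa⟩ := (hD k).exists_basicOpen_le ⟨x, hx⟩ hk
  exact ⟨_, ha, hxa, (h k).basicOpen (hD k) (hW k) a⟩

end Quotient


/-! ### Properties inherited by quotients -/

section Inherit

variable {G : Over SpecC} [GrpObj G] {X Y : Over SpecC} [ModObj G X] {U : X.left.Opens}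
  {q : openSub X U ⟶ Y}

/-- The bracket of a Poisson action descends to the quotient, as invariant functions are closed
under brackets. -/
theorem exists_isPoisson_of_isQuotientOver {PG : PoissonStructure G} {PX : PoissonStructure X}
    (hact : IsPoissonAction PG PX) (h : ∀ V, IsQuotientOver G q V) :
    ∃ PY : PoissonStructure Y, IsPoisson (PX.openRestrict U) PY q := by
  have h1 : ∀ V f g, ∃ b, openPull q V b = PX.bracket _ (openPull q V f) (openPull q V g) :=
    fun V f g => by
      have hr : ∀ f, openPull q V f ∈ invariants G X (openPreimage q V) :=
        fun f => (h V).range_eq ▸ ⟨f, rfl⟩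
      have := bracket_mem_invariants hact (hr f) (hr g)
      rw [← (h V).range_eq] at this
      exact this
  choose b hb using h1
  refine ⟨{ bracket := fun V => LinearMap.mk₂ ℂ (b V) ?_ ?_ ?_ ?_
            alternating := ?_, jacobi := ?_, leibniz := ?_, restrict := ?_ }, ?_⟩
  · intro f f' g
    apply (h V).injective
    rw [map_add, hb, hb, hb, map_add, map_add, LinearMap.add_apply]
  · intro c f g
    apply (h V).injective
    rw [map_smul, hb, hb, map_smul, map_smul, LinearMap.smul_apply]
  · intro f g g'
    apply (h V).injective
    rw [map_add, hb, hb, hb, map_add, map_add]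
  · intro c f g
    apply (h V).injective
    rw [map_smul, hb, hb, map_smul, map_smul]
  · intro V f
    apply (h V).injective
    rw [LinearMap.mk₂_apply, hb, PX.alternating, map_zero]
  · intro V f g k
    apply (h V).injective
    simp only [LinearMap.mk₂_apply, map_add, hb, PX.jacobi, map_zero]
  · intro V f g k
    apply (h V).injective
    simp only [LinearMap.mk₂_apply, map_add, map_mul, hb, PX.leibniz]
  · intro V V' i f g
    apply (h V').injective
    simp only [LinearMap.mk₂_apply]
    rw [openPull_res, hb, hb, PX.restrict, openPull_res, openPull_res]
  · intro V f g
    exact hb V f g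

lemma isReduced_of_isQuotientOver [IsReduced X.left] (h : ∀ V, IsQuotientOver G q V) :
    IsReduced Y.left where
  component_reduced V :=
    isReduced_of_injective (openPull q V) (h V).injective

lemma isIntegral_of_isQuotientOver [IsIntegral X.left] (hY : Nonempty Y.left)
    (h : ∀ V, IsQuotientOver G q V) : IsIntegral Y.left where
  nonempty := hY
  component_integral V hV := by
    have hne : Nonempty (openPreimage q V) := by
      by_contra hempty
      replace hempty : openPreimage q V = ⊥ :=
        eq_bot_iff.2 fun x hx => (hempty ⟨⟨x, hx⟩⟩).elim
      have h0 : Subsingleton Γ(X.left, openPreimage q V) := by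
        rw [hempty]
        infer_instance
      have h1 : (1 : Γ(Y.left, V)) = 0 := (h V).injective (Subsingleton.elim _ _)
      have h2 : Y.left.basicOpen (1 : Γ(Y.left, V)) = V := Scheme.basicOpen_of_isUnit _ isUnit_one
      rw [h1, Scheme.basicOpen_zero] at h2
      obtain ⟨x, hx⟩ := hV
      rw [← h2] at hx
      exact hx
    exact (h V).injective.isDomain (openPull q V).toRingHom

lemma algebraMap_finiteType {U : X.left.Opens} (hU : IsAffineOpen U) (hX : LocallyOfFiniteType X.hom) :
    Algebra.FiniteType ℂ Γ(X.left, U) := by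
  have h1 : (X.hom.appLE ⊤ U le_top).hom.FiniteType :=
    hX.finiteType_appLE (isAffineOpen_top SpecC) hU le_top
  have h2 : (constants X U).hom.FiniteType :=
    h1.comp (RingHom.FiniteType.of_surjective _
      (ConcreteCategory.bijective_of_isIso (Scheme.ΓSpecIso (CommRingCat.of ℂ)).inv).2)
  exact h2

lemma locallyOfFiniteType_of_cover {κ : Type*} (D : κ → Y.left.Opens) (hcov : ⨆ k, D k = ⊤)
    (hD : ∀ k, IsAffineOpen (D k)) (h : ∀ k, Algebra.FiniteType ℂ Γ(Y.left, D k)) :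
    LocallyOfFiniteType Y.hom := by
  refine HasRingHomProperty.of_iSup_eq_top (P := @LocallyOfFiniteType)
    (fun k => (⟨D k, hD k⟩ : Y.left.affineOpens)) hcov fun k => ?_
  have h1 : (constants Y (D k)).hom.FiniteType := h k
  exact RingHom.FiniteType.of_comp_finiteType (f := (Scheme.ΓSpecIso (CommRingCat.of ℂ)).inv.hom) h1

/-- Quotients by reductive groups are of finite type, by Hilbert's theorem. -/
theorem locallyOfFiniteType_of_isQuotientOver {A : Type} [CommRing A] [HopfAlgebra ℂ A]
    (hA : IsReductive A) [ModObj (algGroup A) X] (hX : LocallyOfFiniteType X.hom) {κ : Type*}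
    (D : κ → Y.left.Opens) (hcov : ⨆ k, D k = ⊤) (hD : ∀ k, IsAffineOpen (D k))
    (hW : ∀ k, IsAffineOpen (openPreimage q (D k)))
    (h : ∀ V, IsQuotientOver (algGroup A) q V) : LocallyOfFiniteType Y.hom := by
  refine locallyOfFiniteType_of_cover D hcov hD fun k => ?_
  have := algebraMap_finiteType (hW k) hX
  have h1 := hA.invariants_fg (hW k) (h (D k)).isStable
  rw [← (h (D k)).range_eq, Subalgebra.fg_iff_finiteType] at h1
  exact h1.equiv (AlgEquiv.ofInjective (openPull q (D k)) (h (D k)).injective).symm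

end Inherit


/-! ### Affine quotients -/

section OpenIncl

variable {X Y : Over SpecC}

lemma image_le_of_le_preimage {U W : X.left.Opens} {V : U.toScheme.Opens}
    (h : V ≤ (openIncl X U).left ⁻¹ᵁ W) : U.ι ''ᵁ V ≤ W := by
  rintro _ ⟨x, hx, rfl⟩
  exact h hx

lemma openSubEquiv_pull_openIncl {U W : X.left.Opens} {V : U.toScheme.Opens}
    (h : V ≤ (openIncl X U).left ⁻¹ᵁ W) (s : Γ(X.left, W)) :
    openSubEquiv X U V (pull (openIncl X U) W V h s) = res X (image_le_of_le_preimage h) s :=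
  congrArg (fun φ : Γ(X.left, W) ⟶ Γ(X.left, U.ι ''ᵁ V) => φ.hom s) (Scheme.Opens.ι_appLE U W V h)

lemma openPreimage_le (f : X ⟶ Y) (U : X.left.Opens) (V : Y.left.Opens) :
    openPreimage (openIncl X U ≫ f) V ≤ f.left ⁻¹ᵁ V := by
  rintro _ ⟨x, hx, rfl⟩
  exact hx

lemma openPull_openIncl_comp (f : X ⟶ Y) (U : X.left.Opens) (V : Y.left.Opens)
    (s : Γ(Y.left, V)) :
    openPull (openIncl X U ≫ f) V s = pull f V _ (openPreimage_le f U V) s := by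
  have h1 := pull_pull (openIncl X U) f (W := V) (V := f.left ⁻¹ᵁ V)
    (U := (openIncl X U ≫ f).left ⁻¹ᵁ V) le_rfl le_rfl s
  refine (congrArg (openSubEquiv X U _) h1.symm).trans ?_
  refine (openSubEquiv_pull_openIncl _ _).trans ?_
  rw [res_pull]
  rfl

/-- A morphism on `X` is Poisson if its restriction to the open subset `X` of `X` is. -/
lemma isPoisson_of_openRestrict_top {PX : PoissonStructure X} {PY : PoissonStructure Y} (f : X ⟶ Y)
    (h : IsPoisson (PX.openRestrict ⊤) PY (openIncl X ⊤ ≫ f)) : IsPoisson PX PY f := by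
  intro V s t
  have hle : f.left ⁻¹ᵁ V ≤ openPreimage (openIncl X ⊤ ≫ f) V :=
    fun x hx => ⟨⟨x, trivial⟩, hx, rfl⟩
  have h1 : openPull (openIncl X ⊤ ≫ f) V (PY.bracket V s t) =
      PX.bracket _ (openPull (openIncl X ⊤ ≫ f) V s) (openPull (openIncl X ⊤ ≫ f) V t) := h V s t
  rw [openPull_openIncl_comp, openPull_openIncl_comp, openPull_openIncl_comp] at h1
  have h2 := congrArg (res X hle) h1
  rwa [PX.restrict, res_pull, res_pull, res_pull] at h2

end OpenIncl

section Affine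

variable {G : Over SpecC} [GrpObj G] {X : Over SpecC} [ModObj G X]

lemma specPull_toSpecΓ (T : Scheme) : specPull T.toSpecΓ ⊤ = 𝟙 Γ(T, ⊤) := by
  refine (congrArg (_ ≫ ·) (Scheme.Hom.appLE_eq_app _)).trans ?_
  exact (congrArg (_ ≫ ·) (Scheme.toSpecΓ_appTop _)).trans (Iso.inv_hom_id _)

lemma pull_affineQuotientMap (r : invariants G X ⊤) :
    pull (affineQuotientMap G X) ⊤ ⊤ (fun _ _ => trivial)
      ((Scheme.ΓSpecIso (CommRingCat.of (invariants G X ⊤))).inv.hom r) = r.1 := by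
  have h := specPull_comp_specMap X.left.toSpecΓ
    (CommRingCat.ofHom (invariants G X ⊤).val.toRingHom) ⊤
  refine (congrArg (fun φ => φ.hom r) h).trans ?_
  rw [specPull_toSpecΓ]
  rfl

lemma isQuotientOver_affineQuotientMap :
    IsQuotientOver G (openIncl X ⊤ ≫ affineQuotientMap G X) ⊤ := by
  have hpre : openPreimage (openIncl X ⊤ ≫ affineQuotientMap G X) ⊤ = ⊤ :=
    eq_top_iff.2 fun x _ => ⟨⟨x, trivial⟩, trivial, rfl⟩
  have hinv : ∀ s : Γ((affineQuotient G X).left, ⊤), ∃ r : invariants G X ⊤,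
      (Scheme.ΓSpecIso (CommRingCat.of (invariants G X ⊤))).inv.hom r = s :=
    (ConcreteCategory.bijective_of_isIso
      (Scheme.ΓSpecIso (CommRingCat.of (invariants G X ⊤))).inv).2
  have hpull : ∀ r : invariants G X ⊤, openPull (openIncl X ⊤ ≫ affineQuotientMap G X) ⊤
      ((Scheme.ΓSpecIso (CommRingCat.of (invariants G X ⊤))).inv.hom r) =
        res X le_top r.1 := fun r => by
    have h := congrArg (res X (V := openPreimage (openIncl X ⊤ ≫ affineQuotientMap G X) ⊤) le_top)
      (pull_affineQuotientMap r)
    exact (openPull_openIncl_comp _ _ _ _).trans ((res_pull _ _ _ _).symm.trans h)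
  refine IsQuotientOver.of_forall (hpre.symm ▸ isStable_top) (fun s hs => ?_) (fun s => ?_)
    fun g hg => ?_
  · obtain ⟨r, rfl⟩ := hinv s
    rw [hpull] at hs
    have h := congrArg (res X hpre.ge) hs
    rw [res_res, res_self, map_zero] at h
    rw [show r = 0 from Subtype.ext h, map_zero]
  · obtain ⟨r, rfl⟩ := hinv s
    rw [hpull]
    exact res_mem_invariants _ r.2
  · refine ⟨(Scheme.ΓSpecIso (CommRingCat.of (invariants G X ⊤))).inv.hom
      ⟨res X hpre.ge g, res_mem_invariants _ hg⟩, ?_⟩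
    rw [hpull, res_res, res_self]

/-- The quotient of an affine Poisson variety. -/
theorem affine_quotient {A : Type} [CommRing A] [HopfAlgebra ℂ A] (hA : IsReductive A)
    {PG : PoissonStructure (algGroup A)} {X : Over SpecC} [ModObj (algGroup A) X]
    (hX : IsVariety X) {PX : PoissonStructure X} (hact : IsPoissonAction PG PX)
    (haff : IsAffine X.left) :
    IsVariety (affineQuotient (algGroup A) X) ∧
      (IsIntegral X.left → IsIntegral (affineQuotient (algGroup A) X).left) ∧
      ∃ PY : PoissonStructure (affineQuotient (algGroup A) X),
        IsPoisson PX PY (affineQuotientMap (algGroup A) X) := by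
  have := hX.isReduced
  have hYaff : IsAffine (affineQuotient (algGroup A) X).left := inferInstanceAs (IsAffine (Spec _))
  have hpre : openPreimage (openIncl X ⊤ ≫ affineQuotientMap (algGroup A) X) ⊤ = ⊤ :=
    eq_top_iff.2 fun x _ => ⟨⟨x, trivial⟩, trivial, rfl⟩
  have hW : IsAffineOpen (openPreimage (openIncl X ⊤ ≫ affineQuotientMap (algGroup A) X) ⊤) :=
    hpre.symm.rec (motive := fun W _ => IsAffineOpen W) (isAffineOpen_top X.left)
  have hq := isQuotientOver_of_cover (κ := Unit) (fun _ => ⊤) (iSup_const)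
    (fun _ => isAffineOpen_top _) (fun _ => hW)
    (fun _ => isQuotientOver_affineQuotientMap (G := algGroup A) (X := X))
  refine ⟨⟨isReduced_of_isQuotientOver hq, ?_, locallyOfFiniteType_of_isQuotientOver hA
    hX.locallyOfFiniteType (κ := Unit) (fun _ => ⊤) (iSup_const)
    (fun _ => isAffineOpen_top _) (fun _ => hW) hq, ?_⟩, fun hint => ?_, ?_⟩
  · change IsSeparated (Spec.map _)
    infer_instance
  · change QuasiCompact (Spec.map _)
    infer_instance
  · obtain ⟨x⟩ := hint.nonempty
    exact isIntegral_of_isQuotientOver ⟨(affineQuotientMap (algGroup A) X).left x⟩ hq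
  · obtain ⟨PY, hPY⟩ := exists_isPoisson_of_isQuotientOver hact hq
    exact ⟨PY, isPoisson_of_openRestrict_top _ hPY⟩

end Affine


/-! ### Morphisms to affine open subsets -/

section ToAffine

variable {T Y : Over SpecC} {D : Y.left.Opens}

lemma toSpecΓ_comp_specMap_constants (T : Over SpecC) :
    T.left.toSpecΓ ≫ Spec.map (constants T ⊤) = T.hom := by
  have h2 : constants T ⊤ = (Scheme.ΓSpecIso (CommRingCat.of ℂ)).inv ≫
      Scheme.Hom.appTop (X := T.left) (Y := SpecC) T.hom := by
    unfold constants
    congr 1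
    exact Scheme.Hom.appLE_eq_app (X := T.left) (Y := SpecC) T.hom
  rw [h2, Spec.map_comp]
  have h3 := Scheme.toSpecΓ_naturality (X := T.left) (Y := SpecC) T.hom
  rw [← Category.assoc, ← h3, Category.assoc]
  have h4 : SpecC.toSpecΓ ≫ Spec.map (Scheme.ΓSpecIso (CommRingCat.of ℂ)).inv = 𝟙 _ := by
    simp
  exact (congrArg (T.hom ≫ ·) h4).trans (Category.comp_id _)

lemma fromSpec_comp_hom (hD : IsAffineOpen D) :
    hD.fromSpec ≫ Y.hom = Spec.map (constants Y D) := by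
  have h := IsAffineOpen.SpecMap_appLE_fromSpec (Y := SpecC) Y.hom (isAffineOpen_top SpecC) hD
    (fun _ _ => trivial)
  refine h.symm.trans ?_
  rw [IsAffineOpen.fromSpec_top]
  unfold constants
  rw [Spec.map_comp]
  congr 1
  exact Scheme.isoSpec_Spec_inv _

lemma top_le_fromSpec_preimage (hD : IsAffineOpen D) : ⊤ ≤ hD.fromSpec ⁻¹ᵁ D :=
  (hD.fromSpec_preimage_self).ge

lemma fromSpec_appLE (hD : IsAffineOpen D) :
    hD.fromSpec.appLE D ⊤ (top_le_fromSpec_preimage hD) =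
      (Scheme.ΓSpecIso Γ(Y.left, D)).inv := by
  have h := hD.fromSpec_app_self
  unfold Scheme.Hom.appLE
  rw [h, Category.assoc, ← Functor.map_comp]
  exact (congrArg (_ ≫ ·) (CategoryTheory.Functor.map_id _ _)).trans (Category.comp_id _)

/-- A homomorphism from the functions on an affine open set gives a morphism. -/
lemma exists_pull_eq (hD : IsAffineOpen D) (ψ : Γ(Y.left, D) →ₐ[ℂ] Γ(T.left, ⊤)) :
    ∃ (m : T ⟶ Y) (h : ⊤ ≤ m.left ⁻¹ᵁ D), pull m D ⊤ h = ψ := by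
  have hψ : constants Y D ≫ CommRingCat.ofHom ψ.toRingHom = constants T ⊤ := by
    ext c
    exact ψ.commutes c
  have h1 : (T.left.toSpecΓ ≫ Spec.map (CommRingCat.ofHom ψ.toRingHom) ≫ hD.fromSpec) ≫ Y.hom =
      T.hom := by
    rw [Category.assoc, Category.assoc, fromSpec_comp_hom, ← Spec.map_comp, hψ,
      toSpecΓ_comp_specMap_constants]
  refine ⟨Over.homMk _ h1, ?_, ?_⟩
  · intro x _
    exact top_le_fromSpec_preimage hD trivial
  · refine AlgHom.ext fun s => ?_
    have h2 := Scheme.Hom.appLE_comp_appLE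
      (T.left.toSpecΓ ≫ Spec.map (CommRingCat.ofHom ψ.toRingHom)) hD.fromSpec D ⊤ ⊤
      (top_le_fromSpec_preimage hD) (fun _ _ => trivial)
    rw [fromSpec_appLE] at h2
    have h3 := (specPull_comp_specMap T.left.toSpecΓ (CommRingCat.ofHom ψ.toRingHom) ⊤).trans
      ((congrArg (_ ≫ ·) (specPull_toSpecΓ _)).trans (Category.comp_id _))
    have h4 := h2.symm.trans h3
    exact congrArg (fun φ => φ.hom s) h4

lemma comp_ι_appLE {S Z : Scheme} {W : Z.Opens} (n : S ⟶ W.toScheme) (h : ⊤ ≤ (n ≫ W.ι) ⁻¹ᵁ W) :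
    (n ≫ W.ι).appLE W ⊤ h = W.topIso.inv ≫ n.appTop := by
  have h1 := Scheme.Hom.appLE_comp_appLE n W.ι W ⊤ ⊤ (by simp) (fun _ _ => trivial)
  exact h1.symm.trans (congrArg₂ (· ≫ ·) (Scheme.Opens.ι_appLE W W ⊤ (by simp))
    (Scheme.Hom.appLE_eq_app n))

/-- Morphisms to an affine open subset are determined by the pull-back of functions. -/
lemma eq_of_pull_eq (hD : IsAffineOpen D) {a b : T ⟶ Y} (ha : ⊤ ≤ a.left ⁻¹ᵁ D)
    (hb : ⊤ ≤ b.left ⁻¹ᵁ D) (h : ∀ s, pull a D ⊤ ha s = pull b D ⊤ hb s) : a = b := by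
  have hr : ∀ m : T ⟶ Y, ⊤ ≤ m.left ⁻¹ᵁ D → Set.range m.left ⊆ Set.range D.ι := by
    rintro m hm _ ⟨x, rfl⟩
    rw [Scheme.Opens.range_ι]
    exact hm (show x ∈ ⊤ from trivial)
  have hf : ∀ (m : T ⟶ Y) (hm : ⊤ ≤ m.left ⁻¹ᵁ D), m.left.appLE D ⊤ hm =
      D.topIso.inv ≫ (IsOpenImmersion.lift D.ι m.left (hr m hm)).appTop := fun m hm => by
    have h2 := comp_ι_appLE (IsOpenImmersion.lift D.ι m.left (hr m hm)) (by
      rw [IsOpenImmersion.lift_fac]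
      exact hm)
    simp only [IsOpenImmersion.lift_fac] at h2
    exact h2
  have : IsAffine D.toScheme := hD
  have h1 : IsOpenImmersion.lift D.ι a.left (hr a ha) = IsOpenImmersion.lift D.ι b.left (hr b hb) := by
    refine ext_of_isAffine ?_
    rw [← cancel_epi D.topIso.inv, ← hf, ← hf]
    ext s
    exact h s
  refine Over.OverMorphism.ext ?_
  rw [← IsOpenImmersion.lift_fac D.ι a.left (hr a ha), h1, IsOpenImmersion.lift_fac]

end ToAffine


/-! ### Functions on `D₊(f)` -/

section Proj

variable {R : Type} [CommRing R] [Algebra ℂ R] (𝒜 : ℕ → Submodule ℂ R) [GradedAlgebra 𝒜]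

lemma exists_eq_projFraction {d : ℕ} {f : R} (hf : f ∈ 𝒜 d) (hd : 0 < d)
    (s : Γ((projOver 𝒜).left, Proj.basicOpen 𝒜 f)) :
    ∃ r h hh, s = projFraction 𝒜 f hf r h hh := by
  obtain ⟨a, rfl⟩ := (ConcreteCategory.bijective_of_isIso
    (Proj.basicOpenIsoAway 𝒜 f hf hd).hom).2 s
  obtain ⟨r, h, hh, rfl⟩ := HomogeneousLocalization.Away.mk_surjective 𝒜 hf a
  exact ⟨r, h, hh, rfl⟩

lemma projFraction_eq_zero {d : ℕ} {f : R} (hf : f ∈ 𝒜 d) {r : ℕ} {h : R} (hh : h ∈ 𝒜 (r • d))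
    {m : ℕ} (h0 : f ^ m * h = 0) : projFraction 𝒜 f hf r h hh = 0 := by
  have : HomogeneousLocalization.Away.mk 𝒜 hf r h hh = 0 := by
    apply HomogeneousLocalization.val_injective
    rw [HomogeneousLocalization.Away.val_mk, HomogeneousLocalization.val_zero, Localization.mk_eq_mk',
      IsLocalization.mk'_eq_zero_iff]
    exact ⟨⟨f ^ m, m, rfl⟩, h0⟩
  unfold projFraction
  rw [this, map_zero]

/-- Fractions are multiplied as expected: `(h / gʳ) (p / fˢ) = q / fᵗ` on `D₊(f) ∩ D₊(g)` if
`h p fᵗ = q gʳ fˢ`. -/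
lemma res_projFraction_mul {d e : ℕ} {f g : R} (hf : f ∈ 𝒜 d) (hg : g ∈ 𝒜 e) {r s t : ℕ}
    {h p q : R} (hh : h ∈ 𝒜 (r • e)) (hp : p ∈ 𝒜 (s • d)) (hq : q ∈ 𝒜 (t • d))
    (H : h * p * f ^ t = q * (g ^ r * f ^ s)) :
    res (projOver 𝒜) (V := Proj.basicOpen 𝒜 f ⊓ Proj.basicOpen 𝒜 g) inf_le_right
        (projFraction 𝒜 g hg r h hh) *
      res (projOver 𝒜) inf_le_left (projFraction 𝒜 f hf s p hp) =
      res (projOver 𝒜) inf_le_left (projFraction 𝒜 f hf t q hq) := by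
  apply Subtype.ext
  funext x
  have hprime := x.1.isPrime
  apply HomogeneousLocalization.val_injective
  have key : ∀ {k d : ℕ} {f : R} (hf : f ∈ 𝒜 d) (h : R) (hh : h ∈ 𝒜 (k • d))
      (hx : f ∉ x.1.asHomogeneousIdeal),
      (((ProjectiveSpectrum.Proj.awayToSection 𝒜 f).1
        (HomogeneousLocalization.Away.mk 𝒜 hf k h hh)).val ⟨x.1, hx⟩).val =
      Localization.mk h (⟨f ^ k, fun h => hx (hprime.mem_of_pow_mem k h)⟩ :
        x.1.asHomogeneousIdeal.toIdeal.primeCompl) := by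
    intro k d f hf h hh hx
    rw [ProjectiveSpectrum.Proj.awayToSection_apply, HomogeneousLocalization.Away.val_mk,
      Localization.mk_eq_mk', Localization.mk_eq_mk', IsLocalization.map_mk']
    rfl
  refine (HomogeneousLocalization.val_mul _ _).trans ?_
  refine (congrArg₂ (· * ·) (key hg h hh x.2.2) (key hf p hp x.2.1)).trans ?_
  refine Eq.trans ?_ (key hf q hq x.2.1).symm
  rw [Localization.mk_mul, Localization.mk_eq_mk_iff, Localization.r_iff_exists]
  refine ⟨1, ?_⟩
  simp only [Submonoid.coe_mul, OneMemClass.coe_one, one_mul]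
  linear_combination H

/-- The fraction `h / fʳ` vanishes where `h` does. -/
lemma basicOpen_projFraction {d : ℕ} {f : R} (hf : f ∈ 𝒜 d) {r : ℕ} {h : R}
    (hh : h ∈ 𝒜 (r • d)) :
    (projOver 𝒜).left.basicOpen (projFraction 𝒜 f hf r h hh) =
      Proj.basicOpen 𝒜 f ⊓ Proj.basicOpen 𝒜 h := by
  ext x
  by_cases hx : x ∈ Proj.basicOpen 𝒜 f
  swap
  · exact ⟨fun h => (hx (Scheme.basicOpen_le _ _ h)).elim, fun h => (hx h.1).elim⟩
  have hprime : x.asHomogeneousIdeal.toIdeal.IsPrime := x.isPrime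
  have h1 : (Proj 𝒜).presheaf.germ (Proj.basicOpen 𝒜 f) x hx (projFraction 𝒜 f hf r h hh) =
      (Proj.stalkIso' 𝒜 x).symm (HomogeneousLocalization.mapId 𝒜 (Submonoid.powers_le.mpr hx)
        (HomogeneousLocalization.Away.mk 𝒜 hf r h hh)) :=
    congrArg (fun φ => φ.hom (HomogeneousLocalization.Away.mk 𝒜 hf r h hh))
      (ProjectiveSpectrum.Proj.awayToSection_germ 𝒜 f x hx)
  refine (Scheme.mem_basicOpen (Proj 𝒜) (projFraction 𝒜 f hf r h hh) x hx).trans ?_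
  have hxr : f ^ r ∈ x.asHomogeneousIdeal.toIdeal.primeCompl :=
    fun h => hx (hprime.mem_of_pow_mem r h)
  have h2 : (HomogeneousLocalization.mapId 𝒜 (Submonoid.powers_le.mpr hx)
        (HomogeneousLocalization.Away.mk 𝒜 hf r h hh)).val =
      IsLocalization.mk' (Localization.AtPrime x.asHomogeneousIdeal.toIdeal) h ⟨f ^ r, hxr⟩ := by
    exact (HomogeneousLocalization.val_mk _).trans (congrFun (congrFun Localization.mk_eq_mk' _) _)
  refine (congrArg IsUnit h1).to_iff.trans ?_
  refine (MulEquiv.isUnit_map (Proj.stalkIso' 𝒜 x).symm).trans ?_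
  refine (HomogeneousLocalization.isUnit_iff_isUnit_val 𝒜 _ _).symm.trans ?_
  rw [h2]
  refine (IsLocalization.AtPrime.isUnit_mk'_iff _ _ _ _).trans ?_
  exact ⟨fun h => ⟨hx, h⟩, fun h => h.2⟩

lemma specPull_toSpecZero {d : ℕ} {f : R} (hf : f ∈ 𝒜 d) (hd : 0 < d) :
    specPull (Proj.toSpecZero 𝒜) (Proj.basicOpen 𝒜 f) =
      CommRingCat.ofHom (HomogeneousLocalization.fromZeroRingHom 𝒜 (Submonoid.powers f)) ≫
        Proj.awayToSection 𝒜 f := by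
  have h1 : (Proj.basicOpen 𝒜 f).ι ≫ Proj.toSpecZero 𝒜 = ((Proj.basicOpen 𝒜 f).toScheme.toSpecΓ ≫
      Spec.map (Proj.basicOpen 𝒜 f).topIso.inv) ≫ Spec.map (Proj.awayToSection 𝒜 f) ≫
        Spec.map (CommRingCat.ofHom
          (HomogeneousLocalization.fromZeroRingHom 𝒜 (Submonoid.powers f))) := by
    have h := Proj.awayι_toSpecZero 𝒜 f hf hd
    rw [← Proj.basicOpenIsoSpec_inv_ι, Category.assoc, Iso.inv_comp_eq,
      Proj.basicOpenIsoSpec_hom] at h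
    exact h.trans (Category.assoc _ _ _)
  have h2 := congrArg (fun w => specPull w ⊤) h1
  simp only [← Spec.map_comp, specPull_comp_specMap, specPull_toSpecΓ] at h2
  have h3 : specPull ((Proj.basicOpen 𝒜 f).ι ≫ Proj.toSpecZero 𝒜) ⊤ =
      specPull (Proj.toSpecZero 𝒜) (Proj.basicOpen 𝒜 f) ≫ (Proj.basicOpen 𝒜 f).topIso.inv := by
    have h := Scheme.Hom.appLE_comp_appLE (Proj.basicOpen 𝒜 f).ι (Proj.toSpecZero 𝒜) ⊤
      (Proj.basicOpen 𝒜 f) ⊤ (fun _ _ => trivial) (by simp)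
    unfold specPull
    rw [← h, Category.assoc]
    congr 2
  rw [h3, Category.comp_id, cancel_mono] at h2
  exact h2

lemma projFraction_algebraMap {d : ℕ} {f : R} (hf : f ∈ 𝒜 d) (hd : 0 < d) (c : ℂ) :
    algebraMap ℂ Γ((projOver 𝒜).left, Proj.basicOpen 𝒜 f) c =
      projFraction 𝒜 f hf 0 (algebraMap ℂ R c)
        (by rw [zero_smul]; exact SetLike.algebraMap_mem_graded 𝒜 c) := by
  have h1 := specPull_comp_specMap (Proj.toSpecZero 𝒜) (CommRingCat.ofHom (algebraMap ℂ (𝒜 0)))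
    (Proj.basicOpen 𝒜 f)
  refine (congrArg (fun φ => φ.hom c) h1).trans ?_
  rw [specPull_toSpecZero 𝒜 hf hd]
  refine congrArg (Proj.awayToSection 𝒜 f).hom (HomogeneousLocalization.val_injective _ ?_)
  rw [HomogeneousLocalization.Away.val_mk]
  refine (HomogeneousLocalization.val_mk _).trans ?_
  congr 1
  exact Subtype.ext (pow_zero f).symm

/-- A homomorphism on `R` which makes `f` invertible induces one on the functions on `D₊(f)`. -/
lemma exists_algHom_basicOpen {B : Type} [CommRing B] [Algebra ℂ B] (θ : R →ₐ[ℂ] B) {d : ℕ} {f : R}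
    (hf : f ∈ 𝒜 d) (hd : 0 < d) (hu : IsUnit (θ f)) :
    ∃ ψ : Γ((projOver 𝒜).left, Proj.basicOpen 𝒜 f) →ₐ[ℂ] B,
      ∀ r h hh, ψ (projFraction 𝒜 f hf r h hh) * θ f ^ r = θ h := by
  let ψ₀ : HomogeneousLocalization.Away 𝒜 f →+* B :=
    (IsLocalization.Away.lift (S := Localization.Away f) f (g := θ.toRingHom) hu).comp
      (algebraMap _ (Localization.Away f))
  have h₀ : ∀ r h hh, ψ₀ (HomogeneousLocalization.Away.mk 𝒜 hf r h hh) * θ f ^ r = θ h := by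
    intro r h hh
    simp only [ψ₀, RingHom.comp_apply, HomogeneousLocalization.algebraMap_apply,
      HomogeneousLocalization.Away.val_mk]
    have h1 : Localization.mk h (⟨f ^ r, r, rfl⟩ : Submonoid.powers f) *
        algebraMap R (Localization.Away f) f ^ r = algebraMap R _ h := by
      rw [← map_pow, Localization.mk_eq_mk']
      exact IsLocalization.mk'_spec _ h (⟨f ^ r, r, rfl⟩ : Submonoid.powers f)
    have h2 := congrArg (IsLocalization.Away.lift (S := Localization.Away f) f
      (g := θ.toRingHom) hu) h1
    rw [map_mul, map_pow, IsLocalization.Away.lift_eq, IsLocalization.Away.lift_eq] at h2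
    exact h2
  have h₁ : ∀ a, (Proj.basicOpenIsoAway 𝒜 f hf hd).inv.hom ((Proj.awayToSection 𝒜 f).hom a) = a :=
    fun a => congrArg (fun φ => φ.hom a) (Proj.basicOpenIsoAway 𝒜 f hf hd).hom_inv_id
  let ψ : Γ((projOver 𝒜).left, Proj.basicOpen 𝒜 f) →+* B :=
    ψ₀.comp (Proj.basicOpenIsoAway 𝒜 f hf hd).inv.hom
  have h₂ : ∀ r h hh, ψ (projFraction 𝒜 f hf r h hh) * θ f ^ r = θ h := by
    intro r h hh
    rw [← h₀ r h hh]
    exact congrArg (fun a => ψ₀ a * θ f ^ r) (h₁ _)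
  refine ⟨{ ψ with commutes' := fun c => ?_ }, h₂⟩
  have := h₂ 0 (algebraMap ℂ R c) (by rw [zero_smul]; exact SetLike.algebraMap_mem_graded 𝒜 c)
  rw [pow_zero, mul_one, ← projFraction_algebraMap 𝒜 hf hd, θ.commutes] at this
  exact this

end Proj


/-! ### Charts and loci of linearized varieties -/

section Charts

lemma lift_lift_act {G : Over SpecC} [GrpObj G] {X : Over SpecC} [ModObj G X] {T : Over SpecC}
    (a b : T ⟶ G) (x : T ⟶ X) :
    lift a (lift b x ≫ act G X) ≫ act G X = lift (lift a b ≫ μ[G]) x ≫ act G X := by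
  have h := congrArg (lift a (lift b x) ≫ ·) (lift_mul_act G X)
  simp only [← Category.assoc, comp_lift, lift_fst, lift_snd] at h
  exact h.symm

/-- An open set `U` with `g U ⊆ U` for all `g` is stable. -/
lemma isStable_of_le {G : Over SpecC} [GrpObj G] {X : Over SpecC} [ModObj G X]
    {U : X.left.Opens} (h : (snd G X).left ⁻¹ᵁ U ≤ (act G X).left ⁻¹ᵁ U) : IsStable G X U := by
  refine le_antisymm ?_ h
  have h1 : lift (fst G X ≫ ι[G]) (act G X) ≫ act G X = snd G X := by
    have h2 := lift_lift_act (fst G X ≫ ι[G]) (fst G X) (snd G X)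
    have h3 : lift (fst G X ≫ ι[G]) (fst G X) ≫ μ[G] = toUnit _ ≫ η[G] := by
      have := congrArg (fst G X ≫ ·) (GrpObj.left_inv G)
      simp only [← Category.assoc, comp_lift, Category.comp_id] at this
      rw [this]
      congr 1
    have h4 : lift (toUnit (G ⊗ X) ≫ η[G]) (snd G X) ≫ act G X = snd G X := by
      have := congrArg (snd G X ≫ ·) (lift_one_act G X)
      simp only [← Category.assoc, comp_lift, Category.comp_id] at this
      rw [← this]
      congr 3
      exact toUnit_unique _ _
    rw [h3, h4, lift_fst_snd, Category.id_comp] at h2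
    exact h2
  intro z hz
  have hz' : (lift (fst G X ≫ ι[G]) (act G X)).left z ∈ (snd G X).left ⁻¹ᵁ U := by
    have h5 : (lift (fst G X ≫ ι[G]) (act G X) ≫ snd G X).left z ∈ U := by
      rw [lift_snd]
      exact hz
    exact h5
  have h6 : (lift (fst G X ≫ ι[G]) (act G X) ≫ act G X).left z ∈ U := h hz'
  rw [h1] at h6
  exact h6

attribute [local instance] MvPolynomial.gradedAlgebra

lemma iSup_chart {X : Over SpecC} {N : ℕ} (j : X ⟶ projSpace N) : ⨆ i, chart j i = ⊤ := by
  unfold chart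
  rw [← Scheme.Hom.preimage_iSup, Proj.iSup_basicOpen_eq_top' _ _ (fun i => ⟨1, X_mem i⟩)]
  · rfl
  · rw [eq_top_iff]
    intro p _
    induction p using MvPolynomial.induction_on with
    | C c =>
      exact Subalgebra.algebraMap_mem (Algebra.adjoin _ _)
        (⟨MvPolynomial.C c, MvPolynomial.isHomogeneous_C _ c⟩ :
          MvPolynomial.homogeneousSubmodule (Fin N) ℂ 0)
    | add p q hp hq => exact add_mem (hp trivial) (hq trivial)
    | mul_X p i hp => exact mul_mem (hp trivial) (Algebra.subset_adjoin ⟨i, rfl⟩)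

lemma exists_mem_chart {X : Over SpecC} {N : ℕ} (j : X ⟶ projSpace N) (x : X.left) :
    ∃ i, x ∈ chart j i :=
  TopologicalSpace.Opens.mem_iSup.1 ((iSup_chart j).ge trivial)

variable {A : Type} [CommRing A] [HopfAlgebra ℂ A] {X : Over SpecC} [ModObj (algGroup A) X]
  (L : Linearization A X)

lemma chartPair_le_act {N : ℕ} (j : X ⟶ projSpace N) (i k : Fin N) :
    chartPair (A := A) j i k ≤ (act (algGroup A) X).left ⁻¹ᵁ chart j i :=
  fun _ hz => hz.1

lemma chartPair_le_snd {N : ℕ} (j : X ⟶ projSpace N) (i k : Fin N) :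
    chartPair (A := A) j i k ≤ (snd (algGroup A) X).left ⁻¹ᵁ chart j k :=
  fun _ hz => hz.2

namespace Linearization

variable {L} {n : ℕ} {u : L.ChartFunctions}

lemma mem_locus {x : X.left} : x ∈ L.locus u ↔ ∃ i, x ∈ X.left.basicOpen (u i) :=
  TopologicalSpace.Opens.mem_iSup

lemma basicOpen_le_locus (u : L.ChartFunctions) (i : Fin L.N) :
    X.left.basicOpen (u i) ≤ L.locus u :=
  le_iSup (fun i => X.left.basicOpen (u i)) i

lemma mem_basicOpen_iff (hu : u ∈ L.invariantSections n) {i : Fin L.N} {x : X.left}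
    (hx : x ∈ chart L.j i) : x ∈ X.left.basicOpen (u i) ↔ x ∈ L.locus u := by
  refine ⟨fun h => basicOpen_le_locus u i h, fun h => ?_⟩
  obtain ⟨k, hk⟩ := mem_locus.1 h
  have hxk : x ∈ chart L.j k := X.left.basicOpen_le _ hk
  have h1 : x ∈ X.left.basicOpen (res X (V := chart L.j i ⊓ chart L.j k) inf_le_right (u k)) := by
    rw [basicOpen_res]
    exact ⟨⟨hx, hxk⟩, hk⟩
  rw [hu.1 i k, Scheme.basicOpen_mul, basicOpen_res] at h1
  exact h1.1.2

lemma locus_inf_chart (hu : u ∈ L.invariantSections n) (i : Fin L.N) :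
    L.locus u ⊓ chart L.j i = X.left.basicOpen (u i) := by
  ext x
  refine ⟨fun h => (mem_basicOpen_iff hu h.2).2 h.1, fun h => ?_⟩
  have hx := X.left.basicOpen_le _ h
  exact ⟨(mem_basicOpen_iff hu hx).1 h, hx⟩

lemma pull_act_mul (hu : u ∈ L.invariantSections n) (i k : Fin L.N) :
    pull (act (algGroup A) X) (chart L.j i) (chartPair L.j i k) (chartPair_le_act L.j i k) (u i) *
        translate L.c L.j i i k ^ n =
      pull (snd (algGroup A) X) (chart L.j k) (chartPair L.j i k) (chartPair_le_snd L.j i k) (u k) :=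
  hu.2 i k

lemma isStable_locus (hu : u ∈ L.invariantSections n) : IsStable (algGroup A) X (L.locus u) := by
  refine isStable_of_le fun z hz => ?_
  obtain ⟨k, hk⟩ := mem_locus.1 hz
  obtain ⟨i, hi⟩ := exists_mem_chart L.j ((act (algGroup A) X).left z)
  have hz : z ∈ chartPair L.j i k := ⟨hi, X.left.basicOpen_le _ hk⟩
  have h1 : z ∈ (algGroup A ⊗ X).left.basicOpen
      (pull (snd (algGroup A) X) (chart L.j k) (chartPair L.j i k)
        (chartPair_le_snd L.j i k) (u k)) := by
    rw [basicOpen_pull]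
    exact ⟨hz, hk⟩
  rw [← pull_act_mul hu i k, Scheme.basicOpen_mul, basicOpen_pull] at h1
  exact basicOpen_le_locus u i h1.1.2

end Linearization

end Charts


/-! ### Fractions of invariant sections -/

section Fractions

lemma exists_forall_pow_mul_eq {κ : Type*} [Finite κ] {B : κ → Type*} [∀ p, CommRing (B p)]
    {f s t : ∀ p, B p} (h : ∀ p, ∃ m : ℕ, f p ^ m * s p = f p ^ m * t p) :
    ∃ M : ℕ, ∀ p, f p ^ M * s p = f p ^ M * t p := by
  choose m hm using h
  obtain ⟨M, hM⟩ := Finite.bddAbove_range m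
  refine ⟨M, fun p => ?_⟩
  obtain ⟨c, rfl⟩ := Nat.exists_eq_add_of_le (hM ⟨p, rfl⟩)
  rw [add_comm, pow_add, mul_assoc, hm, mul_assoc]

/-- The identity used for `a = fᵢ(g x)`, `b = f_k(x)`, `c = xᵢ(g x) / x_k(x)`, `s = hᵢ(g x)` and
`t = h_k(x)`. -/
lemma mul_pow_eq_of_eq {B : Type*} [CommRing B] {a b c s t : B} {n r m₁ m₂ : ℕ} (h : a * c ^ n = b)
    (h' : b ^ m₂ * (s * c ^ (r * n)) = b ^ m₂ * t) :
    a ^ (m₁ + m₂) * s * c ^ ((m₁ + m₂ + r) * n) = b ^ (m₁ + m₂) * t := by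
  rw [pow_add b, mul_assoc (b ^ m₁), ← h', ← h]
  ring

attribute [local instance] MvPolynomial.gradedAlgebra

variable {A : Type} [CommRing A] [HopfAlgebra ℂ A] {X : Over SpecC} [ModObj (algGroup A) X]

namespace Linearization

variable (L : Linearization A X)

/-- `g` is the function `h / fʳ` on `W`: on each chart, `hᵢ = fᵢʳ g`. -/
def IsFraction (f : L.ChartFunctions) (W : X.left.Opens) (r : ℕ) (h : L.ChartFunctions)
    (g : Γ(X.left, W)) : Prop :=
  ∀ i, res X (V := chart L.j i ⊓ W) inf_le_left (h i) =
    res X inf_le_left (f i) ^ r * res X inf_le_right g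

variable {L} {f h : L.ChartFunctions} {W : X.left.Opens} {n r : ℕ} {g : Γ(X.left, W)}

lemma isUnit_res (hf : f ∈ L.invariantSections n) (hW : W ≤ L.locus f) (i : Fin L.N) :
    IsUnit (res X (V := chart L.j i ⊓ W) inf_le_left (f i)) := by
  rw [isUnit_iff_le_basicOpen, basicOpen_res, ← locus_inf_chart hf]
  exact fun x hx => ⟨hx, hW hx.2, hx.1⟩

lemma IsFraction.unique (hf : f ∈ L.invariantSections n) (hW : W ≤ L.locus f)
    {g' : Γ(X.left, W)} (hg : L.IsFraction f W r h g) (hg' : L.IsFraction f W r h g') : g = g' := by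
  refine eq_of_res_eq (fun i => chart L.j i ⊓ W) (fun i => inf_le_right) ?_ fun i => ?_
  · rw [← iSup_inf_eq, iSup_chart, top_inf_eq]
  · exact ((isUnit_res hf hW i).pow r).mul_left_cancel ((hg i).symm.trans (hg' i))

lemma IsFraction.pow_mul_num (hg : L.IsFraction f W r h g) (m : ℕ) :
    L.IsFraction f W (m + r) (f ^ m * h) g := by
  intro i
  rw [Pi.mul_apply, Pi.pow_apply, map_mul, map_pow, hg i, pow_add, mul_assoc]

lemma IsFraction.pull_snd (hg : L.IsFraction f W r h g) {V : (algGroup A ⊗ X).left.Opens}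
    {k : Fin L.N} (h1 : V ≤ (snd (algGroup A) X).left ⁻¹ᵁ chart L.j k)
    (h2 : V ≤ (snd (algGroup A) X).left ⁻¹ᵁ W) :
    pull (snd (algGroup A) X) _ V h1 (h k) =
      pull (snd (algGroup A) X) _ V h1 (f k) ^ r * pull (snd (algGroup A) X) _ V h2 g := by
  have h3 : V ≤ (snd (algGroup A) X).left ⁻¹ᵁ (chart L.j k ⊓ W) := le_inf h1 h2
  have := congrArg (pull (snd (algGroup A) X) _ V h3) (hg k)
  rwa [map_mul, map_pow, pull_res, pull_res, pull_res] at this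

lemma IsFraction.pull_act (hg : L.IsFraction f W r h g) {V : (algGroup A ⊗ X).left.Opens}
    {i : Fin L.N} (h1 : V ≤ (act (algGroup A) X).left ⁻¹ᵁ chart L.j i)
    (h2 : V ≤ (act (algGroup A) X).left ⁻¹ᵁ W) :
    pull (act (algGroup A) X) _ V h1 (h i) =
      pull (act (algGroup A) X) _ V h1 (f i) ^ r * pull (act (algGroup A) X) _ V h2 g := by
  have h3 : V ≤ (act (algGroup A) X).left ⁻¹ᵁ (chart L.j i ⊓ W) := le_inf h1 h2
  have := congrArg (pull (act (algGroup A) X) _ V h3) (hg i)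
  rwa [map_mul, map_pow, pull_res, pull_res, pull_res] at this

/-- Quotients of invariant sections are invariant functions. -/
lemma IsFraction.mem_invariants (hf : f ∈ L.invariantSections n)
    (hh : h ∈ L.invariantSections (r • n)) (hW : W = L.locus f) (hg : L.IsFraction f W r h g) :
    g ∈ invariants (algGroup A) X W := by
  have hs : IsStable (algGroup A) X W := hW ▸ isStable_locus hf
  rw [mem_invariants_iff hs]
  refine eq_of_res_eq (X := algGroup A ⊗ X) (κ := Fin L.N × Fin L.N)
    (fun p => chartPair L.j p.1 p.2 ⊓ (snd (algGroup A) X).left ⁻¹ᵁ W)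
    (fun p => inf_le_right) ?_ fun p => ?_
  · intro z hz
    obtain ⟨i, hi⟩ := exists_mem_chart L.j ((act (algGroup A) X).left z)
    obtain ⟨k, hk⟩ := exists_mem_chart L.j ((snd (algGroup A) X).left z)
    exact TopologicalSpace.Opens.mem_iSup.2 ⟨(i, k), ⟨⟨hi, hk⟩, hz⟩⟩
  · obtain ⟨i, k⟩ := p
    have h1 : chartPair L.j i k ⊓ (snd (algGroup A) X).left ⁻¹ᵁ W ≤
      chartPair (A := A) L.j i k := inf_le_left
    have h2 : chartPair L.j i k ⊓ (snd (algGroup A) X).left ⁻¹ᵁ W ≤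
      (snd (algGroup A) X).left ⁻¹ᵁ W := inf_le_right
    have e1 := congrArg (res (algGroup A ⊗ X) h1) (pull_act_mul hf i k)
    have e2 := congrArg (res (algGroup A ⊗ X) h1) (pull_act_mul hh i k)
    rw [map_mul, map_pow, res_pull, res_pull] at e1 e2
    rw [hg.pull_act (h1.trans (chartPair_le_act L.j i k)) (h2.trans hs.act_le),
      hg.pull_snd (h1.trans (chartPair_le_snd L.j i k)) h2, ← e1] at e2
    have hu : IsUnit (pull (snd (algGroup A) X) _ _ (h1.trans (chartPair_le_snd L.j i k))
        (f k)) := by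
      have h4 : chartPair L.j i k ⊓ (snd (algGroup A) X).left ⁻¹ᵁ W ≤
        (snd (algGroup A) X).left ⁻¹ᵁ (chart L.j k ⊓ W) :=
        le_inf (h1.trans (chartPair_le_snd L.j i k)) h2
      have h3 := (isUnit_res hf hW.le k).map (pull (snd (algGroup A) X) _ _ h4)
      rwa [pull_res] at h3
    rw [← e1] at hu
    rw [res_pull, res_pull]
    refine (hu.pow r).mul_left_cancel ?_
    rw [smul_eq_mul, mul_comm r n, pow_mul] at e2
    linear_combination e2

/-- If `h / fʳ` is an invariant function on `X_f`, then `f ^ m h` is an invariant section for some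
`m`: the finitely many equations between functions on `X` and on `G × X` that are required hold
where `f` does not vanish, so they hold after multiplication with a power of `f`. -/
lemma IsFraction.exists_pow_mul_mem (hX : ∀ V : X.left.Opens, IsCompact (V : Set X.left))
    (hGX : ∀ V : (algGroup A ⊗ X).left.Opens, IsCompact (V : Set (algGroup A ⊗ X).left))
    (hf : f ∈ L.invariantSections n) (hW : W = L.locus f)
    (hgi : g ∈ invariants (algGroup A) X W) (hg : L.IsFraction f W r h g) :
    ∃ m : ℕ, f ^ m * h ∈ L.invariantSections ((m + r) • n) := by
  have hs : IsStable (algGroup A) X W := hW ▸ isStable_locus hf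
  have H1 : ∀ p : Fin L.N × Fin L.N, ∃ m : ℕ,
      res X (V := chart L.j p.1 ⊓ chart L.j p.2) inf_le_right (f p.2) ^ m *
        res X (V := chart L.j p.1 ⊓ chart L.j p.2) inf_le_right (h p.2) =
      res X (V := chart L.j p.1 ⊓ chart L.j p.2) inf_le_right (f p.2) ^ m *
        (res X inf_le_left (h p.1) * res X inf_le_right (ratio L.j p.1 p.2) ^ (r * n)) := by
    rintro ⟨i, k⟩
    refine exists_pow_mul_eq (hX _) (W := (chart L.j i ⊓ chart L.j k) ⊓ W) inf_le_left ?_ ?_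
    · rw [basicOpen_res, ← locus_inf_chart hf, hW]
      exact fun x hx => ⟨hx.1, hx.2.1⟩
    · have e1 := congrArg (res X (show (chart L.j i ⊓ chart L.j k) ⊓ W ≤ chart L.j i ⊓ W
        from fun x hx => ⟨hx.1.1, hx.2⟩)) (hg i)
      have e2 := congrArg (res X (show (chart L.j i ⊓ chart L.j k) ⊓ W ≤ chart L.j k ⊓ W
        from fun x hx => ⟨hx.1.2, hx.2⟩)) (hg k)
      have e3 := congrArg (res X (V := (chart L.j i ⊓ chart L.j k) ⊓ W) inf_le_left) (hf.1 i k)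
      simp only [map_mul, map_pow, res_res] at e1 e2 e3 ⊢
      rw [e1, e2, e3]
      ring
  have H2 : ∀ p : Fin L.N × Fin L.N, ∃ m : ℕ,
      pull (snd (algGroup A) X) _ (chartPair L.j p.1 p.2) (chartPair_le_snd L.j p.1 p.2)
        (f p.2) ^ m * (pull (act (algGroup A) X) _ (chartPair L.j p.1 p.2)
          (chartPair_le_act L.j p.1 p.2) (h p.1) * translate L.c L.j p.1 p.1 p.2 ^ (r * n)) =
      pull (snd (algGroup A) X) _ (chartPair L.j p.1 p.2) (chartPair_le_snd L.j p.1 p.2)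
        (f p.2) ^ m * pull (snd (algGroup A) X) _ (chartPair L.j p.1 p.2)
          (chartPair_le_snd L.j p.1 p.2) (h p.2) := by
    rintro ⟨i, k⟩
    have h1 : chartPair L.j i k ⊓ (snd (algGroup A) X).left ⁻¹ᵁ W ≤
      chartPair (A := A) L.j i k := inf_le_left
    have h2 : chartPair L.j i k ⊓ (snd (algGroup A) X).left ⁻¹ᵁ W ≤
      (snd (algGroup A) X).left ⁻¹ᵁ W := inf_le_right
    refine exists_pow_mul_eq (X := algGroup A ⊗ X) (hGX _) h1 ?_ ?_
    · rw [basicOpen_pull, ← locus_inf_chart hf, hW]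
      exact fun x hx => ⟨hx.1, hx.2.1⟩
    · have e1 := congrArg (res (algGroup A ⊗ X) h1) (pull_act_mul hf i k)
      have e2 := congrArg (res (algGroup A ⊗ X) h2) ((mem_invariants_iff hs g).1 hgi)
      simp only [map_mul, map_pow, res_pull] at e1 e2 ⊢
      rw [hg.pull_act (h1.trans (chartPair_le_act L.j i k)) (h2.trans hs.act_le),
        hg.pull_snd (h1.trans (chartPair_le_snd L.j i k)) h2, e2, ← e1]
      ring
  obtain ⟨m₁, hm₁⟩ := exists_forall_pow_mul_eq H1
  obtain ⟨m₂, hm₂⟩ := exists_forall_pow_mul_eq H2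
  refine ⟨m₁ + m₂, fun i k => ?_, fun i k => ?_⟩
  · have e1 := hm₁ (i, k)
    have e3 := hf.1 i k
    simp only [Pi.mul_apply, Pi.pow_apply, map_mul, map_pow, smul_eq_mul] at e1 e3 ⊢
    rw [add_comm m₁, pow_add, mul_assoc, e1, ← mul_assoc, ← pow_add, e3]
    ring
  · have e1 := hm₂ (i, k)
    have e3 := pull_act_mul hf i k
    change pull (act (algGroup A) X) _ (chartPair L.j i k) (chartPair_le_act L.j i k) _ * _ =
      pull (snd (algGroup A) X) _ (chartPair L.j i k) (chartPair_le_snd L.j i k) _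
    simp only [Pi.mul_apply, Pi.pow_apply, map_mul, map_pow, smul_eq_mul] at e1 e3 ⊢
    exact mul_pow_eq_of_eq e3 e1

/-- Every function on `X_f` is of the form `h / fʳ`. -/
lemma exists_isFraction (hX : ∀ V : X.left.Opens, IsCompact (V : Set X.left))
    (hf : f ∈ L.invariantSections n) (hW : W = L.locus f) (g : Γ(X.left, W)) :
    ∃ (r : ℕ) (h : L.ChartFunctions), L.IsFraction f W r h g := by
  have H : ∀ i, ∃ (m : ℕ) (t : Γ(X.left, chart L.j i)),
      res X (V := chart L.j i ⊓ W) inf_le_left t =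
        res X inf_le_left (f i) ^ m * res X inf_le_right g := fun i =>
    exists_res_eq_pow_mul (hX _) (fun U V _ hU _ _ hV _ => hX ⟨U ∩ V, hU.inter hV⟩) (f i)
      (by rw [← locus_inf_chart hf, hW, inf_comm]) inf_le_left _
  choose m t ht using H
  obtain ⟨M, hM⟩ := Finite.bddAbove_range m
  refine ⟨M, fun i => f i ^ (M - m i) * t i, fun i => ?_⟩
  have hi : m i ≤ M := hM ⟨i, rfl⟩
  rw [map_mul, map_pow, ht, ← mul_assoc, ← pow_add, Nat.sub_add_cancel hi]

/-- If `h / fʳ` vanishes on `X_f`, then some `f ^ m h` vanishes. -/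
lemma IsFraction.exists_pow_mul_eq_zero (hX : ∀ V : X.left.Opens, IsCompact (V : Set X.left))
    (hf : f ∈ L.invariantSections n) (hW : W = L.locus f) (hg : L.IsFraction f W r h 0) :
    ∃ m : ℕ, f ^ m * h = 0 := by
  have H : ∀ i, ∃ m : ℕ, f i ^ m * h i = f i ^ m * 0 := fun i => by
    refine exists_pow_mul_eq (hX _) (W := chart L.j i ⊓ W) inf_le_left ?_ ?_
    · rw [← locus_inf_chart hf, hW, inf_comm]
    · rw [hg i, map_zero, map_zero, mul_zero]
  obtain ⟨m, hm⟩ := exists_forall_pow_mul_eq H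
  exact ⟨m, funext fun i => (hm i).trans (mul_zero _)⟩

end Linearization

end Fractions


/-! ### Canonical morphisms to `Proj` -/

section Canonical

lemma exists_eq_ofPiece {P : Type} [CommRing P] [Algebra ℂ P] (M : ℕ → Submodule ℂ P)
    [SetLike.GradedMonoid M] {n : ℕ} {F : sumRing M} (hF : F ∈ sumPiece M n) :
    ∃ u : M n, F = ofPiece M n u := by
  refine ⟨⟨F.1.coeff n, F.2 n⟩, Subtype.ext (Polynomial.ext fun m => ?_)⟩
  change _ = (Polynomial.monomial n (F.1.coeff n)).coeff m
  rw [Polynomial.coeff_monomial]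
  split_ifs with h
  · rw [h]
  · exact hF m (Ne.symm h)

/-- The open subset `D₊(f)` of `Proj (⨁ M n)` for `f ∈ M n`. -/
def dPlus {P : Type} [CommRing P] [Algebra ℂ P] (M : ℕ → Submodule ℂ P)
    [SetLike.GradedMonoid M] {n : ℕ} (f : M n) : (projOver (sumPiece M)).left.Opens :=
  Proj.basicOpen (sumPiece M) (ofPiece M n f)

/-- The function `h / fʳ` on `D₊(f)`. -/
def dPlusFraction {P : Type} [CommRing P] [Algebra ℂ P] (M : ℕ → Submodule ℂ P)
    [SetLike.GradedMonoid M] {n : ℕ} (f : M n) (r : ℕ) (h : M (r • n)) :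
    Γ((projOver (sumPiece M)).left, dPlus M f) :=
  projFraction (sumPiece M) _ (ofPiece M n f).2 r _ (ofPiece M (r • n) h).2

lemma isAffineOpen_dPlus {P : Type} [CommRing P] [Algebra ℂ P] (M : ℕ → Submodule ℂ P)
    [SetLike.GradedMonoid M] {n : ℕ} (hn : 0 < n) (f : M n) : IsAffineOpen (dPlus M f) :=
  Proj.isAffineOpen_basicOpen (sumPiece M) _ (ofPiece M n f).2 hn

lemma exists_eq_dPlusFraction {P : Type} [CommRing P] [Algebra ℂ P] (M : ℕ → Submodule ℂ P)
    [SetLike.GradedMonoid M] {n : ℕ} (hn : 0 < n) (f : M n)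
    (s : Γ((projOver (sumPiece M)).left, dPlus M f)) : ∃ r h, s = dPlusFraction M f r h := by
  obtain ⟨r, H, hH, rfl⟩ := exists_eq_projFraction (sumPiece M) (ofPiece M n f).2 hn s
  obtain ⟨h, rfl⟩ := exists_eq_ofPiece M hH
  exact ⟨r, h, rfl⟩

/-- Functions are equal if their restrictions to the members of an open cover, as schemes, are. -/
lemma eq_of_pull_openIncl_eq {T : Over SpecC} {κ : Type*} (V : κ → T.left.Opens)
    (hV : ⨆ k, V k = ⊤) {W : T.left.Opens} {s t : Γ(T.left, W)}
    (h : ∀ k, pull (openIncl T (V k)) W ((openIncl T (V k)).left ⁻¹ᵁ W) le_rfl s =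
      pull (openIncl T (V k)) W ((openIncl T (V k)).left ⁻¹ᵁ W) le_rfl t) : s = t := by
  refine eq_of_res_eq (fun k => (V k).ι ''ᵁ (show (V k).toScheme.Opens from
    (openIncl T (V k)).left ⁻¹ᵁ W)) (fun k => image_le_of_le_preimage le_rfl) ?_ fun k => ?_
  · intro x hx
    obtain ⟨k, hk⟩ := TopologicalSpace.Opens.mem_iSup.1 (hV.ge (show x ∈ ⊤ from trivial))
    exact TopologicalSpace.Opens.mem_iSup.2 ⟨k, ⟨x, hk⟩, hx, rfl⟩
  · exact (openSubEquiv_pull_openIncl le_rfl s).symm.trans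
      ((congrArg _ (h k)).trans (openSubEquiv_pull_openIncl le_rfl t))

/-- For `a : T ⟶ Y` and `t : T ⟶ X`, the pull-back of the function `s` on `D ⊆ Y` is the fraction
`h / fʳ` of functions on `C ⊆ X`. -/
def IsPullFraction {T X Y : Over SpecC} (a : T ⟶ Y) (t : T ⟶ X) {D : Y.left.Opens}
    {C : X.left.Opens} (s : Γ(Y.left, D)) (f : Γ(X.left, C)) (r : ℕ) (h : Γ(X.left, C)) : Prop :=
  pull a D (a.left ⁻¹ᵁ D ⊓ t.left ⁻¹ᵁ C) inf_le_left s * pull t C _ inf_le_right f ^ r =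
    pull t C _ inf_le_right h

section IsPullFraction

variable {T X Y : Over SpecC} {a : T ⟶ Y} {t : T ⟶ X} {D : Y.left.Opens}
    {C : X.left.Opens} {s : Γ(Y.left, D)} {f h : Γ(X.left, C)} {r : ℕ}

lemma IsPullFraction.pull_mul (H : IsPullFraction a t s f r h) {V : T.left.Opens}
    (h1 : V ≤ a.left ⁻¹ᵁ D) (h2 : V ≤ t.left ⁻¹ᵁ C) :
    pull a D V h1 s * pull t C V h2 f ^ r = pull t C V h2 h := by
  have h3 : V ≤ a.left ⁻¹ᵁ D ⊓ t.left ⁻¹ᵁ C := le_inf h1 h2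
  have := congrArg (res T h3) H
  rwa [map_mul, map_pow, res_pull, res_pull, res_pull] at this

lemma IsPullFraction.of_pull_mul
    (H : ∀ (V : T.left.Opens) (h1 : V ≤ a.left ⁻¹ᵁ D) (h2 : V ≤ t.left ⁻¹ᵁ C),
      pull a D V h1 s * pull t C V h2 f ^ r = pull t C V h2 h) : IsPullFraction a t s f r h :=
  H _ inf_le_left inf_le_right

lemma IsPullFraction.comp (H : IsPullFraction a t s f r h) {S : Over SpecC} (p : S ⟶ T) :
    IsPullFraction (p ≫ a) (p ≫ t) s f r h := by
  have h3 : (p ≫ a).left ⁻¹ᵁ D ⊓ (p ≫ t).left ⁻¹ᵁ C ≤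
    p.left ⁻¹ᵁ (a.left ⁻¹ᵁ D ⊓ t.left ⁻¹ᵁ C) := le_rfl
  have := congrArg (pull p _ _ h3) H
  rwa [map_mul, map_pow, pull_pull, pull_pull, pull_pull] at this

lemma isPullFraction_of_cover {κ : Type*} (V : κ → T.left.Opens) (hV : ⨆ k, V k = ⊤)
    (H : ∀ k, IsPullFraction (openIncl T (V k) ≫ a) (openIncl T (V k) ≫ t) s f r h) :
    IsPullFraction a t s f r h := by
  refine eq_of_pull_openIncl_eq V hV fun k => ?_
  have := H k
  rw [map_mul, map_pow, pull_pull, pull_pull, pull_pull]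
  exact this

/-- A morphism to an affine open set `D` is determined by the fractions which are the pull-backs of
the functions on `D`. -/
lemma eq_of_isPullFraction {κ : Type*} {b : T ⟶ Y} (hD : IsAffineOpen D) (ha : ⊤ ≤ a.left ⁻¹ᵁ D)
    (hb : ⊤ ≤ b.left ⁻¹ᵁ D) {C : κ → X.left.Opens} (hC : ⨆ k, C k = ⊤)
    (f : ∀ k, Γ(X.left, C k)) (hf : ∀ k, t.left ⁻¹ᵁ C k ≤ t.left ⁻¹ᵁ X.left.basicOpen (f k))
    (H : ∀ s : Γ(Y.left, D), ∃ (r : ℕ) (h : ∀ k, Γ(X.left, C k)),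
      (∀ k, IsPullFraction a t s (f k) r (h k)) ∧ ∀ k, IsPullFraction b t s (f k) r (h k)) :
    a = b := by
  refine eq_of_pull_eq hD ha hb fun s => ?_
  obtain ⟨r, h, h1, h2⟩ := H s
  refine eq_of_res_eq (fun k => t.left ⁻¹ᵁ C k) (fun k => le_top) ?_ fun k => ?_
  · rw [← Scheme.Hom.preimage_iSup, hC]
    exact le_rfl
  · have e1 := (h1 k).pull_mul (le_top.trans ha) le_rfl
    have e2 := (h2 k).pull_mul (le_top.trans hb) le_rfl
    have hu : IsUnit (pull t (C k) _ le_rfl (f k)) := by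
      rw [isUnit_iff_le_basicOpen, basicOpen_pull]
      exact le_inf le_rfl (hf k)
    rw [res_pull, res_pull]
    exact (hu.pow r).mul_right_cancel (e1.trans e2.symm)

end IsPullFraction

attribute [local instance] MvPolynomial.gradedAlgebra

variable {A : Type} [CommRing A] [HopfAlgebra ℂ A] {X : Over SpecC} [ModObj (algGroup A) X]

namespace Linearization

variable {L : Linearization A X} {M : ℕ → Submodule ℂ L.ChartFunctions} [SetLike.GradedMonoid M]
  {T : Over SpecC}

/-- The morphism `a : T ⟶ Proj (⨁ M n)` is the canonical morphism, for the morphism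
`t : T ⟶ X`. For the inclusion `t` of an open subset this is `IsCanonical`. -/
def IsCanonicalFor (M : ℕ → Submodule ℂ L.ChartFunctions) [SetLike.GradedMonoid M] (t : T ⟶ X)
    (a : T ⟶ projOver (sumPiece M)) : Prop :=
  ∀ (n : ℕ) (_ : 0 < n) (f : M n), a.left ⁻¹ᵁ dPlus M f = t.left ⁻¹ᵁ L.locus f ∧
    ∀ (r : ℕ) (h : M (r • n)) (i : Fin L.N),
      IsPullFraction a t (dPlusFraction M f r h) (f.1 i) r (h.1 i)

lemma IsCanonicalFor.comp {t : T ⟶ X} {a : T ⟶ projOver (sumPiece M)}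
    (ha : IsCanonicalFor M t a) {S : Over SpecC} (s : S ⟶ T) :
    IsCanonicalFor M (s ≫ t) (s ≫ a) := fun n hn f =>
  ⟨congrArg (fun V => s.left ⁻¹ᵁ V) (ha n hn f).1, fun r h i => ((ha n hn f).2 r h i).comp s⟩

/-- Canonical morphisms are unique, over the locus of a section. -/
lemma IsCanonicalFor.unique (hM : ∀ n, M n ≤ L.invariantSections n) {t : T ⟶ X}
    {a b : T ⟶ projOver (sumPiece M)} (ha : IsCanonicalFor M t a) (hb : IsCanonicalFor M t b)
    {n : ℕ} (hn : 0 < n) (f : M n) (ht : ⊤ ≤ t.left ⁻¹ᵁ L.locus f) : a = b := by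
  refine eq_of_isPullFraction (t := t) (isAffineOpen_dPlus M hn f) (ht.trans (ha n hn f).1.ge)
    (ht.trans (hb n hn f).1.ge) (iSup_chart L.j) f.1 (fun i x hx => ?_) fun s => ?_
  · exact (mem_basicOpen_iff (hM n f.2) hx).2 (ht trivial)
  · obtain ⟨r, h, rfl⟩ := exists_eq_dPlusFraction M hn f s
    exact ⟨r, h.1, (ha n hn f).2 r h, (hb n hn f).2 r h⟩

/-- Being canonical is a local property. -/
lemma isCanonicalFor_of_cover {t : T ⟶ X} {a : T ⟶ projOver (sumPiece M)} {κ : Type*}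
    (V : κ → T.left.Opens) (hV : ⨆ k, V k = ⊤)
    (h : ∀ k, IsCanonicalFor M (openIncl T (V k) ≫ t) (openIncl T (V k) ≫ a)) :
    IsCanonicalFor M t a := by
  intro n hn f
  refine ⟨?_, fun r s i => isPullFraction_of_cover V hV fun k => (h k n hn f).2 r s i⟩
  ext x
  obtain ⟨k, hk⟩ := TopologicalSpace.Opens.mem_iSup.1 (hV.ge (show x ∈ ⊤ from trivial))
  have := congrArg (fun W => (⟨x, hk⟩ : (V k).toScheme) ∈ W) (h k n hn f).1
  exact this.to_iff

end Linearization

end Canonical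


/-! ### Existence of canonical morphisms -/

section Existence

section DPlus

variable {P : Type} [CommRing P] [Algebra ℂ P] (M : ℕ → Submodule ℂ P) [SetLike.GradedMonoid M]

/-- Evaluation at `t = 1` of the polynomials in `⨁ M n`. -/
def evalOne : sumRing M →ₐ[ℂ] P :=
  ((Polynomial.aeval (1 : P)).restrictScalars ℂ).comp (sumRing M).val

lemma evalOne_ofPiece {n : ℕ} (u : M n) : evalOne M (ofPiece M n u) = u := by
  change Polynomial.aeval (1 : P) (Polynomial.monomial n u.1) = u
  rw [Polynomial.aeval_monomial]
  simp

lemma dPlus_pow {e k : ℕ} (g : M e) {n : ℕ} (hn : 0 < n) (hk : g.1 ^ n ∈ M k) (h : k = e * n) :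
    dPlus M ⟨g.1 ^ n, hk⟩ = dPlus M g := by
  have h1 : (ofPiece M k ⟨g.1 ^ n, hk⟩ : sumRing M) = (ofPiece M e g : sumRing M) ^ n := by
    refine Subtype.ext ?_
    change Polynomial.monomial k (g.1 ^ n) = Polynomial.monomial e g.1 ^ n
    rw [Polynomial.monomial_pow, h]
  unfold dPlus
  rw [h1, Proj.basicOpen_pow _ _ _ hn]

lemma basicOpen_dPlusFraction {n : ℕ} (f : M n) (r : ℕ) (h : M (r • n)) :
    (projOver (sumPiece M)).left.basicOpen (dPlusFraction M f r h) = dPlus M f ⊓ dPlus M h :=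
  basicOpen_projFraction (sumPiece M) (ofPiece M n f).2 (ofPiece M (r • n) h).2

lemma res_dPlusFraction_mul {n e : ℕ} (f : M n) (g : M e) {r s t : ℕ} (h : M (r • e))
    (p : M (s • n)) (q : M (t • n)) (H : h.1 * p.1 * f.1 ^ t = q.1 * (g.1 ^ r * f.1 ^ s)) :
    res (projOver (sumPiece M)) (V := dPlus M f ⊓ dPlus M g) inf_le_right (dPlusFraction M g r h) *
      res (projOver (sumPiece M)) inf_le_left (dPlusFraction M f s p) =
      res (projOver (sumPiece M)) inf_le_left (dPlusFraction M f t q) := by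
  refine res_projFraction_mul (sumPiece M) (ofPiece M n f).2 (ofPiece M e g).2
    (ofPiece M (r • e) h).2 (ofPiece M (s • n) p).2 (ofPiece M (t • n) q).2 ?_
  refine Subtype.ext ?_
  change Polynomial.monomial (r • e) h.1 * Polynomial.monomial (s • n) p.1 *
    Polynomial.monomial n f.1 ^ t = Polynomial.monomial (t • n) q.1 *
      (Polynomial.monomial e g.1 ^ r * Polynomial.monomial n f.1 ^ s)
  simp only [Polynomial.monomial_pow, Polynomial.monomial_mul_monomial, smul_eq_mul, H]
  rw [show r * e + s * n + n * t = t * n + (e * r + n * s) by ring]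

lemma exists_algHom_dPlus {B : Type} [CommRing B] [Algebra ℂ B] (θ : P →ₐ[ℂ] B) {n : ℕ}
    (hn : 0 < n) (f : M n) (hu : IsUnit (θ f)) :
    ∃ ψ : Γ((projOver (sumPiece M)).left, dPlus M f) →ₐ[ℂ] B,
      ∀ r h, ψ (dPlusFraction M f r h) * θ f ^ r = θ h := by
  obtain ⟨ψ, hψ⟩ := exists_algHom_basicOpen (sumPiece M) (θ.comp (evalOne M)) (ofPiece M n f).2 hn
    (by rwa [AlgHom.comp_apply, evalOne_ofPiece])
  refine ⟨ψ, fun r h => ?_⟩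
  have := hψ r _ (ofPiece M (r • n) h).2
  rwa [AlgHom.comp_apply, evalOne_ofPiece, AlgHom.comp_apply, evalOne_ofPiece] at this

end DPlus

/-- Morphisms over `ℂ` that agree on the overlaps of an open cover can be glued. -/
lemma exists_glue {T Y : Over SpecC} {κ : Type} (V : κ → T.left.Opens) (hV : ⨆ k, V k = ⊤)
    (a : ∀ k, openSub T (V k) ⟶ Y)
    (h : ∀ k l (S : Over SpecC) (p : S ⟶ openSub T (V k)) (p' : S ⟶ openSub T (V l)),
      p ≫ openIncl T (V k) = p' ≫ openIncl T (V l) → p ≫ a k = p' ≫ a l) :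
    ∃ b : T ⟶ Y, ∀ k, openIncl T (V k) ≫ b = a k := by
  let 𝒰 := T.left.openCoverOfIsOpenCover V hV
  let b := 𝒰.glueMorphisms (fun k => (a k).left) (fun k l => by
    have hc : Limits.pullback.fst (𝒰.f k) (𝒰.f l) ≫ (V k).ι =
        Limits.pullback.snd (𝒰.f k) (𝒰.f l) ≫ (V l).ι := Limits.pullback.condition
    let S : Over SpecC := Over.mk (Limits.pullback.fst (𝒰.f k) (𝒰.f l) ≫ (V k).ι ≫ T.hom)
    let p : S ⟶ openSub T (V k) := Over.homMk (Limits.pullback.fst (𝒰.f k) (𝒰.f l)) rfl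
    let p' : S ⟶ openSub T (V l) := Over.homMk (Limits.pullback.snd (𝒰.f k) (𝒰.f l)) (by
      change Limits.pullback.snd (𝒰.f k) (𝒰.f l) ≫ (V l).ι ≫ T.hom =
        Limits.pullback.fst (𝒰.f k) (𝒰.f l) ≫ (V k).ι ≫ T.hom
      exact (Category.assoc _ _ _).symm.trans
        ((congrArg (· ≫ T.hom) hc.symm).trans (Category.assoc _ _ _)))
    have := h k l S p p' (Over.OverMorphism.ext hc)
    exact congrArg (fun f => f.left) this)
  have hb : ∀ k, (V k).ι ≫ b = (a k).left := fun k => 𝒰.ι_glueMorphisms _ _ k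
  refine ⟨Over.homMk b ?_, fun k => Over.OverMorphism.ext (hb k)⟩
  refine 𝒰.hom_ext _ _ fun k => ?_
  change (V k).ι ≫ b ≫ Y.hom = (V k).ι ≫ T.hom
  exact ((Category.assoc _ _ _).symm.trans (congrArg (· ≫ Y.hom) (hb k))).trans (Over.w (a k))

section ExtendCanonical

variable {T X Y : Over SpecC}

/-- The pull-back of `h / gʳ` is determined by that of the fractions with denominator `f`. -/
lemma isPullFraction_dPlusFraction {P : Type} [CommRing P] [Algebra ℂ P] {M : ℕ → Submodule ℂ P}
    [SetLike.GradedMonoid M] {a : T ⟶ projOver (sumPiece M)} {n e : ℕ} (hn : 0 < n) {f : M n}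
    {g : M e} {θ : P →ₐ[ℂ] Γ(T.left, ⊤)} (ha : ⊤ ≤ a.left ⁻¹ᵁ dPlus M f)
    (H : ∀ r h, pull a (dPlus M f) ⊤ ha (dPlusFraction M f r h) * θ f ^ r = θ h)
    {V : T.left.Opens} (hV : V ≤ a.left ⁻¹ᵁ dPlus M g) (hu : IsUnit (res T (le_top : V ≤ ⊤) (θ g)))
    (r : ℕ) (h : M (r • e)) :
    pull a (dPlus M g) V hV (dPlusFraction M g r h) * res T (le_top : V ≤ ⊤) (θ g) ^ r =
      res T (le_top : V ≤ ⊤) (θ h) := by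
  have hV' : V ≤ a.left ⁻¹ᵁ (dPlus M f ⊓ dPlus M g) := le_inf (le_top.trans ha) hV
  obtain ⟨k, rfl⟩ : ∃ k, n = k + 1 := ⟨n - 1, by omega⟩
  have hp : g.1 ^ ((k + 1) * r) ∈ M ((e * r) • (k + 1)) := by
    have := SetLike.pow_mem_graded ((k + 1) * r) g.2
    rwa [show ((k + 1) * r) • e = (e * r) • (k + 1) by simp only [smul_eq_mul]; ring] at this
  have hq : h.1 * g.1 ^ (k * r) ∈ M ((e * r) • (k + 1)) := by
    have := SetLike.mul_mem_graded h.2 (SetLike.pow_mem_graded (k * r) g.2)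
    rwa [show r • e + (k * r) • e = (e * r) • (k + 1) by simp only [smul_eq_mul]; ring] at this
  have h1 := congrArg (pull a _ V hV') (res_dPlusFraction_mul M f g (r := r) (s := e * r)
    (t := e * r) h ⟨_, hp⟩ ⟨_, hq⟩ (by ring))
  rw [map_mul, pull_res, pull_res, pull_res] at h1
  have h2 := fun p => congrArg (res T (le_top : V ≤ ⊤)) (H (e * r) p)
  simp only [map_mul, res_pull, map_pow] at h2
  have h3 := h2 ⟨_, hp⟩
  have h4 := h2 ⟨_, hq⟩
  rw [← h1, mul_assoc, h3] at h4
  simp only [map_mul, map_pow] at h4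
  refine (hu.pow (k * r)).mul_right_cancel ?_
  rw [← h4]
  ring

end ExtendCanonical

attribute [local instance] MvPolynomial.gradedAlgebra

variable {A : Type} [CommRing A] [HopfAlgebra ℂ A] {X : Over SpecC} [ModObj (algGroup A) X]

namespace Linearization

variable {L : Linearization A X} {M : ℕ → Submodule ℂ L.ChartFunctions} [SetLike.GradedMonoid M]
  {T : Over SpecC}

/-- The pull-back to `T` of the `i`-th component of a family of functions on the charts. -/
def pullChart (t : T ⟶ X) (i : Fin L.N) (ht : ⊤ ≤ t.left ⁻¹ᵁ chart L.j i) :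
    L.ChartFunctions →ₐ[ℂ] Γ(T.left, ⊤) :=
  (pull t (chart L.j i) ⊤ ht).comp (Pi.evalAlgHom ℂ _ i)

/-- A morphism to `D₊(f)` is canonical on a chart if it pulls the fractions `h / fʳ` back to
`h / fʳ`; the conditions for other denominators follow. -/
lemma isCanonicalFor_of_pull (hM : ∀ n, M n ≤ L.invariantSections n) {t : T ⟶ X}
    {a : T ⟶ projOver (sumPiece M)} {n : ℕ} (hn : 0 < n) (f : M n) (i : Fin L.N)
    (ht : ⊤ ≤ t.left ⁻¹ᵁ chart L.j i) (hf : ⊤ ≤ t.left ⁻¹ᵁ X.left.basicOpen (f.1 i))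
    (ha : ⊤ ≤ a.left ⁻¹ᵁ dPlus M f)
    (H : ∀ r h, pull a (dPlus M f) ⊤ ha (dPlusFraction M f r h) * pullChart t i ht f ^ r =
      pullChart t i ht h) : IsCanonicalFor M t a := by
  have hbas : ∀ {e : ℕ} (g : L.ChartFunctions), g ∈ L.invariantSections e →
      T.left.basicOpen (pullChart t i ht g) = t.left ⁻¹ᵁ L.locus g := by
    intro e g hg
    have h1 : T.left.basicOpen (pullChart t i ht g) = ⊤ ⊓ t.left ⁻¹ᵁ X.left.basicOpen (g i) :=
      basicOpen_pull _ _ _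
    rw [h1, top_inf_eq, ← locus_inf_chart hg]
    exact le_antisymm (fun x hx => hx.1) fun x hx => ⟨hx, ht trivial⟩
  have hu : IsUnit (pullChart t i ht f.1) := by
    rw [isUnit_iff_le_basicOpen, hbas f.1 (hM n f.2)]
    exact hf.trans (Scheme.Hom.preimage_mono _ (basicOpen_le_locus f.1 i))
  intro e he g
  have hpre : a.left ⁻¹ᵁ dPlus M g = t.left ⁻¹ᵁ L.locus g := by
    have hk : g.1 ^ n ∈ M (e • n) := by
      have := SetLike.pow_mem_graded n g.2
      rwa [smul_eq_mul, mul_comm, ← smul_eq_mul] at this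
    have h1 := congrArg (fun s => T.left.basicOpen s) (H e ⟨_, hk⟩)
    have h2 : T.left.basicOpen (pullChart t i ht f.1 ^ e) = ⊤ :=
      Scheme.basicOpen_of_isUnit _ (hu.pow e)
    have h3 : T.left.basicOpen (pullChart t i ht (g.1 ^ n)) = t.left ⁻¹ᵁ L.locus g := by
      rw [map_pow, Scheme.basicOpen_pow _ _ hn]
      exact hbas g.1 (hM e g.2)
    have h4 : T.left.basicOpen (pull a (dPlus M f) ⊤ ha (dPlusFraction M f e ⟨_, hk⟩)) =
        a.left ⁻¹ᵁ dPlus M g := by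
      rw [basicOpen_pull, basicOpen_dPlusFraction, dPlus_pow M g hn hk (by rw [smul_eq_mul]),
        top_inf_eq]
      exact le_antisymm (fun x hx => hx.2) fun x hx => ⟨ha trivial, hx⟩
    rw [Scheme.basicOpen_mul, h2, inf_top_eq, h4] at h1
    exact h1.trans h3
  refine ⟨hpre, fun r h k => ?_⟩
  refine IsPullFraction.of_pull_mul fun V hV1 hV2 => ?_
  have h1 := isPullFraction_dPlusFraction hn ha H hV1 (by
    rw [isUnit_iff_le_basicOpen, basicOpen_res, hbas g.1 (hM e g.2), ← hpre]
    exact le_inf le_rfl hV1) r h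
  have hV3 : V ≤ t.left ⁻¹ᵁ (chart L.j i ⊓ chart L.j k) := le_inf (le_top.trans ht) hV2
  have h2 := congrArg (pull t _ _ hV3) ((hM e g.2).1 i k)
  have h3 := congrArg (pull t _ _ hV3) ((hM _ h.2).1 i k)
  rw [map_mul, map_pow, pull_res, pull_res] at h2 h3
  have h4 : ∀ u : L.ChartFunctions, res T (le_top : V ≤ ⊤) (pullChart t i ht u) =
      pull t (chart L.j i) _ (le_top.trans ht) (u i) := fun u => res_pull _ _ _ _
  rw [h4, h4] at h1
  rw [h2, h3, ← h1, smul_eq_mul]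
  ring

lemma exists_isCanonicalFor_of_basicOpen (hM : ∀ n, M n ≤ L.invariantSections n) (t : T ⟶ X)
    {n : ℕ} (hn : 0 < n) (f : M n) (i : Fin L.N)
    (hf : ⊤ ≤ t.left ⁻¹ᵁ X.left.basicOpen (f.1 i)) :
    ∃ a : T ⟶ projOver (sumPiece M), IsCanonicalFor M t a := by
  have ht : ⊤ ≤ t.left ⁻¹ᵁ chart L.j i :=
    hf.trans (Scheme.Hom.preimage_mono _ (X.left.basicOpen_le _))
  obtain ⟨ψ, hψ⟩ := exists_algHom_dPlus M (pullChart t i ht) hn f (by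
    rw [isUnit_iff_le_basicOpen]
    exact (le_inf le_rfl hf).trans (basicOpen_pull _ _ _).ge)
  obtain ⟨a, ha, hpull⟩ := exists_pull_eq (isAffineOpen_dPlus M hn f) ψ
  exact ⟨a, isCanonicalFor_of_pull hM hn f i ht hf ha fun r h => by rw [hpull, hψ]⟩

/-- The canonical morphism exists on the union of the loci of invariant sections. -/
theorem exists_isCanonicalFor (hM : ∀ n, M n ≤ L.invariantSections n) (t : T ⟶ X)
    (ht : ∀ x : T.left, ∃ n, 0 < n ∧ ∃ f : M n, t.left x ∈ L.locus f) :
    ∃ a : T ⟶ projOver (sumPiece M), IsCanonicalFor M t a := by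
  choose n hn f hf using ht
  choose i hi using fun x => mem_locus.1 (hf x)
  let V : T.left → T.left.Opens := fun x => t.left ⁻¹ᵁ X.left.basicOpen ((f x).1 (i x))
  have hV : ⨆ x, V x = ⊤ :=
    eq_top_iff.2 fun x _ => TopologicalSpace.Opens.mem_iSup.2 ⟨x, hi x⟩
  have hVt : ∀ x, ⊤ ≤ (openIncl T (V x) ≫ t).left ⁻¹ᵁ X.left.basicOpen ((f x).1 (i x)) :=
    fun x y _ => y.2
  choose a ha using fun x => exists_isCanonicalFor_of_basicOpen hM (openIncl T (V x) ≫ t) (hn x)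
    (f x) (i x) (hVt x)
  obtain ⟨b, hb⟩ := exists_glue V hV a (fun x y S p p' hp => by
    have h1 := (ha x).comp p
    have h2 := (ha y).comp p'
    rw [← Category.assoc, ← hp, Category.assoc] at h2
    refine h1.unique hM h2 (hn x) (f x) fun z _ => ?_
    exact basicOpen_le_locus _ (i x) (hVt x (show p.left z ∈ ⊤ from trivial)))
  exact ⟨b, isCanonicalFor_of_cover V hV fun x => (hb x).symm ▸ ha x⟩

end Linearization

end Existence


/-! ### Quotients by linearized actions -/

section LinearizedQuotient

section OpenPull

variable {X Y : Over SpecC} {U : X.left.Opens}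

/-- If the pull-back of `s` is the fraction `h / fʳ` on the scheme `U`, then so is `openPull q D s`,
as a function on an open subset of `X`. -/
lemma IsPullFraction.res_eq {q : openSub X U ⟶ Y} {D : Y.left.Opens} {C : X.left.Opens}
    {s : Γ(Y.left, D)} {f h : Γ(X.left, C)} {r : ℕ}
    (H : IsPullFraction q (openIncl X U) s f r h) :
    res X (V := C ⊓ openPreimage q D) inf_le_left h =
      res X inf_le_left f ^ r * res X inf_le_right (openPull q D s) := by
  let V : U.toScheme.Opens := q.left ⁻¹ᵁ D ⊓ (openIncl X U).left ⁻¹ᵁ C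
  have h1 : V ≤ q.left ⁻¹ᵁ D := inf_le_left
  have h2 : V ≤ (openIncl X U).left ⁻¹ᵁ C := inf_le_right
  have hV : C ⊓ openPreimage q D ≤ U.ι ''ᵁ V := by
    rintro _ ⟨hx, y, hy, rfl⟩
    exact ⟨y, ⟨hy, hx⟩, rfl⟩
  have hle : U.ι ''ᵁ V ≤ openPreimage q D := Scheme.Hom.image_mono U.ι h1
  have e1 : pull q D V h1 s * pull (openIncl X U) C V h2 f ^ r = pull (openIncl X U) C V h2 h := H
  have e2 := congrArg (openSubEquiv X U V) e1
  have e3 : openSubEquiv X U V (pull q D V h1 s) =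
      res X hle (openPull q D s) := by
    have : pull q D V h1 s = res (openSub X U) h1 (pull q D (q.left ⁻¹ᵁ D) le_rfl s) := by
      rw [res_pull]
    rw [this]
    rfl
  rw [map_mul, map_pow, e3, openSubEquiv_pull_openIncl, openSubEquiv_pull_openIncl] at e2
  have e4 := congrArg (res X hV) e2
  rw [map_mul, map_pow, res_res, res_res, res_res] at e4
  rw [← e4, mul_comm]

lemma pull_bijective_of_isOpenImmersion {j : X ⟶ Y} [IsOpenImmersion j.left] {V : Y.left.Opens}
    (hV : V ≤ j.left.opensRange) : Function.Bijective (pull j V (j.left ⁻¹ᵁ V) le_rfl) := by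
  have := j.left.isIso_app V hV
  have h : Function.Bijective (j.left.app V).hom := ConcreteCategory.bijective_of_isIso _
  rw [← Scheme.Hom.appLE_eq_app] at h
  exact h

end OpenPull

attribute [local instance] MvPolynomial.gradedAlgebra

variable {A : Type} [CommRing A] [HopfAlgebra ℂ A] {X Y : Over SpecC} [ModObj (algGroup A) X]

lemma dPlusFraction_eq_zero {P : Type} [CommRing P] [Algebra ℂ P] (M : ℕ → Submodule ℂ P)
    [SetLike.GradedMonoid M] {n : ℕ} (f : M n) {r : ℕ} (h : M (r • n)) {m : ℕ}
    (h0 : f.1 ^ m * h.1 = 0) : dPlusFraction M f r h = 0 := by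
  refine projFraction_eq_zero (sumPiece M) (ofPiece M n f).2 (ofPiece M (r • n) h).2 (m := m) ?_
  refine Subtype.ext ?_
  change Polynomial.monomial n f.1 ^ m * Polynomial.monomial (r • n) h.1 = 0
  rw [Polynomial.monomial_pow, Polynomial.monomial_mul_monomial, h0, map_zero]

namespace Linearization

variable {L : Linearization A X} {M : ℕ → Submodule ℂ L.ChartFunctions} [SetLike.GradedMonoid M]
  {U : X.left.Opens} {j : Y ⟶ projOver (sumPiece M)} {q : openSub X U ⟶ Y} {n : ℕ}

lemma openPreimage_preimage_dPlus (hq : IsCanonicalFor M (openIncl X U) (q ≫ j)) (hn : 0 < n)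
    {f : M n} (hU : L.locus f ≤ U) : openPreimage q (j.left ⁻¹ᵁ dPlus M f) = L.locus f := by
  have h1 : q.left ⁻¹ᵁ j.left ⁻¹ᵁ dPlus M f = (openIncl X U).left ⁻¹ᵁ L.locus f := (hq n hn f).1
  unfold openPreimage
  rw [h1]
  refine le_antisymm (image_le_of_le_preimage le_rfl) fun x hx => ⟨⟨x, hU hx⟩, hx, rfl⟩

/-- The canonical morphism pulls `h / fʳ` back to `h / fʳ`. -/
lemma isFraction_openPull (hq : IsCanonicalFor M (openIncl X U) (q ≫ j)) (hn : 0 < n)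
    (f : M n) (r : ℕ) (h : M (r • n)) :
    L.IsFraction f.1 (openPreimage q (j.left ⁻¹ᵁ dPlus M f)) r h.1
      (openPull q _ (pull j (dPlus M f) _ le_rfl (dPlusFraction M f r h))) := by
  intro i
  refine IsPullFraction.res_eq (IsPullFraction.of_pull_mul fun V h1 h2 => ?_)
  have h3 := ((hq n hn f).2 r h i).pull_mul (V := V) h1 h2
  rw [← h3]
  congr 1
  exact pull_pull q j _ _ _

set_option maxHeartbeats 800000 in
/-- `D₊(f)` is the quotient of `X_f` if every invariant function on `X_f` is of the form `h / fʳ`,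
for some `h ∈ M (r n)`. -/
theorem isQuotientOver_preimage_dPlus (hX : ∀ V : X.left.Opens, IsCompact (V : Set X.left))
    (hM : ∀ n, M n ≤ L.invariantSections n) [IsOpenImmersion j.left]
    (hq : IsCanonicalFor M (openIncl X U) (q ≫ j)) (hn : 0 < n) (f : M n)
    (hU : L.locus f ≤ U) (hj : dPlus M f ≤ j.left.opensRange)
    (H : ∀ W : X.left.Opens, W = L.locus f → ∀ g ∈ invariants (algGroup A) X W,
      ∃ (r : ℕ) (h : M (r • n)), L.IsFraction f.1 W r h.1 g) :
    IsQuotientOver (algGroup A) q (j.left ⁻¹ᵁ dPlus M f) := by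
  have hpre := openPreimage_preimage_dPlus hq hn hU
  have hsurj : ∀ s : Γ(Y.left, j.left ⁻¹ᵁ dPlus M f), ∃ r h,
      s = pull j (dPlus M f) _ le_rfl (dPlusFraction M f r h) := fun s => by
    obtain ⟨s', rfl⟩ := (pull_bijective_of_isOpenImmersion hj).2 s
    obtain ⟨r, h, rfl⟩ := exists_eq_dPlusFraction M hn f s'
    exact ⟨r, h, rfl⟩
  refine IsQuotientOver.of_forall (hpre ▸ isStable_locus (hM n f.2)) (fun s hs => ?_) (fun s => ?_)
    fun g hg => ?_
  · obtain ⟨r, h, rfl⟩ := hsurj s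
    have h1 := isFraction_openPull hq hn f r h
    rw [hs] at h1
    obtain ⟨m, hm⟩ := h1.exists_pow_mul_eq_zero hX (hM n f.2) hpre
    exact (congrArg (pull j (dPlus M f) _ le_rfl) (dPlusFraction_eq_zero M f h hm)).trans
      (map_zero (pull j (dPlus M f) _ le_rfl))
  · obtain ⟨r, h, rfl⟩ := hsurj s
    exact (isFraction_openPull hq hn f r h).mem_invariants (hM n f.2) (hM _ h.2) hpre
  · obtain ⟨r, h, hg'⟩ := H _ hpre g hg
    exact ⟨pull j (dPlus M f) _ le_rfl (dPlusFraction M f r h),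
      (isFraction_openPull hq hn f r h).unique (hM n f.2) hpre.le hg'⟩

end Linearization

end LinearizedQuotient


/-! ### Finiteness and separatedness of quotients -/

section Finiteness

/-- Open subsets of schemes of finite type over `ℂ` are compact. -/
lemma isCompact_of_finiteType {X : Over SpecC} (h : LocallyOfFiniteType X.hom)
    (h' : QuasiCompact X.hom) (V : X.left.Opens) : IsCompact (V : Set X.left) := by
  have : IsNoetherianRing (CommRingCat.of ℂ) := inferInstanceAs (IsNoetherianRing ℂ)
  have h1 : IsLocallyNoetherian X.left :=
    LocallyOfFiniteType.isLocallyNoetherian (X := X.left) (Y := SpecC) X.hom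
  have h2 : CompactSpace X.left :=
    (quasiCompact_iff_compactSpace (X := X.left) (Y := SpecC) X.hom).1 h'
  have : IsNoetherian X.left := {}
  exact TopologicalSpace.NoetherianSpace.isCompact _

lemma IsVariety.isCompact {X : Over SpecC} (hX : IsVariety X) (V : X.left.Opens) :
    IsCompact (V : Set X.left) :=
  isCompact_of_finiteType hX.locallyOfFiniteType hX.quasiCompact V

lemma IsVariety.isCompact_algGroup_tensor {A : Type} [CommRing A] [Algebra ℂ A]
    [Algebra.FiniteType ℂ A] {X : Over SpecC} (hX : IsVariety X)
    (V : (algGroup A ⊗ X).left.Opens) : IsCompact (V : Set (algGroup A ⊗ X).left) := by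
  have h1 : LocallyOfFiniteType (algGroup A).hom :=
    (HasRingHomProperty.Spec_iff (P := @LocallyOfFiniteType)).2
      (RingHom.finiteType_algebraMap.2 inferInstance)
  have h2 : QuasiCompact (algGroup A).hom :=
    inferInstanceAs (QuasiCompact (Spec.map (CommRingCat.ofHom (algebraMap ℂ A))))
  have h3 : LocallyOfFiniteType (Limits.pullback.snd (algGroup A).hom X.hom) := inferInstance
  have h4 : QuasiCompact (Limits.pullback.snd (algGroup A).hom X.hom) := inferInstance
  have := hX.locallyOfFiniteType
  have := hX.quasiCompact
  have h5 : (snd (algGroup A) X).left ≫ X.hom = (algGroup A ⊗ X).hom := Over.w _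
  refine isCompact_of_finiteType ?_ ?_ V
  · rw [← h5, Over.snd_left]
    infer_instance
  · rw [← h5, Over.snd_left]
    infer_instance

variable {A : Type} [CommRing A] [HopfAlgebra ℂ A] {X Y : Over SpecC} [ModObj (algGroup A) X]
  {U : X.left.Opens} {q : openSub X U ⟶ Y}

/-- Open subsets of `Y` cover `D` if their inverse images cover `q⁻¹(D)`: otherwise invariant
functions without common zero on `q⁻¹(D)` would lie in a proper ideal of the invariant
functions. -/
lemma IsQuotientOver.le_iSup_of_openPreimage_le (hA : IsReductive A) {D : Y.left.Opens}
    (h : IsQuotientOver (algGroup A) q D) (hD : IsAffineOpen D)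
    (hW : IsAffineOpen (openPreimage q D)) {κ : Type*} (V : κ → Y.left.Opens)
    (hV : openPreimage q D ≤ ⨆ k, openPreimage q (V k)) : D ≤ ⨆ k, V k := by
  let S : Set Γ(Y.left, D) := {a | ∃ k, Y.left.basicOpen a ≤ V k}
  have hmem : ∀ a, openPull q D a ∈ invariants (algGroup A) X (openPreimage q D) := fun a =>
    h.range_eq ▸ ⟨a, rfl⟩
  let e : Γ(Y.left, D) →ₐ[ℂ] invariants (algGroup A) X (openPreimage q D) :=
    (openPull q D).codRestrict _ hmem
  have he : Function.Bijective e := by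
    refine ⟨fun s t hst => h.injective (congrArg Subtype.val hst), fun b => ?_⟩
    obtain ⟨a, ha⟩ : b.1 ∈ (openPull q D).range := by
      rw [h.range_eq]
      exact b.2
    exact ⟨a, Subtype.ext ha⟩
  have h1 : Ideal.span ((invariants (algGroup A) X (openPreimage q D)).val '' (e '' S)) = ⊤ := by
    rw [← hW.self_le_iSup_basicOpen_iff]
    intro x hx
    obtain ⟨k, hk⟩ := TopologicalSpace.Opens.mem_iSup.1 (hV hx)
    obtain ⟨y, hy, rfl⟩ := hx
    obtain ⟨y', hy', hyy⟩ := hk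
    obtain rfl : y' = y := Subtype.ext hyy
    have hyD : q.left y' ∈ D := hy
    have hyV : q.left y' ∈ V k := hy'
    obtain ⟨a, ha, hya⟩ := hD.exists_basicOpen_le ⟨_, hyV⟩ hyD
    refine TopologicalSpace.Opens.mem_iSup.2 ⟨⟨openPull q D a, e a, ⟨a, ⟨k, ha⟩, rfl⟩, rfl⟩, ?_⟩
    change _ ∈ X.left.basicOpen (openPull q D a)
    rw [← openPreimage_basicOpen]
    exact ⟨y', hya, rfl⟩
  have h2 := hA.invariants_span_eq_top hW h.isStable _ h1
  have h3 : Ideal.span S = ⊤ := by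
    have := Ideal.comap_map_of_bijective e he (I := Ideal.span S)
    rwa [Ideal.map_span, h2, Ideal.comap_top, eq_comm] at this
  refine (hD.self_le_iSup_basicOpen_iff.2 h3).trans (iSup_le fun a => ?_)
  obtain ⟨k, hk⟩ := a.2
  exact hk.trans (le_iSup V k)

/-- The quotient of a quasi-compact open set by a reductive group is quasi-compact, as finitely many
of the `q⁻¹(D)` cover `U`. -/
theorem quasiCompact_of_isQuotientOver (hA : IsReductive A) (hU : IsCompact (U : Set X.left))
    {κ : Type*} (D : κ → Y.left.Opens) (hcov : ⨆ k, D k = ⊤) (hD : ∀ k, IsAffineOpen (D k))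
    (hW : ∀ k, IsAffineOpen (openPreimage q (D k)))
    (h : ∀ k, IsQuotientOver (algGroup A) q (D k)) : QuasiCompact Y.hom := by
  have hpre : (U : Set X.left) ⊆ ⋃ k, (openPreimage q (D k) : Set X.left) := by
    have h1 : openPreimage q ⊤ = ⨆ k, openPreimage q (D k) := by rw [← openPreimage_iSup, hcov]
    intro x hx
    have h2 : x ∈ openPreimage q ⊤ := ⟨⟨x, hx⟩, trivial, rfl⟩
    rw [h1] at h2
    obtain ⟨k, hk⟩ := TopologicalSpace.Opens.mem_iSup.1 h2
    exact Set.mem_iUnion.2 ⟨k, hk⟩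
  obtain ⟨t, ht⟩ := hU.elim_finite_subcover _ (fun k => (openPreimage q (D k)).isOpen) hpre
  have h1 : ∀ k, D k ≤ ⨆ l : t, D l := fun k =>
    (h k).le_iSup_of_openPreimage_le hA (hD k) (hW k) (fun l : t => D l) fun x hx => by
      have hxU : x ∈ (U : Set X.left) := by
        obtain ⟨y, -, rfl⟩ := hx
        exact y.2
      obtain ⟨l, hl, hxl⟩ := Set.mem_iUnion₂.1 (ht hxU)
      exact TopologicalSpace.Opens.mem_iSup.2 ⟨⟨l, hl⟩, hxl⟩
  have h2 : (⊤ : Y.left.Opens) ≤ ⨆ l : t, D l := hcov ▸ iSup_le h1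
  refine (quasiCompact_iff_compactSpace (X := Y.left) (Y := SpecC) Y.hom).2 ⟨?_⟩
  have h3 : IsCompact (⋃ l : t, (D l : Set Y.left)) :=
    isCompact_iUnion fun l => (hD l).isCompact
  refine (Set.univ_subset_iff.1 fun y _ => ?_ : (⋃ l : t, (D l : Set Y.left)) = Set.univ) ▸ h3
  obtain ⟨l, hl⟩ := TopologicalSpace.Opens.mem_iSup.1 (h2 (show y ∈ ⊤ from trivial))
  exact Set.mem_iUnion.2 ⟨l, hl⟩

lemma isSeparated_of_projOver {R : Type} [CommRing R] [Algebra ℂ R] {𝒜 : ℕ → Submodule ℂ R}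
    [GradedAlgebra 𝒜] (j : Y ⟶ projOver 𝒜) [IsOpenImmersion j.left] : IsSeparated Y.hom := by
  have h1 : IsSeparated (Proj.toSpecZero 𝒜 ≫
    Spec.map (CommRingCat.ofHom (algebraMap ℂ (𝒜 0)))) := inferInstance
  have h2 : IsSeparated (projOver 𝒜).hom := h1
  rw [← Over.w j]
  exact MorphismProperty.comp_mem _ _ _ inferInstance h2

/-- Morphisms can be factored through open immersions. -/
lemma exists_comp_eq_of_isOpenImmersion {T Z : Over SpecC} (j : Y ⟶ Z) [IsOpenImmersion j.left]
    (m : T ⟶ Z) (h : ⊤ ≤ m.left ⁻¹ᵁ j.left.opensRange) : ∃ q : T ⟶ Y, q ≫ j = m := by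
  have h1 : Set.range m.left ⊆ Set.range j.left := by
    rintro _ ⟨x, rfl⟩
    exact h (show x ∈ ⊤ from trivial)
  refine ⟨Over.homMk (IsOpenImmersion.lift j.left m.left h1) ?_, Over.OverMorphism.ext
    (IsOpenImmersion.lift_fac j.left m.left h1)⟩
  rw [← Over.w j, ← Category.assoc, IsOpenImmersion.lift_fac, Over.w]

end Finiteness

section LinearizedQuotient

attribute [local instance] MvPolynomial.gradedAlgebra

variable {A : Type} [CommRing A] [HopfAlgebra ℂ A] {X Y : Over SpecC}
  [ModObj (algGroup A) X]

namespace Linearization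

/-- The quotient of the union of the affine open subsets `X_f`, for a family of invariant sections
`f`, is the union of the open subsets `D₊(f)`. -/
theorem exists_quotient (hA : IsReductive A) {PG : PoissonStructure (algGroup A)}
    (hX : IsVariety X) {PX : PoissonStructure X} (hact : IsPoissonAction PG PX)
    {L : Linearization A X} {M : ℕ → Submodule ℂ L.ChartFunctions} [SetLike.GradedMonoid M]
    (hM : ∀ n, M n ≤ L.invariantSections n) {U : X.left.Opens} (j : Y ⟶ projOver (sumPiece M))
    [IsOpenImmersion j.left] {κ : Type} (n : κ → ℕ) (hn : ∀ k, 0 < n k) (f : ∀ k, M (n k))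
    (haff : ∀ k, IsAffineOpen (L.locus (f k).1)) (hU : ⨆ k, L.locus (f k).1 = U)
    (hj : ⨆ k, dPlus M (f k) = j.left.opensRange)
    (H : ∀ k, ∀ W : X.left.Opens, W = L.locus (f k).1 → ∀ g ∈ invariants (algGroup A) X W,
      ∃ (r : ℕ) (h : M (r • n k)), L.IsFraction (f k).1 W r h.1 g) :
    IsVariety Y ∧ (IsIntegral X.left → Nonempty Y.left → IsIntegral Y.left) ∧
      ∃ q : openSub X U ⟶ Y, IsCanonicalFor M (openIncl X U) (q ≫ j) ∧
        ∃ PY : PoissonStructure Y, IsPoisson (PX.openRestrict U) PY q := by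
  have hlocus : ∀ k, L.locus (f k).1 ≤ U := fun k => hU ▸ le_iSup (fun k => L.locus (f k).1) k
  have hmem : ∀ x ∈ U, ∃ k, x ∈ L.locus (f k).1 := fun x hx =>
    TopologicalSpace.Opens.mem_iSup.1 (hU.ge hx)
  obtain ⟨m, hm⟩ := exists_isCanonicalFor hM (openIncl X U) fun x => by
    obtain ⟨k, hk⟩ := hmem _ x.2
    exact ⟨n k, hn k, f k, hk⟩
  have hdj : ∀ k, dPlus M (f k) ≤ j.left.opensRange := fun k =>
    hj ▸ le_iSup (fun k => dPlus M (f k)) k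
  obtain ⟨q, rfl⟩ := exists_comp_eq_of_isOpenImmersion j m fun x _ => by
    obtain ⟨k, hk⟩ := hmem _ x.2
    exact hdj k ((hm (n k) (hn k) (f k)).1.ge hk)
  let D : κ → Y.left.Opens := fun k => j.left ⁻¹ᵁ dPlus M (f k)
  have hcov : ⨆ k, D k = ⊤ := by
    rw [← Scheme.Hom.preimage_iSup, hj, Scheme.Hom.preimage_opensRange]
  have hD : ∀ k, IsAffineOpen (D k) := fun k =>
    (isAffineOpen_dPlus M (hn k) (f k)).preimage_of_isOpenImmersion j.left (hdj k)
  have hW : ∀ k, IsAffineOpen (openPreimage q (D k)) := fun k =>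
    (openPreimage_preimage_dPlus hm (hn k) (hlocus k)).symm ▸ haff k
  have hDq : ∀ k, IsQuotientOver (algGroup A) q (D k) := fun k =>
    isQuotientOver_preimage_dPlus hX.isCompact hM hm (hn k) (f k) (hlocus k) (hdj k) (H k)
  have hq := isQuotientOver_of_cover D hcov hD hW hDq
  have := hX.isReduced
  refine ⟨⟨isReduced_of_isQuotientOver hq, isSeparated_of_projOver j,
    locallyOfFiniteType_of_isQuotientOver hA hX.locallyOfFiniteType D hcov hD hW hq,
    quasiCompact_of_isQuotientOver hA (hX.isCompact U) D hcov hD hW hDq⟩,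
    fun hint hne => isIntegral_of_isQuotientOver hne hq, q, hm, ?_⟩
  exact exists_isPoisson_of_isQuotientOver hact hq

end Linearization

end LinearizedQuotient


/-! ### Quasi-projective quotients -/

section QuasiProjective

attribute [local instance] MvPolynomial.gradedAlgebra

variable {A : Type} [CommRing A] [HopfAlgebra ℂ A] {X : Over SpecC} [ModObj (algGroup A) X]

namespace Linearization

/-- The quotient of a quasi-projective Poisson variety. -/
theorem quasiProjective_quotient [Algebra.FiniteType ℂ A] (hA : IsReductive A)
    {PG : PoissonStructure (algGroup A)} (hX : IsVariety X) {PX : PoissonStructure X}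
    (hact : IsPoissonAction PG PX) (L : Linearization A X) :
    IsVariety L.quotient ∧
      (IsIntegral X.left → Nonempty L.quotient.left → IsIntegral L.quotient.left) ∧
      ∃ q : openSub X L.semistable ⟶ L.quotient,
        L.IsCanonical L.invariantSections L.semistable (q ≫ openIncl _ L.quotientOpen) ∧
        ∃ PY : PoissonStructure L.quotient,
          IsPoisson (PX.openRestrict L.semistable) PY q := by
  let κ : Type := {p : Σ n, L.invariantSections n // 0 < p.1 ∧ IsAffineOpen (L.locus p.2.1)}
  have hj : IsOpenImmersion (openIncl (projOver (sumPiece L.invariantSections))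
      L.quotientOpen).left := inferInstanceAs (IsOpenImmersion L.quotientOpen.ι)
  refine exists_quotient hA hX hact (fun n => le_rfl)
    (openIncl (projOver (sumPiece L.invariantSections)) L.quotientOpen) (κ := κ)
    (fun k => k.1.1) (fun k => k.2.1) (fun k => k.1.2) (fun k => k.2.2) ?_ ?_
    fun k W hW g hg => ?_
  · refine le_antisymm (iSup_le fun k => ?_) (iSup_le fun n => iSup_le fun hn => iSup_le fun f =>
      iSup_le fun hf => le_iSup (fun k : κ => L.locus k.1.2.1) ⟨⟨n, f⟩, hn, hf⟩)
    exact le_iSup_of_le k.1.1 (le_iSup_of_le k.2.1 (le_iSup_of_le k.1.2 (le_iSup_of_le k.2.2 le_rfl)))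
  · refine Eq.trans ?_ (Scheme.Opens.opensRange_ι L.quotientOpen).symm
    refine le_antisymm (iSup_le fun k => ?_) (iSup_le fun n => iSup_le fun hn => iSup_le fun f =>
      iSup_le fun hf => le_iSup (fun k : κ => dPlus L.invariantSections k.1.2) ⟨⟨n, f⟩, hn, hf⟩)
    exact le_iSup_of_le k.1.1 (le_iSup_of_le k.2.1 (le_iSup_of_le k.1.2 (le_iSup_of_le k.2.2 le_rfl)))
  · obtain ⟨r, h, hh⟩ := exists_isFraction hX.isCompact k.1.2.2 hW g
    obtain ⟨m, hm⟩ := hh.exists_pow_mul_mem hX.isCompact hX.isCompact_algGroup_tensor k.1.2.2 hW hg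
    exact ⟨m + r, ⟨_, hm⟩, hh.pow_mul_num m⟩

end Linearization

end QuasiProjective


/-! ### Projective quotients -/

section Projective

lemma aeval_mul_pow_of_isHomogeneous {σ B : Type*} [CommRing B] [Algebra ℂ B]
    {F : MvPolynomial σ ℂ} {n : ℕ} (hF : F.IsHomogeneous n) (g : σ → B) (c : B) :
    MvPolynomial.aeval g F * c ^ n = MvPolynomial.aeval (fun l => g l * c) F := by
  rw [MvPolynomial.aeval_def, MvPolynomial.aeval_def, MvPolynomial.eval₂_eq,
    MvPolynomial.eval₂_eq, Finset.sum_mul]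
  refine Finset.sum_congr rfl fun d hd => ?_
  have h1 : d.degree = n := by
    have := hF (MvPolynomial.mem_support_iff.1 hd)
    rwa [Finsupp.degree_eq_weight_one]
  rw [mul_assoc, ← h1]
  congr 1
  simp only [mul_pow]
  rw [Finset.prod_mul_distrib, Finset.prod_pow_eq_pow_sum, Finsupp.degree_apply]

lemma pull_surjective_of_isClosedImmersion {X Y : Over SpecC} (j : X ⟶ Y)
    [IsClosedImmersion j.left] {V : Y.left.Opens} (hV : IsAffineOpen V) :
    Function.Surjective (pull j V (j.left ⁻¹ᵁ V) le_rfl) := by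
  have h := j.left.app_surjective V hV
  rw [← Scheme.Hom.appLE_eq_app] at h
  exact h

/-- `Proj (⨁ M n)` is covered by the `D₊(f)` for `f` of positive degree. -/
lemma iSup_dPlus_eq_top {P : Type} [CommRing P] [Algebra ℂ P] (M : ℕ → Submodule ℂ P)
    [SetLike.GradedMonoid M] :
    ⨆ p : {p : Σ n, M n // 0 < p.1}, dPlus M p.1.2 = ⊤ := by
  refine Proj.iSup_basicOpen_eq_top (sumPiece M)
    (fun p : {p : Σ n, M n // 0 < p.1} => (ofPiece M p.1.1 p.1.2 : sumRing M)) ?_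
  refine (HomogeneousIdeal.toIdeal_irrelevant_le _).2 fun i hi F hF => ?_
  obtain ⟨u, rfl⟩ := exists_eq_ofPiece M hF
  exact Ideal.subset_span ⟨⟨⟨i, u⟩, hi⟩, rfl⟩

/-- Functions on `D₊(f)` are elements of the localization of `R` at `f`. -/
lemma exists_injective_projFraction_mul {R : Type} [CommRing R] [Algebra ℂ R] (𝒜 : ℕ → Submodule ℂ R)
    [GradedAlgebra 𝒜] {d : ℕ} {f : R} (hf : f ∈ 𝒜 d) (hd : 0 < d) :
    ∃ ψ : Γ((projOver 𝒜).left, Proj.basicOpen 𝒜 f) →ₐ[ℂ] Localization.Away f,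
      Function.Injective ψ ∧ ∀ r h hh, ψ (projFraction 𝒜 f hf r h hh) *
        algebraMap R _ f ^ r = algebraMap R _ h := by
  have hu : IsUnit (algebraMap R (Localization.Away f) f) :=
    IsLocalization.Away.algebraMap_isUnit f
  obtain ⟨ψ, hψ⟩ := exists_algHom_basicOpen 𝒜
    (IsScalarTower.toAlgHom ℂ R (Localization.Away f)) hf hd hu
  refine ⟨ψ, (injective_iff_map_eq_zero ψ).2 fun s hs => ?_, hψ⟩
  obtain ⟨r, h, hh, rfl⟩ := exists_eq_projFraction 𝒜 hf hd s
  have h1 := hψ r h hh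
  rw [hs, zero_mul] at h1
  obtain ⟨⟨_, m, rfl⟩, hm⟩ := (IsLocalization.map_eq_zero_iff (Submonoid.powers f)
    (Localization.Away f) h).1 h1.symm
  exact projFraction_eq_zero 𝒜 hf hh hm

attribute [local instance] MvPolynomial.gradedAlgebra

/-- The open subset `F ≠ 0` of `ℙ(V)`. -/
def hypersurfaceCompl {N : ℕ} (F : MvPolynomial (Fin N) ℂ) : (projSpace N).left.Opens :=
  Proj.basicOpen (MvPolynomial.homogeneousSubmodule (Fin N) ℂ) F

/-- The function `F / xᵢⁿ` on `D₊(xᵢ) ⊆ ℙ(V)`, for a form `F` of degree `n`. -/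
def formFraction {N n : ℕ} (i : Fin N) (F : MvPolynomial (Fin N) ℂ) (hF : F.IsHomogeneous n) :
    Γ((projSpace N).left, hypersurfaceCompl (MvPolynomial.X i)) :=
  projFraction (MvPolynomial.homogeneousSubmodule (Fin N) ℂ) (MvPolynomial.X i) (X_mem i) n F
    (by rw [smul_eq_mul, mul_one]; exact hF)

/-- The function `F / xᵢⁿ` is `F(x₁ / xᵢ, …, x_N / xᵢ)`. -/
lemma formFraction_eq_aeval {N n : ℕ} (i : Fin N) {F : MvPolynomial (Fin N) ℂ}
    (hF : F.IsHomogeneous n) :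
    formFraction i F hF = MvPolynomial.aeval
      (fun l => formFraction i (MvPolynomial.X l) (MvPolynomial.isHomogeneous_X ℂ l)) F := by
  obtain ⟨ψ, hψ, h⟩ := exists_injective_projFraction_mul
    (MvPolynomial.homogeneousSubmodule (Fin N) ℂ) (X_mem i) zero_lt_one
  have hu : IsUnit (algebraMap (MvPolynomial (Fin N) ℂ)
      (Localization.Away (MvPolynomial.X i : MvPolynomial (Fin N) ℂ)) (MvPolynomial.X i)) :=
    IsLocalization.Away.algebraMap_isUnit _
  apply hψ
  refine (hu.pow n).mul_right_cancel ?_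
  have h1 : ψ (formFraction i F hF) * algebraMap (MvPolynomial (Fin N) ℂ)
      (Localization.Away (MvPolynomial.X i : MvPolynomial (Fin N) ℂ)) (MvPolynomial.X i) ^ n =
      algebraMap _ _ F := h n F _
  have h2 : ∀ l, ψ (formFraction i (MvPolynomial.X l) (MvPolynomial.isHomogeneous_X ℂ l)) *
      algebraMap (MvPolynomial (Fin N) ℂ)
      (Localization.Away (MvPolynomial.X i : MvPolynomial (Fin N) ℂ)) (MvPolynomial.X i) =
      algebraMap _ _ (MvPolynomial.X l) := fun l => by
    have := h 1 (MvPolynomial.X l) ((one_smul ℕ 1).symm ▸ X_mem l)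
    rwa [pow_one] at this
  have h3 := MvPolynomial.comp_aeval_apply (f := MvPolynomial.X)
    (IsScalarTower.toAlgHom ℂ (MvPolynomial (Fin N) ℂ)
    (Localization.Away (MvPolynomial.X i : MvPolynomial (Fin N) ℂ))) F
  rw [MvPolynomial.aeval_X_left_apply] at h3
  have h4 := MvPolynomial.comp_aeval_apply
    (f := fun l => formFraction i (MvPolynomial.X l) (MvPolynomial.isHomogeneous_X ℂ l)) ψ F
  refine h1.trans (Eq.trans ?_ (congrArg (· * _) h4.symm))
  refine Eq.trans ?_ (aeval_mul_pow_of_isHomogeneous hF _ _).symm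
  refine h3.trans ?_
  congr 2
  exact funext fun l => (h2 l).symm

/-- The function `P / Fʳ` on the open subset `F ≠ 0` of `ℙ(V)`. -/
def hypersurfaceFraction {N n : ℕ} {F : MvPolynomial (Fin N) ℂ} (hF : F.IsHomogeneous n) {r : ℕ}
    {P : MvPolynomial (Fin N) ℂ} (hP : P.IsHomogeneous (r • n)) :
    Γ((projSpace N).left, hypersurfaceCompl F) :=
  projFraction (MvPolynomial.homogeneousSubmodule (Fin N) ℂ) F hF r P hP

lemma res_hypersurfaceFraction_mul {N n : ℕ} (i : Fin N) {F : MvPolynomial (Fin N) ℂ}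
    (hF : F.IsHomogeneous n) {r : ℕ} {P : MvPolynomial (Fin N) ℂ} (hP : P.IsHomogeneous (r • n)) :
    res (projSpace N) (V := hypersurfaceCompl (MvPolynomial.X i) ⊓ hypersurfaceCompl F) inf_le_right
        (hypersurfaceFraction hF hP) *
      res (projSpace N) inf_le_left (formFraction i (F ^ r) (hF.pow r)) =
      res (projSpace N) inf_le_left (formFraction i P hP) := by
  refine res_projFraction_mul (MvPolynomial.homogeneousSubmodule (Fin N) ℂ) (X_mem i) hF hP _ _ ?_
  rw [smul_eq_mul, mul_comm n r]
  ring

variable {A : Type} [CommRing A] [HopfAlgebra ℂ A] {X : Over SpecC} [ModObj (algGroup A) X]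

namespace Linearization

variable (L : Linearization A X)

lemma chart_le (i : Fin L.N) :
    chart L.j i ≤ L.j.left ⁻¹ᵁ hypersurfaceCompl (MvPolynomial.X i) := le_rfl

lemma ofPolynomial_apply {n : ℕ} {F : MvPolynomial (Fin L.N) ℂ} (hF : F.IsHomogeneous n)
    (i : Fin L.N) :
    L.ofPolynomial F i = pull L.j _ (chart L.j i) (L.chart_le i) (formFraction i F hF) := by
  rw [formFraction_eq_aeval, MvPolynomial.comp_aeval_apply]
  rfl

/-- The locus of the section given by a form `F` is the intersection of `X` with `F ≠ 0`. -/
lemma locus_ofPolynomial {n : ℕ} {F : MvPolynomial (Fin L.N) ℂ} (hF : F.IsHomogeneous n) :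
    L.locus (L.ofPolynomial F) = L.j.left ⁻¹ᵁ hypersurfaceCompl F := by
  have h1 : ∀ i, X.left.basicOpen (L.ofPolynomial F i) =
      L.j.left ⁻¹ᵁ (hypersurfaceCompl (MvPolynomial.X i) ⊓ hypersurfaceCompl F) := fun i => by
    have h2 : (projSpace L.N).left.basicOpen (formFraction i F hF) =
      hypersurfaceCompl (MvPolynomial.X i) ⊓ hypersurfaceCompl F := basicOpen_projFraction _ _ _
    rw [L.ofPolynomial_apply hF, basicOpen_pull, h2]
    exact le_antisymm (fun x hx => hx.2) fun x hx => ⟨hx.1, hx⟩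
  refine le_antisymm (iSup_le fun i => (h1 i).le.trans fun x hx => hx.2) fun x hx => ?_
  obtain ⟨i, hi⟩ := exists_mem_chart L.j x
  exact TopologicalSpace.Opens.mem_iSup.2 ⟨i, (h1 i).ge ⟨hi, hx⟩⟩

/-- The restriction of `P / Fʳ` to `X` is the fraction of the sections given by `P` and `F`. -/
lemma isFraction_ofPolynomial {n : ℕ} {F : MvPolynomial (Fin L.N) ℂ} (hF : F.IsHomogeneous n)
    {r : ℕ} {P : MvPolynomial (Fin L.N) ℂ} (hP : P.IsHomogeneous (r • n)) :
    L.IsFraction (L.ofPolynomial F) (L.j.left ⁻¹ᵁ hypersurfaceCompl F) r (L.ofPolynomial P)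
      (pull L.j _ _ le_rfl (hypersurfaceFraction hF hP)) := by
  intro i
  have hV : chart L.j i ⊓ L.j.left ⁻¹ᵁ hypersurfaceCompl F ≤
    L.j.left ⁻¹ᵁ (hypersurfaceCompl (MvPolynomial.X i) ⊓ hypersurfaceCompl F) := fun x hx => hx
  have h1 := congrArg (pull L.j _ _ hV) (res_hypersurfaceFraction_mul i hF hP)
  rw [map_mul, pull_res, pull_res, pull_res] at h1
  rw [← map_pow, ← Pi.pow_apply, ← map_pow, L.ofPolynomial_apply hP, L.ofPolynomial_apply (hF.pow r),
    res_pull, res_pull, res_pull, ← h1, mul_comm]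

/-- The quotient of a projective variety. -/
theorem projective_quotient [Algebra.FiniteType ℂ A] (hA : IsReductive A)
    {PG : PoissonStructure (algGroup A)} (hX : IsVariety X) {PX : PoissonStructure X}
    (hact : IsPoissonAction PG PX) (L : Linearization A X) (hL : IsClosedImmersion L.j.left) :
    IsVariety L.projectiveQuotient ∧
      (IsIntegral X.left → Nonempty L.projectiveQuotient.left →
        IsIntegral L.projectiveQuotient.left) ∧
      ∃ q : openSub X L.projectiveSemistable ⟶ L.projectiveQuotient,
        L.IsCanonical L.invariantForms L.projectiveSemistable q ∧
        ∃ PY : PoissonStructure L.projectiveQuotient,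
          IsPoisson (PX.openRestrict L.projectiveSemistable) PY q := by
  let κ : Type := {p : Σ n, L.invariantForms n // 0 < p.1}
  have hM : ∀ n, L.invariantForms n ≤ L.invariantSections n := fun n => inf_le_left
  have hD : ∀ {n : ℕ} (F : MvPolynomial (Fin L.N) ℂ), 0 < n → F.IsHomogeneous n →
      IsAffineOpen (hypersurfaceCompl F) := fun F hn hF =>
    Proj.isAffineOpen_basicOpen (MvPolynomial.homogeneousSubmodule (Fin L.N) ℂ) F hF hn
  have hj : IsOpenImmersion (𝟙 (projOver (sumPiece L.invariantForms)) :
      projOver (sumPiece L.invariantForms) ⟶ _).left :=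
    inferInstanceAs (IsOpenImmersion (𝟙 (Proj (sumPiece L.invariantForms))))
  have haff : ∀ k : κ, IsAffineOpen (L.locus k.1.2.1) := fun k => by
    obtain ⟨-, F, hF, hFk⟩ := k.1.2.2
    rw [← hFk]
    exact (L.locus_ofPolynomial hF).symm ▸ (hD F k.2 hF).preimage L.j.left
  have hU : ⨆ k : κ, L.locus k.1.2.1 = L.projectiveSemistable := by
    refine le_antisymm (iSup_le fun k => ?_) (iSup_le fun n => iSup_le fun hn => iSup_le fun f =>
      le_iSup (fun k : κ => L.locus k.1.2.1) ⟨⟨n, f⟩, hn⟩)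
    exact le_iSup_of_le k.1.1 (le_iSup_of_le k.2 (le_iSup_of_le k.1.2 le_rfl))
  have hcov : ⨆ k : κ, dPlus L.invariantForms k.1.2 = Scheme.Hom.opensRange
      (𝟙 (projOver (sumPiece L.invariantForms)) : projOver (sumPiece L.invariantForms) ⟶ _).left :=
    (iSup_dPlus_eq_top L.invariantForms).trans (Scheme.Hom.opensRange_of_isIso (𝟙 _)).symm
  have hfrac : ∀ k : κ, ∀ W : X.left.Opens, W = L.locus k.1.2.1 →
      ∀ g ∈ invariants (algGroup A) X W, ∃ (r : ℕ) (h : L.invariantForms (r • k.1.1)),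
        L.IsFraction k.1.2.1 W r h.1 g := by
    rintro ⟨⟨n, f⟩, hn⟩ W hW g hg
    obtain ⟨-, F, hF, hFk⟩ := f.2
    obtain rfl : W = L.j.left ⁻¹ᵁ hypersurfaceCompl F :=
      (hW.trans (congrArg L.locus hFk.symm)).trans (L.locus_ofPolynomial hF)
    -- as `X` is closed, `g` is the restriction of a function `P / Fʳ` on `F ≠ 0`
    obtain ⟨s, hs⟩ := pull_surjective_of_isClosedImmersion L.j (hD F hn hF) g
    obtain ⟨r, P, hP, rfl⟩ := exists_eq_projFraction
      (MvPolynomial.homogeneousSubmodule (Fin L.N) ℂ) hF hn s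
    have hg' : pull L.j _ _ le_rfl (hypersurfaceFraction hF hP) = g := hs
    have hh := L.isFraction_ofPolynomial hF hP
    rw [hg'] at hh
    obtain ⟨m, hm⟩ := hh.exists_pow_mul_mem hX.isCompact hX.isCompact_algGroup_tensor
      (n := n) (hFk ▸ hM n f.2) (L.locus_ofPolynomial hF).symm hg
    refine ⟨m + r, ⟨_, hm, F ^ m * P, ?_, by rw [AlgHom.toLinearMap_apply, map_mul, map_pow]⟩, ?_⟩
    · have := (hF.pow m).mul hP
      rwa [show n * m + r • n = (m + r) • n by simp only [smul_eq_mul]; ring] at this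
    · exact hFk ▸ hh.pow_mul_num m
  obtain ⟨h1, h2, q, h3, h4⟩ := exists_quotient hA hX hact hM
    (𝟙 (projOver (sumPiece L.invariantForms))) (fun k : κ => k.1.1) (fun k => k.2)
    (fun k => k.1.2) haff hU hcov hfrac
  exact ⟨h1, h2, q, (Category.comp_id q) ▸ h3, h4⟩

end Linearization

end Projective

end PoissonGIT

end

open PoissonGIT in
theorem mainTheorem7
    -- a reductive Poisson linear algebraic group
    (A : Type) [CommRing A] [HopfAlgebra ℂ A] [Algebra.FiniteType ℂ A] [IsReduced A]
    (hA : IsReductive A)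
    (PG : PoissonStructure (algGroup A)) (hPG : IsPoissonGroup A PG)
    -- acting on a Poisson variety, with Poisson action map
    (X : Over SpecC) [ModObj (algGroup A) X] (hX : IsVariety X)
    (PX : PoissonStructure X) (hact : IsPoissonAction PG PX) :
    -- the invariant functions form a Poisson subalgebra
    (∀ U : X.left.Opens, IsStable (algGroup A) X U →
      ∀ f ∈ invariants (algGroup A) X U, ∀ g ∈ invariants (algGroup A) X U,
        PX.bracket U f g ∈ invariants (algGroup A) X U) ∧
    -- affine varieties
    (IsAffine X.left →
      IsVariety (affineQuotient (algGroup A) X) ∧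
      (IsIntegral X.left → IsIntegral (affineQuotient (algGroup A) X).left) ∧
      ∃ PY : PoissonStructure (affineQuotient (algGroup A) X),
        IsPoisson PX PY (affineQuotientMap (algGroup A) X)) ∧
    -- linearized projective varieties
    (∀ L : Linearization A X, IsClosedImmersion L.j.left →
      IsVariety L.projectiveQuotient ∧
      (IsIntegral X.left → Nonempty L.projectiveQuotient.left →
        IsIntegral L.projectiveQuotient.left) ∧
      ∃ q : openSub X L.projectiveSemistable ⟶ L.projectiveQuotient,
        L.IsCanonical L.invariantForms L.projectiveSemistable q ∧
        ∃ PY : PoissonStructure L.projectiveQuotient,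
          IsPoisson (PX.openRestrict L.projectiveSemistable) PY q) ∧
    -- linearized quasi-projective varieties
    (∀ L : Linearization A X,
      IsVariety L.quotient ∧
      (IsIntegral X.left → Nonempty L.quotient.left → IsIntegral L.quotient.left) ∧
      ∃ q : openSub X L.semistable ⟶ L.quotient,
        L.IsCanonical L.invariantSections L.semistable (q ≫ openIncl _ L.quotientOpen) ∧
        ∃ PY : PoissonStructure L.quotient,
          IsPoisson (PX.openRestrict L.semistable) PY q) := by
  refine ⟨fun U _ f hf g hg => bracket_mem_invariants hact hf hg,
    affine_quotient hA hX hact, fun L => L.projective_quotient hA hX hact,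
    fun L => L.quasiProjective_quotient hA hX hact⟩
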